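/- Let $d\in\{2,3\}$ and let $\Omega\subset\mathbb{R}^d$ be a bounded smooth domain. Let $\phi\in C^1[0,\infty)\cap C^2(0,\infty)$ satisfy: $\phi(0)=\phi'(0)=0$ and $\phi''(t)>0$ for $t>0$; there are constants $0<c_0\le c_1$ with $c_0\phi'(t)\le \phi''(t)\,t\le c_1\phi'(t)$ for all $t\ge 0$ (at $t=0$, where $\phi''$ need not exist, the middle term is read as $0$); there is $p\in(1,2)$ with $\sup_{t\ge 0}\bigl(\phi'(t)t-p\,\phi(t)\bigr)<+\infty$; and there are constants $c$ and $\beta>0$ with $|\phi''(s+t)-\phi''(t)|\le c\,\phi''(t)\,(|s|/t)^\beta$ for all $t>0$ and $s\in\mathbb{R}$ with $|s|<t/2$. Let $S_0$ be the space of real symmetric traceless $3\times 3$ matrices, with $|\mathbf{Q}|^2=\sum_{i,j}Q_{ij}^2$. For $A,B,C>0$ let $$f_B(\mathbf{Q})=-\tfrac{A}{2}\operatorname{tr}\mathbf{Q}^2-\tfrac{B}{3}\operatorname{tr}\mathbf{Q}^3+\tfrac{C}{4}(\operatorname{tr}\mathbf{Q}^2)^2+M(A,B,C),$$ where the constant $M(A,B,C)$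 is such that $\min_{S_0}f_B=0$, and let $$\mathcal{N}=\bigl\{s_+(\mathbf{n}\otimes\mathbf{n}-\mathbf{I}/3):\mathbf{n}\in S^2\bigr\},\qquad s_+=\frac{B+\sqrt{B^2+24AC}}{4C}.$$ Let $L^\phi(\Omega)$ be the Orlicz space of measurable $u$ with $\int_\Omega\phi(|u|)<\infty$, with the Luxemburg norm, and let $W^{1,\phi}(\Omega)$ be the space of $u\in L^\phi(\Omega)$ whose weak gradient is in $L^\phi(\Omega)$; for a set $K$ of $3\times 3$ matrices, $W^{1,\phi}(\Omega;K)$ is the set of matrix-valued $W^{1,\phi}$ maps with values in $K$ almost everywhere. Equality on $\partial\Omega$ of two such maps means that their difference is in the closure $W^{1,\phi}_0$ of $C^\infty_c(\Omega)$ in $W^{1,\phi}(\Omega)$. Fix $\mathbf{Q}_b\in W^{1,\phi}(\Omega;\mathcal{N})$ and set $$\mathcal{A}=\bigl\{\mathbf{Q}\in W^{1,\phi}(\Omega;S_0): f_B(\mathbf{Q})\in L^1(\Omega),\ \mathbf{Q}=\mathbf{Q}_b\text{ on }\partial\Omega\bigr\}.$$ For every $L>0$ let $\mathbf{Q}_L$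 be a global minimizer in $\mathcal{A}$ of $$I_L[\mathbf{Q}]=\int_\Omega\Bigl(\phi(|\nabla\mathbf{Q}|)+\frac1L f_B(\mathbf{Q})\Bigr)\,dV .$$ Then there exist a sequence $L_k>0$ with $L_k\to 0$ and a map $\mathbf{Q}_0$ such that $\mathbf{Q}_{L_k}\rightharpoonup\mathbf{Q}_0$ weakly in $W^{1,\phi}(\Omega;S_0)$, and $\mathbf{Q}_0$ is a $\phi$-minimizing uniaxial harmonic map, that is, $\mathbf{Q}_0$ minimizes $\mathbf{Q}\mapsto\int_\Omega\phi(|\nabla\mathbf{Q}|)\,dV$ among all $\mathbf{Q}\in W^{1,\phi}(\Omega;\mathcal{N})$ with $\mathbf{Q}=\mathbf{Q}_b$ on $\partial\Omega$. Moreover, for every smooth subdomain $\omega\subset\subset\Omega$, $$\int_\omega\phi(|\nabla\mathbf{Q}_{L_k}|)\,dV\to\int_\omega\phi(|\nabla\mathbf{Q}_0|)\,dV,\qquad \frac1{L_k}\int_\omega f_B(\mathbf{Q}_{L_k})\,dV\to 0\qquad(k\to\infty).$$ -/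

import Mathlib

open Set Filter Topology MeasureTheory
open scoped ContDiff

noncomputable section

namespace LdG

/-- The physical space `ℝ^d`. -/
abbrev E (d : ℕ) := EuclideanSpace ℝ (Fin d)

/-- Real `3 × 3` matrices. -/
abbrev Mat := Matrix (Fin 3) (Fin 3) ℝ

/-! ### Domains -/

/-- A smooth domain: a nonempty connected open set which near each of its boundary points is the
strict sublevel set `{ρ < 0}` of a smooth function `ρ` with non-vanishing differential. -/
structure IsSmoothDomain {d : ℕ} (Ω : Set (E d)) : Prop where
  isOpen : IsOpen Ω
  isConnected : IsConnected Ω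
  smooth_boundary : ∀ x ∈ frontier Ω, ∃ U ∈ 𝓝 x, ∃ ρ : E d → ℝ,
    ContDiff ℝ ∞ ρ ∧ fderiv ℝ ρ x ≠ 0 ∧ Ω ∩ U = {y ∈ U | ρ y < 0}

/-- `V ⊂⊂ Ω`. -/
def CompactlyIn {d : ℕ} (V Ω : Set (E d)) : Prop :=
  IsCompact (closure V) ∧ closure V ⊆ Ω

/-! ### The elastic energy density -/

/-- The first derivative of a function on `[0, ∞)` (one-sided at `0`). -/
def d1 (φ : ℝ → ℝ) (t : ℝ) : ℝ := derivWithin φ (Ici 0) t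

/-- The second derivative of a function on `(0, ∞)`. -/
def d2 (φ : ℝ → ℝ) (t : ℝ) : ℝ := deriv (deriv φ) t

/-- The standing assumptions on `φ : [0, ∞) → ℝ`
(the values of `φ` at negative numbers are irrelevant). -/
structure IsElasticDensity (φ : ℝ → ℝ) : Prop where
  contDiffOn_one : ContDiffOn ℝ 1 φ (Ici 0)
  contDiffOn_two : ContDiffOn ℝ 2 φ (Ioi 0)
  map_zero : φ 0 = 0
  d1_zero : d1 φ 0 = 0
  d2_pos : ∀ t, 0 < t → 0 < d2 φ t
  characteristics : ∃ c₀ c₁ : ℝ, 0 < c₀ ∧ c₀ ≤ c₁ ∧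
    ∀ t, 0 ≤ t → c₀ * d1 φ t ≤ d2 φ t * t ∧ d2 φ t * t ≤ c₁ * d1 φ t
  subquadratic : ∃ p : ℝ, 1 < p ∧ p < 2 ∧
    BddAbove ((fun t => d1 φ t * t - p * φ t) '' Ici 0)
  holder : ∃ c β : ℝ, 0 < β ∧ ∀ t s : ℝ, 0 < t → |s| < t / 2 →
    |d2 φ (s + t) - d2 φ t| ≤ c * d2 φ t * (|s| / t) ^ β

/-! ### Weak derivatives -/

/-- `v` is the weak partial derivative `∂ₖ u` on the open set `Ω`. -/
structure IsWeakPartial {d : ℕ} (Ω : Set (E d)) (k : Fin d) (u v : E d → ℝ) : Prop where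
  locInt : LocallyIntegrableOn u Ω
  locInt_partial : LocallyIntegrableOn v Ω
  integral_eq : ∀ η : E d → ℝ, ContDiff ℝ ∞ η → HasCompactSupport η → tsupport η ⊆ Ω →
    ∫ x in Ω, u x * fderiv ℝ η x (EuclideanSpace.single k 1) = -∫ x in Ω, v x * η x

open Classical in
/-- The weak partial derivative `∂ₖ u` on `Ω` (unique almost everywhere), if there is one. -/
def weakPartial {d : ℕ} (Ω : Set (E d)) (k : Fin d) (u : E d → ℝ) : E d → ℝ :=
  if h : ∃ v, IsWeakPartial Ω k u v then h.choose else 0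

/-- The weak gradient `∇Q` with entries `Q_{ij,k}`. -/
def weakGrad {d : ℕ} (Ω : Set (E d)) (Q : E d → Mat) : E d → Fin d → Mat :=
  fun x k => Matrix.of fun i j => weakPartial Ω k (fun y => Q y i j) x

/-- The Euclidean norm `|Q| = (∑ Q_{ij}²)^{1/2}`. -/
def matNorm (Q : Mat) : ℝ := √(∑ i, ∑ j, Q i j ^ 2)

/-- The Euclidean norm `|D| = (∑ D_{ij,k}²)^{1/2}`. -/
def gradNorm {d : ℕ} (D : Fin d → Mat) : ℝ := √(∑ k, ∑ i, ∑ j, D k i j ^ 2)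

/-! ### Orlicz and Orlicz-Sobolev spaces -/

/-- `u ∈ L^φ(Ω)`. -/
def MemOrlicz {d : ℕ} (φ : ℝ → ℝ) (Ω : Set (E d)) (u : E d → ℝ) : Prop :=
  AEStronglyMeasurable u (volume.restrict Ω) ∧ IntegrableOn (fun x => φ |u x|) Ω

/-- The Luxemburg norm of `L^φ(Ω)`. -/
def luxNorm {d : ℕ} (φ : ℝ → ℝ) (Ω : Set (E d)) (u : E d → ℝ) : ℝ :=
  sInf {r : ℝ | 0 < r ∧ ∫⁻ x in Ω, ENNReal.ofReal (φ (|u x| / r)) ≤ 1}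

/-- `Q ∈ W^{1,φ}(Ω; M^{3×3})`. -/
structure MemW1 {d : ℕ} (φ : ℝ → ℝ) (Ω : Set (E d)) (Q : E d → Mat) : Prop where
  weakDiff : ∀ (k : Fin d) (i j : Fin 3), ∃ v, IsWeakPartial Ω k (fun x => Q x i j) v
  memOrlicz : MemOrlicz φ Ω (fun x => matNorm (Q x))
  memOrlicz_grad : MemOrlicz φ Ω (fun x => gradNorm (weakGrad Ω Q x))

/-- `W^{1,φ}(Ω; K)`: the maps in `W^{1,φ}` with values in `K` almost everywhere in `Ω`. -/
def W1 {d : ℕ} (φ : ℝ → ℝ) (Ω : Set (E d)) (K : Set Mat) : Set (E d → Mat) :=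
  {Q | MemW1 φ Ω Q ∧ ∀ᵐ x ∂volume.restrict Ω, Q x ∈ K}

/-- The norm of `W^{1,φ}(Ω)`. -/
def w1Norm {d : ℕ} (φ : ℝ → ℝ) (Ω : Set (E d)) (Q : E d → Mat) : ℝ :=
  luxNorm φ Ω (fun x => matNorm (Q x)) + luxNorm φ Ω (fun x => gradNorm (weakGrad Ω Q x))

/-- Smooth matrix-valued maps with compact support in `Ω`. -/
def TestMaps {d : ℕ} (Ω : Set (E d)) : Set (E d → Mat) :=
  {η | (∀ i j, ContDiff ℝ ∞ fun x => η x i j) ∧ HasCompactSupport η ∧ tsupport η ⊆ Ω}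

/-- `W^{1,φ}_0(Ω; M^{3×3})`: the closure of the test maps in `W^{1,φ}`. -/
def W10 {d : ℕ} (φ : ℝ → ℝ) (Ω : Set (E d)) : Set (E d → Mat) :=
  {Q | MemW1 φ Ω Q ∧ ∀ ε > 0, ∃ η ∈ TestMaps Ω, w1Norm φ Ω (Q - η) < ε}

/-- `Q = P` on `∂Ω`, for maps of class `W^{1,φ}`. -/
def EqOnBoundary {d : ℕ} (φ : ℝ → ℝ) (Ω : Set (E d)) (Q P : E d → Mat) : Prop :=
  Q - P ∈ W10 φ Ω

/-- `ℓ` is a bounded linear functional on the normed space `W^{1,φ}(Ω; K)`, for a linear space `K`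
of matrices (its values outside of `W^{1,φ}(Ω; K)` are irrelevant). -/
structure IsBoundedFunctional {d : ℕ} (φ : ℝ → ℝ) (Ω : Set (E d)) (K : Submodule ℝ Mat)
    (ℓ : (E d → Mat) → ℝ) : Prop where
  map_add : ∀ Q ∈ W1 φ Ω K, ∀ P ∈ W1 φ Ω K, ℓ (Q + P) = ℓ Q + ℓ P
  map_smul : ∀ (a : ℝ), ∀ Q ∈ W1 φ Ω K, ℓ (a • Q) = a * ℓ Q
  bound : ∃ c : ℝ, ∀ Q ∈ W1 φ Ω K, |ℓ Q| ≤ c * w1Norm φ Ω Q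

/-- Weak convergence of a sequence in `W^{1,φ}(Ω; K)`. -/
def TendstoWeakly {d : ℕ} (φ : ℝ → ℝ) (Ω : Set (E d)) (K : Submodule ℝ Mat)
    (Q : ℕ → E d → Mat) (Q₀ : E d → Mat) : Prop :=
  (∀ k, Q k ∈ W1 φ Ω K) ∧ Q₀ ∈ W1 φ Ω K ∧
    ∀ ℓ, IsBoundedFunctional φ Ω K ℓ → Tendsto (fun k => ℓ (Q k)) atTop (𝓝 (ℓ Q₀))

/-! ### Q-tensors and the bulk potential -/

/-- The space `S₀` of symmetric traceless `3 × 3` matrices. -/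
def S0 : Submodule ℝ Mat where
  carrier := {Q | Q.transpose = Q ∧ Q.trace = 0}
  add_mem' := by
    rintro P Q ⟨hP, hP'⟩ ⟨hQ, hQ'⟩
    exact ⟨by rw [Matrix.transpose_add, hP, hQ], by rw [Matrix.trace_add, hP', hQ', add_zero]⟩
  zero_mem' := ⟨Matrix.transpose_zero, Matrix.trace_zero _ _⟩
  smul_mem' := by
    rintro a Q ⟨hQ, hQ'⟩
    exact ⟨by rw [Matrix.transpose_smul, hQ], by rw [Matrix.trace_smul, hQ', smul_zero]⟩

/-- The bulk potential before normalization. -/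
def rawBulk (A B C : ℝ) (Q : Mat) : ℝ :=
  -(A / 2) * (Q ^ 2).trace - B / 3 * (Q ^ 3).trace + C / 4 * (Q ^ 2).trace ^ 2

/-- The bulk potential `f_B`, normalized by an additive constant to have minimum `0` on `S₀`. -/
def fB (A B C : ℝ) (Q : Mat) : ℝ :=
  rawBulk A B C Q - sInf (rawBulk A B C '' (S0 : Set Mat))

/-- `s₊ = (B + √(B² + 24AC)) / (4C)`. -/
def sPlus (A B C : ℝ) : ℝ := (B + √(B ^ 2 + 24 * A * C)) / (4 * C)

/-- The uniaxial tensors `s₊ (n ⊗ n - I/3)`, with `n` a unit vector. -/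
def Nmin (A B C : ℝ) : Set Mat :=
  {Q | ∃ n : E 3, ‖n‖ = 1 ∧
    Q = sPlus A B C • (Matrix.vecMulVec (⇑n) (⇑n) - (1 / 3 : ℝ) • (1 : Mat))}

/-! ### The variational problems -/

/-- `∫_V φ(|∇Q|)`, where `∇Q` is the weak gradient on `Ω`. -/
def elasticEnergy {d : ℕ} (φ : ℝ → ℝ) (Ω V : Set (E d)) (Q : E d → Mat) : ℝ :=
  ∫ x in V, φ (gradNorm (weakGrad Ω Q x))

/-- The modified Landau-de Gennes energy `∫_Ω φ(|∇Q|) + (1/L) f_B(Q)`. -/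
def energy {d : ℕ} (φ : ℝ → ℝ) (Ω : Set (E d)) (A B C L : ℝ) (Q : E d → Mat) : ℝ :=
  ∫ x in Ω, (φ (gradNorm (weakGrad Ω Q x)) + 1 / L * fB A B C (Q x))

/-- The admissible class with boundary datum `Qb`. -/
def Admissible {d : ℕ} (φ : ℝ → ℝ) (Ω : Set (E d)) (A B C : ℝ) (Qb : E d → Mat) :
    Set (E d → Mat) :=
  {Q | Q ∈ W1 φ Ω S0 ∧ IntegrableOn (fun x => fB A B C (Q x)) Ω ∧ EqOnBoundary φ Ω Q Qb}

/-- `Q` is a global minimizer of the modified Landau-de Gennes energy in the admissible class. -/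
def IsGlobalMinimizer {d : ℕ} (φ : ℝ → ℝ) (Ω : Set (E d)) (A B C : ℝ) (Qb : E d → Mat) (L : ℝ)
    (Q : E d → Mat) : Prop :=
  Q ∈ Admissible φ Ω A B C Qb ∧
    ∀ P ∈ Admissible φ Ω A B C Qb, energy φ Ω A B C L Q ≤ energy φ Ω A B C L P

/-- `Q` is a `φ`-minimizing uniaxial harmonic map with boundary datum `Qb`. -/
def IsPhiMinimizingUniaxial {d : ℕ} (φ : ℝ → ℝ) (Ω : Set (E d)) (A B C : ℝ) (Qb : E d → Mat)
    (Q : E d → Mat) : Prop :=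
  Q ∈ W1 φ Ω (Nmin A B C) ∧ EqOnBoundary φ Ω Q Qb ∧
    ∀ P ∈ W1 φ Ω (Nmin A B C), EqOnBoundary φ Ω P Qb →
      elasticEnergy φ Ω Ω Q ≤ elasticEnergy φ Ω Ω P

end LdG

end

/-!
Weak convergence of the minimizers is obtained here as a consequence of strong convergence, so that
neither reflexivity nor duality of Orlicz spaces plays a role. Everything is expressed through the
modular `J(u) = ∫ φ(|u|)`, for maps with values in Euclidean spaces.

Every uniaxial competitor `P` satisfies `f_B(P) = 0` almost everywhere
(`fB_of_mem_Nmin`), so minimality of `Q_L` gives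
`J(∇Q_L) + (1/L) ∫ f_B(Q_L) ≤ J(∇P)` (`IsGlobalMinimizer.modular_add_le`). With `P = Q_b` this
bounds the gradients in the modular sense, and the maps in `L⁴`, since `f_B` has quartic growth. As
`Q_L - Q_b` is a limit of test maps, Rellich's theorem (`exists_subseq_tendsto_L1`) yields a
subsequence converging in `L¹` and almost everywhere to a map `Q₀`. Since `∫ f_B(Q_L) → 0`, Fatou's
lemma gives `f_B(Q₀) = 0`, that is, `Q₀` is uniaxial (`ae_mem_Nmin_of_tendsto`); the `L⁴` bound
and the subquadratic growth of `φ` upgrade the convergence to `J(Q_L - Q₀) → 0`.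

The characteristics condition `c₀ φ' ≤ φ'' t` says that `φ(t)` is a convex function of `t ^ (1 + c₀)`.
This makes `J` uniformly convex (`exists_modular_sub_le`). Choosing in the convex hull of each tail of
the sequence of gradients an element of almost minimal energy therefore gives a Cauchy sequence,
whose limit has to be `∇Q₀` (`exists_grad_of_tendsto_modular`). Hence `Q₀` is weakly differentiable
with the boundary values of `Q_b`, and `J(∇Q₀) ≤ liminf J(∇Q_L) ≤ J(∇P)` for all uniaxial
competitors `P`, so `Q₀` is `φ`-minimizing. As `Q₀` is itself a competitor, `J(∇Q_L) ≤ J(∇Q₀)`.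
Lower semicontinuity along the midpoints `(Q_L + Q₀) / 2` and uniform convexity then give
`J(∇Q_L - ∇Q₀) → 0` (`tendsto_modular_grad_sub`). This strong convergence implies the weak convergence
and the convergence of the energies on every measurable subset of `Ω`, and the bulk term is at most
`J(∇Q₀) - J(∇Q_L) → 0`.
-/

namespace LdG

/-! ### Elastic densities -/

/-- The properties of an elastic density that the variational argument uses: `φ` is a doubling
convex density, and it is a convex function of a power `t ^ q` with `q > 1`. The last property is
what makes the modular `∫ φ(|·|)` uniformly convex. -/
structure IsPowerConvexDensity (φ : ℝ → ℝ) : Prop where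
  continuousOn : ContinuousOn φ (Ici 0)
  map_zero : φ 0 = 0
  pos : ∀ t, 0 < t → 0 < φ t
  monotoneOn : MonotoneOn φ (Ici 0)
  convexOn : ConvexOn ℝ (Ici 0) φ
  doubling : ∃ K, ∀ t, 0 ≤ t → φ (2 * t) ≤ K * φ t
  power_convexOn : ∃ q : ℝ, 1 < q ∧ ConvexOn ℝ (Ici 0) (fun x => φ (x ^ (1 / q)))

/-- A differential inequality `f' t ≤ p f` bounds the growth of `f` by that of `t ^ p`. It turns
the characteristics condition on `φ'` and the bound on `φ' t - p φ` into growth estimates. -/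
theorem antitoneOn_mul_rpow_neg {f f' : ℝ → ℝ} {p : ℝ}
    (hf : ∀ t, 0 < t → HasDerivAt f (f' t) t) (h : ∀ t, 0 < t → f' t * t ≤ p * f t) :
    AntitoneOn (fun t => f t * t ^ (-p)) (Ioi 0) := by
  have hd : ∀ t : ℝ, 0 < t → HasDerivAt (fun t => f t * t ^ (-p))
      (f' t * t ^ (-p) + f t * (-p * t ^ (-p - 1))) t := fun t ht =>
    (hf t ht).mul (Real.hasDerivAt_rpow_const (Or.inl ht.ne'))
  refine antitoneOn_of_deriv_nonpos (convex_Ioi 0)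
    (fun t ht => (hd t ht).continuousAt.continuousWithinAt) ?_ ?_
  · rw [interior_Ioi]
    exact fun t ht => (hd t ht).differentiableAt.differentiableWithinAt
  · rw [interior_Ioi]
    intro t ht
    have ht : 0 < t := ht
    rw [(hd t ht).deriv]
    have e : t ^ (-p) = t ^ (-p - 1) * t := by
      rw [Real.rpow_sub_one ht.ne']; field_simp
    have := mul_nonneg (Real.rpow_nonneg ht.le (-p - 1)) (sub_nonneg.2 (h t ht))
    rw [e]; nlinarith

namespace IsElasticDensity

variable {φ : ℝ → ℝ}

theorem hasDerivAt (h : IsElasticDensity φ) {t : ℝ} (ht : 0 < t) :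
    HasDerivAt φ (d1 φ t) t := by
  have hm : Ici (0 : ℝ) ∈ 𝓝 t := Ici_mem_nhds ht
  have := (h.contDiffOn_one.differentiableOn one_ne_zero t ht.le).differentiableAt hm
  rw [d1, derivWithin_of_mem_nhds hm]
  exact this.hasDerivAt

theorem hasDerivAt_d1 (h : IsElasticDensity φ) {t : ℝ} (ht : 0 < t) :
    HasDerivAt (d1 φ) (d2 φ t) t := by
  have h1 : ContDiffOn ℝ 1 (deriv φ) (Ioi 0) :=
    h.contDiffOn_two.deriv_of_isOpen isOpen_Ioi (by norm_num)
  have h2 := (h1.differentiableOn one_ne_zero t ht).differentiableAt (Ioi_mem_nhds ht)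
  refine h2.hasDerivAt.congr_of_eventuallyEq ?_
  filter_upwards [Ioi_mem_nhds ht] with s hs
  exact derivWithin_of_mem_nhds (Ici_mem_nhds hs)

theorem continuousOn_d1 (h : IsElasticDensity φ) : ContinuousOn (d1 φ) (Ici 0) :=
  h.contDiffOn_one.continuousOn_derivWithin (uniqueDiffOn_Ici 0) le_rfl

theorem strictMonoOn_d1 (h : IsElasticDensity φ) : StrictMonoOn (d1 φ) (Ici 0) := by
  refine strictMonoOn_of_deriv_pos (convex_Ici 0) h.continuousOn_d1 fun t ht => ?_
  rw [interior_Ici] at ht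
  rw [(h.hasDerivAt_d1 ht).deriv]
  exact h.d2_pos t ht

theorem d1_pos (h : IsElasticDensity φ) {t : ℝ} (ht : 0 < t) : 0 < d1 φ t := by
  have := h.strictMonoOn_d1 self_mem_Ici ht.le ht
  rwa [h.d1_zero] at this

theorem strictMonoOn (h : IsElasticDensity φ) : StrictMonoOn φ (Ici 0) := by
  refine strictMonoOn_of_deriv_pos (convex_Ici 0) h.contDiffOn_one.continuousOn fun t ht => ?_
  rw [interior_Ici] at ht
  rw [(h.hasDerivAt ht).deriv]
  exact h.d1_pos ht

theorem convexOn (h : IsElasticDensity φ) : ConvexOn ℝ (Ici 0) φ := by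
  refine MonotoneOn.convexOn_of_deriv (convex_Ici 0) h.contDiffOn_one.continuousOn ?_ ?_
  · rw [interior_Ici]
    exact fun t ht => (h.hasDerivAt ht).differentiableAt.differentiableWithinAt
  · rw [interior_Ici]
    intro s hs t ht hst
    rw [(h.hasDerivAt hs).deriv, (h.hasDerivAt ht).deriv]
    exact h.strictMonoOn_d1.monotoneOn (mem_Ici_of_Ioi hs) (mem_Ici_of_Ioi ht) hst

/-- Since `(φ' t)' ≤ (1 + c₁) φ'`, integration gives `φ' t ≤ (1 + c₁) φ`, whence `φ(t) t ^ (-1 - c₁)` is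
nonincreasing. -/
theorem doubling (h : IsElasticDensity φ) : ∃ K, ∀ t, 0 ≤ t → φ (2 * t) ≤ K * φ t := by
  obtain ⟨c₀, c₁, -, -, hc⟩ := h.characteristics
  -- `φ'(t) t ≤ (1 + c₁) φ(t)`, since the difference is monotone and vanishes at `0`
  have hm : MonotoneOn (fun t => (1 + c₁) * φ t - d1 φ t * t) (Ici 0) := by
    have hd : ∀ t, 0 < t → HasDerivAt (fun t => (1 + c₁) * φ t - d1 φ t * t)
        ((1 + c₁) * d1 φ t - (d2 φ t * t + d1 φ t * 1)) t := fun t ht =>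
      ((h.hasDerivAt ht).const_mul _).sub ((h.hasDerivAt_d1 ht).mul (hasDerivAt_id t))
    refine monotoneOn_of_deriv_nonneg (convex_Ici 0)
      ((h.contDiffOn_one.continuousOn.const_smul (1 + c₁)).sub
        (h.continuousOn_d1.mul continuousOn_id)) ?_ ?_
    · rw [interior_Ici]
      exact fun t ht => (hd t ht).differentiableAt.differentiableWithinAt
    · rw [interior_Ici]
      intro t ht
      rw [(hd t ht).deriv]
      have := (hc t (mem_Ici_of_Ioi ht)).2
      linarith
  have hg : ∀ t, 0 < t → d1 φ t * t ≤ (1 + c₁) * φ t := by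
    intro t ht
    have := hm self_mem_Ici (mem_Ici.2 ht.le) ht.le
    simp only [h.map_zero, mul_zero, sub_zero] at this
    linarith
  have ha := antitoneOn_mul_rpow_neg (fun t ht => h.hasDerivAt ht) hg
  refine ⟨2 ^ (1 + c₁), fun t ht => ?_⟩
  rcases ht.eq_or_lt with rfl | ht
  · simp [h.map_zero]
  have h2 : (0 : ℝ) < 2 * t := by positivity
  have := ha (mem_Ioi.2 ht) (mem_Ioi.2 h2) (by linarith)
  simp only at this
  rw [Real.mul_rpow two_pos.le ht.le, Real.rpow_neg two_pos.le, ← mul_assoc] at this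
  have h3 := le_of_mul_le_mul_right this (Real.rpow_pos_of_pos ht _)
  rwa [← div_eq_mul_inv, div_le_iff₀ (by positivity), mul_comm (φ t)] at h3

/-- With `q = 1 + c₀`, the derivative of `φ(x ^ (1 / q))` is a multiple of `φ'(t) t ^ (-c₀)` at
`t = x ^ (1 / q)`, which is nondecreasing because `c₀ φ' ≤ φ'' t`. -/
theorem power_convexOn (h : IsElasticDensity φ) :
    ∃ q : ℝ, 1 < q ∧ ConvexOn ℝ (Ici 0) (fun x => φ (x ^ (1 / q))) := by
  obtain ⟨c₀, c₁, hc₀, -, hc⟩ := h.characteristics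
  have hq : 0 < 1 + c₀ := by linarith
  refine ⟨1 + c₀, by linarith, ?_⟩
  -- `φ'(t) t ^ (-c₀)` is monotone
  have hm : ∀ s t, 0 < s → s ≤ t → d1 φ s * s ^ (-c₀) ≤ d1 φ t * t ^ (-c₀) := by
    have := antitoneOn_mul_rpow_neg (f := fun t => - d1 φ t) (p := c₀)
      (fun t ht => (h.hasDerivAt_d1 ht).neg) (fun t ht => by
        have := (hc t ht.le).1
        linarith)
    intro s t hs hst
    have := this (mem_Ioi.2 hs) (mem_Ioi.2 (hs.trans_le hst)) hst
    simp only at this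
    linarith
  have hd : ∀ x : ℝ, 0 < x → HasDerivAt (fun x => φ (x ^ (1 / (1 + c₀))))
      (d1 φ (x ^ (1 / (1 + c₀))) * (1 / (1 + c₀) * x ^ (1 / (1 + c₀) - 1))) x := fun x hx =>
    HasDerivAt.comp (h := fun x : ℝ => x ^ (1 / (1 + c₀))) x
      (h.hasDerivAt (Real.rpow_pos_of_pos hx _)) (Real.hasDerivAt_rpow_const (Or.inl hx.ne'))
  refine MonotoneOn.convexOn_of_deriv (convex_Ici 0) ?_ ?_ ?_
  · refine h.contDiffOn_one.continuousOn.comp ?_ fun x hx => Real.rpow_nonneg hx _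
    exact (Real.continuous_rpow_const (by positivity)).continuousOn
  · rw [interior_Ici]
    exact fun t ht => (hd t ht).differentiableAt.differentiableWithinAt
  · rw [interior_Ici]
    intro x hx y hy hxy
    have hx : 0 < x := hx
    have hy : 0 < y := hy
    rw [(hd x hx).deriv, (hd y hy).deriv]
    have e : ∀ x : ℝ, 0 < x → x ^ (1 / (1 + c₀) - 1) = (x ^ (1 / (1 + c₀))) ^ (-c₀) := by
      intro x hx
      rw [← Real.rpow_mul hx.le]
      congr 1
      field_simp
      ring
    rw [e x hx, e y hy]
    have := hm _ _ (Real.rpow_pos_of_pos hx (1 / (1 + c₀)))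
      (Real.rpow_le_rpow hx.le hxy (by positivity))
    have h2 := mul_le_mul_of_nonneg_left this (show 0 ≤ 1 / (1 + c₀) by positivity)
    linarith

theorem isPowerConvexDensity (h : IsElasticDensity φ) : IsPowerConvexDensity φ where
  continuousOn := h.contDiffOn_one.continuousOn
  map_zero := h.map_zero
  pos t ht := by
    have := h.strictMonoOn self_mem_Ici (mem_Ici.2 ht.le) ht
    rwa [h.map_zero] at this
  monotoneOn := h.strictMonoOn.monotoneOn
  convexOn := h.convexOn
  doubling := h.doubling
  power_convexOn := h.power_convexOn

/-- The growth of an elastic density is at most quadratic. -/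
theorem le_sq (h : IsElasticDensity φ) : ∃ C, 0 ≤ C ∧ ∀ t, 1 ≤ t → φ t ≤ C * t ^ 2 := by
  obtain ⟨p, hp1, hp2, b, hb⟩ := h.subquadratic
  set K := max b 0 with hK
  have hK0 : 0 ≤ K := le_max_right _ _
  have hp : 0 < p := by linarith
  have hpos : 0 ≤ φ 1 := (h.isPowerConvexDensity.pos 1 one_pos).le
  have ha := antitoneOn_mul_rpow_neg (f := fun t => φ t + K / p) (f' := d1 φ) (p := p)
    (fun t ht => (h.hasDerivAt ht).add_const _) (fun t ht => by
      have h1 : d1 φ t * t - p * φ t ≤ b := hb ⟨t, ht.le, rfl⟩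
      have h2 : b ≤ K := le_max_left _ _
      have : p * (φ t + K / p) = p * φ t + K := by field_simp
      linarith)
  refine ⟨φ 1 + K / p, by positivity, fun t ht => ?_⟩
  have ht0 : 0 < t := by linarith
  have h1 := ha (mem_Ioi.2 one_pos) (mem_Ioi.2 ht0) ht
  simp only [Real.one_rpow, mul_one] at h1
  rw [Real.rpow_neg ht0.le, ← div_eq_mul_inv, div_le_iff₀ (by positivity)] at h1
  have h2 : t ^ p ≤ t ^ (2 : ℕ) := by
    rw [← Real.rpow_natCast]
    exact Real.rpow_le_rpow_of_exponent_le ht (by norm_num; linarith)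
  have h3 : 0 ≤ K / p := by positivity
  calc φ t ≤ φ t + K / p := by linarith
    _ ≤ _ := h1
    _ ≤ _ := by gcongr

end IsElasticDensity

end LdG

namespace LdG

/-! ### Uniform convexity of the energy density -/

section PowerConvexity

variable {H : Type*} [NormedAddCommGroup H] [InnerProductSpace ℝ H]

theorem norm_midpoint_rpow_le {q : ℝ} (hq : 1 < q) (x y : H) :
    ‖(1 / 2 : ℝ) • (x + y)‖ ^ q ≤ (‖x‖ ^ q + ‖y‖ ^ q) / 2 := by
  have h1 : ‖(1 / 2 : ℝ) • (x + y)‖ ≤ (1 / 2) * ‖x‖ + (1 / 2) * ‖y‖ := by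
    rw [norm_smul, ← mul_add, Real.norm_of_nonneg (by norm_num)]
    exact mul_le_mul_of_nonneg_left (norm_add_le _ _) (by norm_num)
  have h2 := (strictConvexOn_rpow hq).convexOn.2 (norm_nonneg x) (norm_nonneg y)
    (show (0 : ℝ) ≤ 1 / 2 by norm_num) (show (0 : ℝ) ≤ 1 / 2 by norm_num) (by norm_num)
  simp only [smul_eq_mul] at h2
  have h3 := Real.rpow_le_rpow (norm_nonneg _) h1 (by linarith : 0 ≤ q)
  linarith

theorem norm_midpoint_rpow_lt {q : ℝ} (hq : 1 < q) {x y : H} (hxy : x ≠ y) :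
    ‖(1 / 2 : ℝ) • (x + y)‖ ^ q < (‖x‖ ^ q + ‖y‖ ^ q) / 2 := by
  have hq0 : 0 < q := by linarith
  by_cases hn : ‖x‖ = ‖y‖
  · have h1 := (norm_midpoint_lt_iff hn).2 hxy
    have h2 := Real.rpow_lt_rpow (norm_nonneg _) h1 hq0
    rw [← hn]; linarith
  · have h1 : ‖(1 / 2 : ℝ) • (x + y)‖ ≤ (1 / 2) * ‖x‖ + (1 / 2) * ‖y‖ := by
      rw [norm_smul, ← mul_add, Real.norm_of_nonneg (by norm_num)]
      exact mul_le_mul_of_nonneg_left (norm_add_le _ _) (by norm_num)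
    have h2 := (strictConvexOn_rpow hq).2 (norm_nonneg x) (norm_nonneg y) hn
      (show (0 : ℝ) < 1 / 2 by norm_num) (show (0 : ℝ) < 1 / 2 by norm_num) (by norm_num)
    simp only [smul_eq_mul] at h2
    have h3 := Real.rpow_le_rpow (norm_nonneg _) h1 hq0.le
    linarith

variable [FiniteDimensional ℝ H]

/-- Uniform convexity of `‖·‖ ^ q`, `q > 1`, in a form that is additive in the two terms on the
right. By homogeneity it suffices to look at the compact set `‖x‖ ^ q + ‖y‖ ^ q = 1`. -/
theorem exists_norm_sub_rpow_le {q : ℝ} (hq : 1 < q) {ε : ℝ} (hε : 0 < ε) :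
    ∃ C, 0 ≤ C ∧ ∀ x y : H, ‖x - y‖ ^ q ≤
      C * ((‖x‖ ^ q + ‖y‖ ^ q) / 2 - ‖(1 / 2 : ℝ) • (x + y)‖ ^ q) +
        ε * (‖x‖ ^ q + ‖y‖ ^ q) := by
  have hq0 : 0 < q := by linarith
  have hc : Continuous fun t : ℝ => t ^ q := Real.continuous_rpow_const hq0.le
  let δ : H × H → ℝ := fun p => (‖p.1‖ ^ q + ‖p.2‖ ^ q) / 2 - ‖(1 / 2 : ℝ) • (p.1 + p.2)‖ ^ q
  have hδc : Continuous δ := by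
    refine (((hc.comp continuous_fst.norm).add (hc.comp continuous_snd.norm)).div_const _).sub
      (hc.comp ?_)
    fun_prop
  have hδ0 : ∀ p, 0 ≤ δ p := fun p => sub_nonneg.2 (norm_midpoint_rpow_le hq _ _)
  let S : Set (H × H) := {p | ‖p.1‖ ^ q + ‖p.2‖ ^ q = 1 ∧ ε ≤ ‖p.1 - p.2‖ ^ q}
  have hle1 : ∀ p : H × H, ‖p.1‖ ^ q + ‖p.2‖ ^ q = 1 → ‖p.1‖ ≤ 1 ∧ ‖p.2‖ ≤ 1 := by
    intro p hp
    have h1 := Real.rpow_nonneg (norm_nonneg p.1) q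
    have h2 := Real.rpow_nonneg (norm_nonneg p.2) q
    constructor <;>
    · by_contra! hh
      have := Real.one_lt_rpow hh hq0
      linarith
  have hS : IsCompact S := by
    refine Metric.isCompact_of_isClosed_isBounded ?_ ?_
    · exact (isClosed_eq ((hc.comp continuous_fst.norm).add (hc.comp continuous_snd.norm))
        continuous_const).inter
        (isClosed_le continuous_const (hc.comp (continuous_fst.sub continuous_snd).norm))
    · refine (Metric.isBounded_closedBall (x := (0 : H × H)) (r := 1)).subset fun p hp => ?_
      rw [mem_closedBall_zero_iff, Prod.norm_def]
      exact max_le (hle1 p hp.1).1 (hle1 p hp.1).2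
  have key : ∃ C, 0 ≤ C ∧ ∀ p : H × H, ‖p.1‖ ^ q + ‖p.2‖ ^ q = 1 →
      ‖p.1 - p.2‖ ^ q ≤ C * δ p + ε := by
    rcases S.eq_empty_or_nonempty with he | hne
    · refine ⟨0, le_rfl, fun p hp => ?_⟩
      by_contra! hh
      have : p ∈ S := ⟨hp, by linarith⟩
      simp [he] at this
    · obtain ⟨m, hmS, hm⟩ := hS.exists_isMinOn hne hδc.continuousOn
      have hm0 : 0 < δ m := by
        refine sub_pos.2 (norm_midpoint_rpow_lt hq fun h => ?_)
        have := hmS.2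
        rw [h, sub_self, norm_zero, Real.zero_rpow hq0.ne'] at this
        linarith
      refine ⟨2 ^ q / δ m, by positivity, fun p hp => ?_⟩
      by_cases hpS : ε ≤ ‖p.1 - p.2‖ ^ q
      · have h1 : δ m ≤ δ p := hm ⟨hp, hpS⟩
        have h2 : ‖p.1 - p.2‖ ≤ 2 :=
          (norm_sub_le _ _).trans (by linarith [(hle1 p hp).1, (hle1 p hp).2])
        have h3 := Real.rpow_le_rpow (norm_nonneg _) h2 hq0.le
        have h4 : (2 : ℝ) ^ q ≤ 2 ^ q / δ m * δ p := by
          rw [div_mul_eq_mul_div, le_div_iff₀ hm0]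
          gcongr
        linarith
      · have := mul_nonneg (show (0 : ℝ) ≤ 2 ^ q / δ m by positivity) (hδ0 p)
        linarith
  obtain ⟨C, hC, h⟩ := key
  refine ⟨C, hC, fun x y => ?_⟩
  set N := ‖x‖ ^ q + ‖y‖ ^ q with hN
  have hx0 := Real.rpow_nonneg (norm_nonneg x) q
  have hy0 := Real.rpow_nonneg (norm_nonneg y) q
  rcases (add_nonneg hx0 hy0).eq_or_lt with hz | hpos
  · have hx : x = 0 := by
      have : ‖x‖ ^ q = 0 := by linarith
      rwa [Real.rpow_eq_zero (norm_nonneg _) hq0.ne', norm_eq_zero] at this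
    have hy : y = 0 := by
      have : ‖y‖ ^ q = 0 := by linarith
      rwa [Real.rpow_eq_zero (norm_nonneg _) hq0.ne', norm_eq_zero] at this
    simp [hN, hx, hy, Real.zero_rpow hq0.ne']
  · have hl : 0 ≤ N ^ (-(1 / q)) := Real.rpow_nonneg hpos.le _
    have hsc : ∀ z : H, ‖N ^ (-(1 / q)) • z‖ ^ q = N⁻¹ * ‖z‖ ^ q := by
      intro z
      rw [norm_smul, Real.norm_of_nonneg hl, Real.mul_rpow hl (norm_nonneg _),
        ← Real.rpow_mul hpos.le, show -(1 / q) * q = -1 by field_simp, Real.rpow_neg_one]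
    have := h (N ^ (-(1 / q)) • x, N ^ (-(1 / q)) • y) (by
      simp only [hsc]
      rw [← mul_add, inv_mul_cancel₀ hpos.ne'])
    simp only [δ, ← smul_sub, ← smul_add, smul_comm (1 / 2 : ℝ), hsc] at this
    have h2 := mul_le_mul_of_nonneg_left this hpos.le
    have e : ∀ a : ℝ, N * (N⁻¹ * a) = a := fun a => by
      rw [← mul_assoc, mul_inv_cancel₀ hpos.ne', one_mul]
    rw [e] at h2
    refine h2.trans (le_of_eq ?_)
    have hN0 : N ≠ 0 := hpos.ne'
    field_simp
    rw [hN]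

end PowerConvexity

namespace IsPowerConvexDensity

variable {φ : ℝ → ℝ}

theorem nonneg (h : IsPowerConvexDensity φ) {t : ℝ} (ht : 0 ≤ t) : 0 ≤ φ t := by
  rcases ht.eq_or_lt with rfl | ht
  · exact h.map_zero.ge
  · exact (h.pos t ht).le

theorem mul_le (h : IsPowerConvexDensity φ) {a t : ℝ} (ha : 0 ≤ a) (ha1 : a ≤ 1) (ht : 0 ≤ t) :
    φ (a * t) ≤ a * φ t := by
  have := h.convexOn.2 (mem_Ici.2 ht) self_mem_Ici ha (sub_nonneg.2 ha1) (by ring)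
  simpa [h.map_zero] using this

/-- Iterated doubling. -/
theorem exists_mul_le (h : IsPowerConvexDensity φ) (a : ℝ) :
    ∃ K, 0 ≤ K ∧ ∀ s t, 0 ≤ s → s ≤ a * t → 0 ≤ t → φ s ≤ K * φ t := by
  obtain ⟨K, hK⟩ := h.doubling
  have hK' : ∀ n : ℕ, ∀ t, 0 ≤ t → φ (2 ^ n * t) ≤ (max K 0) ^ n * φ t := by
    intro n
    induction n with
    | zero => simp
    | succ n ih =>
      intro t ht
      calc φ (2 ^ (n + 1) * t) = φ (2 ^ n * (2 * t)) := by ring_nf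
        _ ≤ (max K 0) ^ n * φ (2 * t) := ih _ (by positivity)
        _ ≤ (max K 0) ^ n * (max K 0 * φ t) := by
          refine mul_le_mul_of_nonneg_left ((hK t ht).trans ?_) (by positivity)
          exact mul_le_mul_of_nonneg_right (le_max_left _ _) (h.nonneg ht)
        _ = _ := by ring
  obtain ⟨n, hn⟩ := pow_unbounded_of_one_lt a (one_lt_two (α := ℝ))
  refine ⟨(max K 0) ^ n, by positivity, fun s t hs hst ht => ?_⟩
  have h1 : s ≤ 2 ^ n * t := hst.trans (mul_le_mul_of_nonneg_right hn.le ht)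
  exact (h.monotoneOn (mem_Ici.2 hs) (mem_Ici.2 (hs.trans h1)) h1).trans (hK' n t ht)

/-- A convex density dominates a multiple of `t` beyond any given threshold. -/
theorem exists_le_add (h : IsPowerConvexDensity φ) {ε : ℝ} (hε : 0 < ε) :
    ∃ C, 0 ≤ C ∧ ∀ t, 0 ≤ t → t ≤ ε + C * φ t := by
  have hp := h.pos ε hε
  refine ⟨ε / φ ε, by positivity, fun t ht => ?_⟩
  rcases le_total t ε with hle | hle
  · have := mul_nonneg (show 0 ≤ ε / φ ε by positivity) (h.nonneg ht)
    linarith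
  · have ht0 : 0 < t := hε.trans_le hle
    have h1 := h.mul_le (a := ε / t) (by positivity) (div_le_one_of_le₀ hle ht) ht
    rw [div_mul_cancel₀ _ ht0.ne', div_mul_eq_mul_div, le_div_iff₀ ht0] at h1
    have h2 : t ≤ ε / φ ε * φ t := by
      rw [div_mul_eq_mul_div, le_div_iff₀ hp]
      linarith
    linarith

variable {H : Type*} [NormedAddCommGroup H]

theorem norm_nonneg (h : IsPowerConvexDensity φ) (x : H) : 0 ≤ φ ‖x‖ :=
  h.nonneg (_root_.norm_nonneg x)

theorem continuous_norm (h : IsPowerConvexDensity φ) : Continuous fun x : H => φ ‖x‖ :=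
  h.continuousOn.comp_continuous _root_.continuous_norm fun x => _root_.norm_nonneg x

theorem norm_convexOn (h : IsPowerConvexDensity φ) [NormedSpace ℝ H] :
    ConvexOn ℝ univ fun x : H => φ ‖x‖ := by
  refine ⟨convex_univ, fun x _ y _ a b ha hb hab => ?_⟩
  have h1 : ‖a • x + b • y‖ ≤ a * ‖x‖ + b * ‖y‖ := by
    refine (norm_add_le _ _).trans ?_
    rw [norm_smul, norm_smul, Real.norm_of_nonneg ha, Real.norm_of_nonneg hb]
  have h0 : 0 ≤ a * ‖x‖ + b * ‖y‖ := by positivity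
  exact (h.monotoneOn (mem_Ici.2 (_root_.norm_nonneg _)) (mem_Ici.2 h0) h1).trans
    (h.convexOn.2 (_root_.norm_nonneg x) (_root_.norm_nonneg y) ha hb hab)

theorem exists_norm_add_le (h : IsPowerConvexDensity φ) :
    ∃ K, 0 ≤ K ∧ ∀ (H : Type) [NormedAddCommGroup H] (x y : H),
      φ ‖x + y‖ ≤ K * (φ ‖x‖ + φ ‖y‖) := by
  obtain ⟨K, hK, hle⟩ := h.exists_mul_le 2
  refine ⟨K, hK, fun H _ x y => ?_⟩
  rcases le_total ‖x‖ ‖y‖ with hxy | hxy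
  · have := hle ‖x + y‖ ‖y‖ (_root_.norm_nonneg _) (by linarith [norm_add_le x y])
      (_root_.norm_nonneg _)
    nlinarith [mul_nonneg hK (h.norm_nonneg x)]
  · have := hle ‖x + y‖ ‖x‖ (_root_.norm_nonneg _) (by linarith [norm_add_le x y])
      (_root_.norm_nonneg _)
    nlinarith [mul_nonneg hK (h.norm_nonneg y)]

/-- The density changes little, relative to its size, under perturbations of small modular. -/
theorem exists_abs_sub_le (h : IsPowerConvexDensity φ) {ε : ℝ} (hε : 0 < ε) :
    ∃ C, 0 ≤ C ∧ ∀ (x y : H), |φ ‖x‖ - φ ‖y‖| ≤ ε * (φ ‖x‖ + φ ‖y‖) + C * φ ‖x - y‖ := by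
  obtain ⟨K, hK, hK2⟩ := h.exists_mul_le 2
  set θ := min 1 (ε / (K + 1)) with hθ
  have hθ0 : 0 < θ := lt_min one_pos (by positivity)
  have hθ1 : θ ≤ 1 := min_le_left _ _
  have hθK : θ * K ≤ ε := by
    have : θ ≤ ε / (K + 1) := min_le_right _ _
    rw [le_div_iff₀ (by linarith)] at this
    nlinarith
  obtain ⟨C, hC, hC2⟩ := h.exists_mul_le (1 / θ + 1)
  -- small increments are absorbed by convexity and doubling, large ones by doubling alone
  have key : ∀ s t r : ℝ, 0 ≤ s → 0 ≤ t → 0 ≤ r → s ≤ t + r →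
      φ s - φ t ≤ ε * φ t + C * φ r := by
    intro s t r hs ht hr hst
    have hφr := mul_nonneg hC (h.nonneg hr)
    have hφt := h.nonneg ht
    rcases le_total r (θ * t) with hrt | hrt
    · have h0 : 0 ≤ (1 - θ) * t + θ * (2 * t) := by nlinarith
      have h1 := h.monotoneOn (mem_Ici.2 hs) (mem_Ici.2 h0) (by linarith)
      have h2 := h.convexOn.2 (mem_Ici.2 ht) (mem_Ici.2 (by positivity : 0 ≤ 2 * t))
        (sub_nonneg.2 hθ1) hθ0.le (by ring)
      simp only [smul_eq_mul] at h2
      have h3 := mul_le_mul_of_nonneg_left (hK2 (2 * t) t (by positivity) le_rfl ht) hθ0.le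
      have h4 := mul_le_mul_of_nonneg_right hθK hφt
      nlinarith [mul_nonneg hθ0.le hφt]
    · have h1 : s ≤ (1 / θ + 1) * r := by
        have : t ≤ 1 / θ * r := by
          rw [div_mul_eq_mul_div, one_mul, le_div_iff₀ hθ0]; linarith
        linarith
      have h2 := hC2 s r hs h1 hr
      nlinarith
  refine ⟨C, hC, fun x y => abs_sub_le_iff.2 ⟨?_, ?_⟩⟩
  · have := key ‖x‖ ‖y‖ ‖x - y‖ (_root_.norm_nonneg _) (_root_.norm_nonneg _)
      (_root_.norm_nonneg _) (by have := norm_add_le y (x - y); rwa [add_sub_cancel] at this)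
    nlinarith [mul_nonneg hε.le (h.norm_nonneg x)]
  · have := key ‖y‖ ‖x‖ ‖x - y‖ (_root_.norm_nonneg _) (_root_.norm_nonneg _)
      (_root_.norm_nonneg _)
      (by have := norm_sub_le x (x - y); rwa [sub_sub_cancel] at this)
    nlinarith [mul_nonneg hε.le (h.norm_nonneg y)]

/-- The convexity defect `(φ(|x|) + φ(|y|)) / 2 - φ(|x + y| / 2)`. -/
noncomputable def defect [NormedSpace ℝ H] (φ : ℝ → ℝ) (x y : H) : ℝ :=
  (φ ‖x‖ + φ ‖y‖) / 2 - φ ‖(1 / 2 : ℝ) • (x + y)‖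

/-- Uniform convexity of `φ(|·|)`: up to a small part of the energy, the modular of a difference
is controlled by the convexity defect. With `φ(t) = h(t ^ q)`, it follows from the same property
of `|·| ^ q`, because a convex `h ≥ 0` vanishing at `0` is superadditive. -/
theorem exists_norm_sub_le_defect [InnerProductSpace ℝ H] [FiniteDimensional ℝ H]
    (h : IsPowerConvexDensity φ) {ε : ℝ} (hε : 0 < ε) :
    ∃ C, 0 ≤ C ∧ ∀ x y : H, φ ‖x - y‖ ≤ C * defect φ x y + ε * (φ ‖x‖ + φ ‖y‖) := by
  obtain ⟨q, hq, hconv⟩ := h.power_convexOn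
  have hq0 : 0 < q := by linarith
  set g : ℝ → ℝ := fun x => φ (x ^ (1 / q)) with hg
  have hφg : ∀ t, 0 ≤ t → φ t = g (t ^ q) := by
    intro t ht
    simp only [hg]
    rw [← Real.rpow_mul ht, mul_one_div_cancel hq0.ne', Real.rpow_one]
  have hgm : ∀ s t, 0 ≤ s → s ≤ t → g s ≤ g t := fun s t hs hst =>
    h.monotoneOn (mem_Ici.2 (Real.rpow_nonneg hs _))
      (mem_Ici.2 (Real.rpow_nonneg (hs.trans hst) _)) (Real.rpow_le_rpow hs hst (by positivity))
  have hg0 : g 0 = 0 := by simp [hg, Real.zero_rpow, hq0.ne', h.map_zero]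
  have hgn : ∀ t, 0 ≤ t → 0 ≤ g t := fun t ht => h.nonneg (Real.rpow_nonneg ht _)
  have hgmul : ∀ a t, 0 ≤ a → a ≤ 1 → 0 ≤ t → g (a * t) ≤ a * g t := by
    intro a t ha ha1 ht
    have := hconv.2 (mem_Ici.2 ht) self_mem_Ici ha (sub_nonneg.2 ha1) (by ring)
    simp only [smul_eq_mul, mul_zero, add_zero] at this
    change g (a * t) ≤ a * g t + (1 - a) * g 0 at this
    rwa [hg0, mul_zero, add_zero] at this
  have hsup : ∀ s t, 0 ≤ s → 0 ≤ t → g s + g t ≤ g (s + t) := by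
    intro s t hs ht
    rcases (add_nonneg hs ht).eq_or_lt with h0 | h0
    · have hs0 : s = 0 := by linarith
      have ht0 : t = 0 := by linarith
      simp [hs0, ht0, hg0]
    · have h1 := hgmul (s / (s + t)) (s + t) (by positivity)
        (div_le_one_of_le₀ (by linarith) h0.le) h0.le
      have h2 := hgmul (t / (s + t)) (s + t) (by positivity)
        (div_le_one_of_le₀ (by linarith) h0.le) h0.le
      rw [div_mul_cancel₀ _ h0.ne'] at h1 h2
      have : s / (s + t) * g (s + t) + t / (s + t) * g (s + t) = g (s + t) := by
        rw [← add_mul, ← add_div, div_self h0.ne', one_mul]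
      linarith
  set η := min (1 / 4) (ε / 2) with hη
  have hη0 : 0 < η := lt_min (by norm_num) (by linarith)
  obtain ⟨C, hC, hle⟩ := exists_norm_sub_rpow_le (H := H) hq hη0
  obtain ⟨K, hK, hK2⟩ := h.exists_mul_le ((2 * C) ^ (1 / q))
  refine ⟨K / 2, by positivity, fun x y => ?_⟩
  set a := ‖x‖ ^ q with ha
  set b := ‖y‖ ^ q with hb
  set m := ‖(1 / 2 : ℝ) • (x + y)‖ ^ q with hm
  have ha0 : 0 ≤ a := Real.rpow_nonneg (_root_.norm_nonneg _) _
  have hb0 : 0 ≤ b := Real.rpow_nonneg (_root_.norm_nonneg _) _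
  have hm0 : 0 ≤ m := Real.rpow_nonneg (_root_.norm_nonneg _) _
  set δ := (a + b) / 2 - m with hδ
  have hδ0 : 0 ≤ δ := sub_nonneg.2 (norm_midpoint_rpow_le hq x y)
  have hmid : g ((a + b) / 2) ≤ (g a + g b) / 2 := by
    have := hconv.2 (mem_Ici.2 ha0) (mem_Ici.2 hb0) (show (0 : ℝ) ≤ 1 / 2 by norm_num)
      (show (0 : ℝ) ≤ 1 / 2 by norm_num) (by norm_num)
    simp only [smul_eq_mul] at this
    change g (1 / 2 * a + 1 / 2 * b) ≤ 1 / 2 * g a + 1 / 2 * g b at this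
    rw [show (a + b) / 2 = 1 / 2 * a + 1 / 2 * b by ring]
    linarith
  have hdef : g δ ≤ defect φ x y := by
    rw [defect, hφg _ (_root_.norm_nonneg x), hφg _ (_root_.norm_nonneg y),
      hφg _ (_root_.norm_nonneg ((1 / 2 : ℝ) • (x + y)))]
    have := hsup m δ hm0 hδ0
    rw [hδ, add_sub_cancel] at this
    linarith
  have h1 : φ ‖x - y‖ ≤ g (C * δ + η * (a + b)) := by
    rw [hφg _ (_root_.norm_nonneg _)]
    exact hgm _ _ (Real.rpow_nonneg (_root_.norm_nonneg _) _) (hle x y)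
  have h2 : g (C * δ + η * (a + b)) ≤ 1 / 2 * g (2 * C * δ) + 1 / 2 * g (4 * η * ((a + b) / 2)) := by
    have := hconv.2 (mem_Ici.2 (show 0 ≤ 2 * C * δ by positivity))
      (mem_Ici.2 (show 0 ≤ 4 * η * ((a + b) / 2) by positivity))
      (show (0 : ℝ) ≤ 1 / 2 by norm_num) (show (0 : ℝ) ≤ 1 / 2 by norm_num) (by norm_num)
    simp only [smul_eq_mul] at this
    rwa [show 1 / 2 * (2 * C * δ) + 1 / 2 * (4 * η * ((a + b) / 2)) = C * δ + η * (a + b) by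
      ring] at this
  have h3 : g (2 * C * δ) ≤ K * g δ := by
    refine hK2 _ _ (Real.rpow_nonneg (by positivity) _) (le_of_eq ?_) (Real.rpow_nonneg hδ0 _)
    rw [Real.mul_rpow (by positivity) hδ0]
  have h4 : g (4 * η * ((a + b) / 2)) ≤ 4 * η * ((g a + g b) / 2) :=
    (hgmul _ _ (by positivity) (by linarith [min_le_left (1 / 4) (ε / 2)]) (by positivity)).trans
      (mul_le_mul_of_nonneg_left hmid (by positivity))
  have h5 : η * (g a + g b) ≤ ε * (g a + g b) :=
    mul_le_mul_of_nonneg_right (by linarith [min_le_right (1 / 4) (ε / 2)])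
      (add_nonneg (hgn _ ha0) (hgn _ hb0))
  have h6 := mul_le_mul_of_nonneg_left hdef hK
  rw [hφg _ (_root_.norm_nonneg x), hφg _ (_root_.norm_nonneg y)]
  linarith

end IsPowerConvexDensity

end LdG

namespace LdG

/-! ### The bulk potential -/

theorem exists_diagonalization {Q : Mat} (hQ : Q ∈ S0) :
    ∃ (U : Mat) (l : Fin 3 → ℝ), U * U.transpose = 1 ∧ U.transpose * U = 1 ∧
      Q = U * Matrix.diagonal l * U.transpose := by
  have hH : Q.IsHermitian := by
    rw [Matrix.IsHermitian, Matrix.conjTranspose_eq_transpose_of_trivial]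
    exact hQ.1
  have hs := hH.spectral_theorem
  rw [Unitary.conjStarAlgAut_apply] at hs
  refine ⟨hH.eigenvectorUnitary, hH.eigenvalues, ?_, ?_, ?_⟩
  · have := Unitary.mul_star_self_of_mem hH.eigenvectorUnitary.2
    rwa [Matrix.star_eq_conjTranspose, Matrix.conjTranspose_eq_transpose_of_trivial] at this
  · have := Unitary.star_mul_self_of_mem hH.eigenvectorUnitary.2
    rwa [Matrix.star_eq_conjTranspose, Matrix.conjTranspose_eq_transpose_of_trivial] at this
  · rw [Matrix.star_eq_conjTranspose, Matrix.conjTranspose_eq_transpose_of_trivial] at hs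
    exact hs

theorem trace_conj_diagonal {U : Mat} (hU : U.transpose * U = 1) (l : Fin 3 → ℝ) (n : ℕ) :
    ((U * Matrix.diagonal l * U.transpose) ^ n).trace = ∑ i, l i ^ n := by
  have hp : (U * Matrix.diagonal l * U.transpose) ^ n * U = U * Matrix.diagonal l ^ n := by
    induction n with
    | zero => simp
    | succ n ih =>
      have : U * Matrix.diagonal l * U.transpose * U = U * Matrix.diagonal l := by
        rw [Matrix.mul_assoc, hU, Matrix.mul_one]
      rw [pow_succ, Matrix.mul_assoc, this, ← Matrix.mul_assoc, ih, pow_succ, Matrix.mul_assoc]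
  have hU' : U * U.transpose = 1 := mul_eq_one_comm.1 hU
  calc ((U * Matrix.diagonal l * U.transpose) ^ n).trace
      = ((U * Matrix.diagonal l * U.transpose) ^ n * (U * U.transpose)).trace := by
        rw [hU', Matrix.mul_one]
    _ = (U * Matrix.diagonal l ^ n * U.transpose).trace := by rw [← Matrix.mul_assoc, hp]
    _ = (Matrix.diagonal l ^ n).trace := by
        rw [Matrix.trace_mul_comm, ← Matrix.mul_assoc, hU, Matrix.one_mul]
    _ = _ := by rw [Matrix.diagonal_pow, Matrix.trace_diagonal]; rfl

/-- A traceless symmetric matrix whose spectrum is `2s/3, -s/3, -s/3` is uniaxial. -/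
theorem conj_diagonal_eq_uniaxial {U : Mat} (hU : U * U.transpose = 1) {l : Fin 3 → ℝ} {s : ℝ}
    (j : Fin 3) (hj : l j = 2 * s / 3) (hl : ∀ i, i ≠ j → l i = -s / 3) :
    U * Matrix.diagonal l * U.transpose =
      s • (Matrix.vecMulVec (fun a => U a j) (fun a => U a j) - (1 / 3 : ℝ) • (1 : Mat)) := by
  have hd : Matrix.diagonal l = s • Matrix.single j j (1 : ℝ) - (s / 3) • (1 : Mat) := by
    ext a b
    by_cases hab : a = b
    · subst hab
      by_cases haj : a = j
      · subst haj
        simp [hj]; ring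
      · simp [hl a haj, Ne.symm haj]; ring
    · rw [Matrix.diagonal_apply_ne _ hab]
      have : ¬ (j = a ∧ j = b) := fun h => hab (h.1.symm.trans h.2)
      simp [this, Matrix.one_apply_ne hab]
  have hv : U * Matrix.single j j (1 : ℝ) * U.transpose =
      Matrix.vecMulVec (fun a => U a j) (fun a => U a j) := by
    ext a b
    simp [Matrix.mul_apply, Matrix.vecMulVec_apply, Matrix.single_apply, ite_and,
      Finset.sum_ite_eq]
  rw [hd, Matrix.mul_sub, Matrix.sub_mul, Matrix.mul_smul, Matrix.smul_mul, hv, Matrix.mul_smul,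
    Matrix.mul_one, Matrix.smul_mul, hU, smul_sub, smul_smul]
  congr 2
  ring

theorem trace_sq_of_mem_S0 {Q : Mat} (hQ : Q ∈ S0) : (Q ^ 2).trace = matNorm Q ^ 2 := by
  rw [matNorm, Real.sq_sqrt (by positivity), pow_two Q, Matrix.trace]
  refine Finset.sum_congr rfl fun i _ => ?_
  rw [Matrix.diag_apply, Matrix.mul_apply]
  refine Finset.sum_congr rfl fun j _ => ?_
  have : Q j i = Q i j := congr_fun (congr_fun hQ.1 i) j
  rw [this, sq]

/-- The cubic invariant is controlled by the quadratic one; equality forces two equal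
eigenvalues, since the difference is twice the discriminant of the characteristic polynomial. -/
theorem trace_cube_sq_le {Q : Mat} (hQ : Q ∈ S0) :
    6 * (Q ^ 3).trace ^ 2 ≤ (Q ^ 2).trace ^ 3 := by
  obtain ⟨U, l, -, hU, h⟩ := exists_diagonalization hQ
  have h1 := trace_conj_diagonal hU l 1
  have h0 : Q.trace = 0 := hQ.2
  rw [pow_one, ← h, h0, Fin.sum_univ_three] at h1
  rw [h, trace_conj_diagonal hU, trace_conj_diagonal hU, Fin.sum_univ_three, Fin.sum_univ_three]
  have h2 : l 2 = -l 0 - l 1 := by linarith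
  rw [h2]
  nlinarith [sq_nonneg ((l 0 - l 1) * (2 * l 0 + l 1) * (l 0 + 2 * l 1))]

/-- The bulk potential along the uniaxial tensors of order parameter `s`. -/
noncomputable def uniaxialBulk (A B C s : ℝ) : ℝ :=
  -A / 3 * s ^ 2 - 2 * B / 27 * s ^ 3 + C / 9 * s ^ 4

section

variable {A B C : ℝ}

theorem sPlus_pos (hA : 0 < A) (hB : 0 < B) (hC : 0 < C) : 0 < sPlus A B C := by
  unfold sPlus; positivity

theorem sPlus_eq (hA : 0 < A) (hC : 0 < C) :
    2 * C * sPlus A B C ^ 2 = B * sPlus A B C + 3 * A := by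
  have h := Real.sq_sqrt (show 0 ≤ B ^ 2 + 24 * A * C by positivity)
  unfold sPlus
  generalize √(B ^ 2 + 24 * A * C) = r at h
  field_simp
  linarith

/-- The order parameter `s₊` is a critical point of the uniaxial bulk potential, so `(s - s₊) ^ 2`
factors out. -/
theorem uniaxialBulk_sub (hA : 0 < A) (hC : 0 < C) (s : ℝ) :
    uniaxialBulk A B C s - uniaxialBulk A B C (sPlus A B C) = (s - sPlus A B C) ^ 2 *
      (C / 9 * s ^ 2 + (2 * C * sPlus A B C / 9 - 2 * B / 27) * s +
        (2 * C * sPlus A B C / 9 - 2 * B / 27) * sPlus A B C / 2) := by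
  have h := sPlus_eq (B := B) hA hC
  set t := sPlus A B C
  unfold uniaxialBulk
  linear_combination (1 / 9 * s ^ 2 - t ^ 2 / 9) * h

theorem uniaxialBulk_factor_pos (hA : 0 < A) (hB : 0 < B) (hC : 0 < C) {s : ℝ} (hs : 0 ≤ s) :
    0 < C / 9 * s ^ 2 + (2 * C * sPlus A B C / 9 - 2 * B / 27) * s +
        (2 * C * sPlus A B C / 9 - 2 * B / 27) * sPlus A B C / 2 := by
  have ht := sPlus_pos hA hB hC
  have h := sPlus_eq (B := B) hA hC
  have h1 : B < 2 * C * sPlus A B C := by nlinarith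
  have h2 : 0 < 2 * C * sPlus A B C / 9 - 2 * B / 27 := by linarith
  positivity

/-- At fixed `tr Q ^ 2`, the bulk potential exceeds its uniaxial value by a multiple of the deviation of
`tr Q ^ 3` from its maximum, which uniaxial tensors attain. -/
theorem rawBulk_eq {Q : Mat} (hQ : Q ∈ S0) :
    rawBulk A B C Q = uniaxialBulk A B C √(3 / 2 * (Q ^ 2).trace) +
      B / 3 * (2 / 9 * √(3 / 2 * (Q ^ 2).trace) ^ 3 - (Q ^ 3).trace) := by
  have hx : 0 ≤ (Q ^ 2).trace := by rw [trace_sq_of_mem_S0 hQ]; positivity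
  have hs := Real.sq_sqrt (show 0 ≤ 3 / 2 * (Q ^ 2).trace by positivity)
  set s := √(3 / 2 * (Q ^ 2).trace)
  have : (Q ^ 2).trace = 2 / 3 * s ^ 2 := by linarith
  rw [rawBulk, this, uniaxialBulk]
  ring

theorem trace_cube_le {Q : Mat} (hQ : Q ∈ S0) :
    (Q ^ 3).trace ≤ 2 / 9 * √(3 / 2 * (Q ^ 2).trace) ^ 3 := by
  have hx : 0 ≤ (Q ^ 2).trace := by rw [trace_sq_of_mem_S0 hQ]; positivity
  have hs := Real.sq_sqrt (show 0 ≤ 3 / 2 * (Q ^ 2).trace by positivity)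
  have hs0 := Real.sqrt_nonneg (3 / 2 * (Q ^ 2).trace)
  set s := √(3 / 2 * (Q ^ 2).trace)
  have h2 : (Q ^ 2).trace = 2 / 3 * s ^ 2 := by linarith
  have h := trace_cube_sq_le hQ
  rw [h2] at h
  refine abs_le_of_sq_le_sq' ?_ (by positivity) |>.2
  nlinarith

theorem uniaxialBulk_sPlus_le (hA : 0 < A) (hB : 0 < B) (hC : 0 < C) {Q : Mat} (hQ : Q ∈ S0) :
    uniaxialBulk A B C (sPlus A B C) ≤ rawBulk A B C Q := by
  have h1 := uniaxialBulk_sub (B := B) hA hC √(3 / 2 * (Q ^ 2).trace)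
  have h2 := uniaxialBulk_factor_pos hA hB hC (Real.sqrt_nonneg (3 / 2 * (Q ^ 2).trace))
  have h3 := mul_nonneg (sq_nonneg (√(3 / 2 * (Q ^ 2).trace) - sPlus A B C)) h2.le
  have h4 := mul_nonneg (show 0 ≤ B / 3 by positivity) (sub_nonneg.2 (trace_cube_le hQ))
  rw [rawBulk_eq hQ]
  linarith

theorem mem_Nmin_of_rawBulk_le (hA : 0 < A) (hB : 0 < B) (hC : 0 < C) {Q : Mat} (hQ : Q ∈ S0)
    (hle : rawBulk A B C Q ≤ uniaxialBulk A B C (sPlus A B C)) : Q ∈ Nmin A B C := by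
  have h1 := uniaxialBulk_sub (B := B) hA hC √(3 / 2 * (Q ^ 2).trace)
  have h2 := uniaxialBulk_factor_pos hA hB hC (Real.sqrt_nonneg (3 / 2 * (Q ^ 2).trace))
  have h4 := trace_cube_le hQ
  have hsp := sPlus_pos hA hB hC
  have hx : 0 ≤ (Q ^ 2).trace := by rw [trace_sq_of_mem_S0 hQ]; positivity
  have hss := Real.sq_sqrt (show 0 ≤ 3 / 2 * (Q ^ 2).trace by positivity)
  rw [rawBulk_eq hQ] at hle
  set s := √(3 / 2 * (Q ^ 2).trace)
  have h5 : 0 ≤ B / 3 * (2 / 9 * s ^ 3 - (Q ^ 3).trace) :=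
    mul_nonneg (by positivity) (sub_nonneg.2 h4)
  have h6 : (s - sPlus A B C) ^ 2 = 0 := by
    refine le_antisymm (le_of_not_gt fun hgt => ?_) (sq_nonneg _)
    have := mul_pos hgt h2
    linarith
  have hs : s = sPlus A B C := sub_eq_zero.1 (pow_eq_zero_iff two_ne_zero |>.1 h6)
  have h7 : (Q ^ 3).trace = 2 / 9 * s ^ 3 := by
    rw [hs] at hle h5 h4 ⊢
    have : B / 3 * (2 / 9 * sPlus A B C ^ 3 - (Q ^ 3).trace) = 0 := by linarith
    rcases mul_eq_zero.1 this with h | h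
    · linarith
    · linarith
  have h8 : (Q ^ 2).trace = 2 / 3 * s ^ 2 := by linarith
  obtain ⟨U, l, hU', hU, h⟩ := exists_diagonalization hQ
  have e1 := trace_conj_diagonal hU l 1
  have h0 : Q.trace = 0 := hQ.2
  rw [pow_one, ← h, h0, Fin.sum_univ_three, pow_one, pow_one, pow_one] at e1
  have e2 := trace_conj_diagonal hU l 2
  have e3 := trace_conj_diagonal hU l 3
  rw [← h, h8, Fin.sum_univ_three] at e2
  rw [← h, h7, Fin.sum_univ_three] at e3
  rw [hs] at e2 e3
  set t := sPlus A B C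
  have l2 : l 2 = -l 0 - l 1 := by linarith
  -- the eigenvalues are roots of the characteristic polynomial `(X + t/3)² (X - 2t/3)`
  have hroot : ∀ i, l i = 2 * t / 3 ∨ l i = -t / 3 := by
    have : ∀ i, (l i - 2 * t / 3) * (l i + t / 3) ^ 2 = 0 := by
      have e2' : l 0 ^ 2 + l 0 * l 1 + l 1 ^ 2 = t ^ 2 / 3 := by rw [l2] at e2; linarith
      have e3' : l 0 * l 1 * (-l 0 - l 1) = 2 / 27 * t ^ 3 := by rw [l2] at e3; linarith
      intro i
      fin_cases i
      · simp only [Fin.zero_eta]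
        linear_combination l 0 * e2' + e3'
      · simp only [Fin.mk_one]
        linear_combination l 1 * e2' + e3'
      · simp only [Fin.reduceFinMk]
        rw [l2]
        linear_combination (-l 0 - l 1) * e2' + e3'
    intro i
    rcases mul_eq_zero.1 (this i) with h | h
    · left; linarith
    · right; linarith [pow_eq_zero_iff two_ne_zero |>.1 h]
  have hj : ∃ j, l j = 2 * t / 3 ∧ ∀ i, i ≠ j → l i = -t / 3 := by
    rcases hroot 0 with a | a <;> rcases hroot 1 with b | b <;> rcases hroot 2 with c | c
    all_goals first
      | (exfalso; linarith)
      | exact ⟨0, a, fun i hi => by fin_cases i; exacts [absurd rfl hi, b, c]⟩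
      | exact ⟨1, b, fun i hi => by fin_cases i; exacts [a, absurd rfl hi, c]⟩
      | exact ⟨2, c, fun i hi => by fin_cases i; exacts [a, b, absurd rfl hi]⟩
  obtain ⟨j, hj, hl⟩ := hj
  refine ⟨WithLp.toLp 2 fun a => U a j, ?_, ?_⟩
  · rw [EuclideanSpace.norm_eq, Real.sqrt_eq_one]
    have := congr_fun (congr_fun hU j) j
    simp only [Matrix.mul_apply, Matrix.transpose_apply, Matrix.one_apply_eq] at this
    simp only [Real.norm_eq_abs, sq_abs]
    rw [← this]
    exact Finset.sum_congr rfl fun i _ => sq _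
  · rw [h, conj_diagonal_eq_uniaxial hU' j hj hl]

theorem Nmin_subset_S0 {Q : Mat} (hQ : Q ∈ Nmin A B C) : Q ∈ S0 := by
  obtain ⟨n, hn, rfl⟩ := hQ
  refine S0.smul_mem _ ⟨?_, ?_⟩
  · rw [Matrix.transpose_sub, Matrix.transpose_vecMulVec, Matrix.transpose_smul,
      Matrix.transpose_one]
  · rw [EuclideanSpace.norm_eq, Real.sqrt_eq_one, Fin.sum_univ_three] at hn
    simp only [Real.norm_eq_abs, sq_abs] at hn
    simp [Matrix.trace, Matrix.vecMulVec_apply, Fin.sum_univ_three]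
    linarith

theorem traces_of_mem_Nmin {Q : Mat} (hQ : Q ∈ Nmin A B C) :
    (Q ^ 2).trace = 2 / 3 * sPlus A B C ^ 2 ∧ (Q ^ 3).trace = 2 / 9 * sPlus A B C ^ 3 := by
  obtain ⟨n, hn, rfl⟩ := hQ
  rw [EuclideanSpace.norm_eq, Real.sqrt_eq_one] at hn
  simp only [Real.norm_eq_abs, sq_abs] at hn
  have hd : (n : Fin 3 → ℝ) ⬝ᵥ (n : Fin 3 → ℝ) = 1 := by
    rw [← hn]; exact Finset.sum_congr rfl fun i _ => (sq _).symm
  set P : Mat := Matrix.vecMulVec (⇑n) (⇑n) with hP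
  have hPP : P * P = P := by
    rw [hP, Matrix.vecMulVec_mul_vecMulVec, hd]; simp
  have htr : P.trace = 1 := by rw [hP, Matrix.trace_vecMulVec, hd]
  have h1 : (1 : Mat).trace = 3 := by simp
  have h2 : (P - (1 / 3 : ℝ) • (1 : Mat)) ^ 2 = (1 / 3 : ℝ) • P + (1 / 9 : ℝ) • (1 : Mat) := by
    rw [pow_two, Matrix.sub_mul, Matrix.mul_sub, Matrix.mul_sub, hPP]
    simp only [Matrix.mul_smul, Matrix.smul_mul, Matrix.mul_one, Matrix.one_mul]
    module
  have h3 : (P - (1 / 3 : ℝ) • (1 : Mat)) ^ 3 = (1 / 3 : ℝ) • P - (1 / 27 : ℝ) • (1 : Mat) := by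
    rw [pow_succ, h2, Matrix.add_mul, Matrix.mul_sub, Matrix.mul_sub]
    simp only [Matrix.mul_smul, Matrix.smul_mul, Matrix.mul_one, Matrix.one_mul, hPP]
    module
  rw [smul_pow, smul_pow, h2, h3]
  simp only [Matrix.trace_smul, Matrix.trace_add, Matrix.trace_sub, htr, h1, smul_eq_mul]
  constructor <;> ring

theorem rawBulk_of_mem_Nmin {Q : Mat} (hQ : Q ∈ Nmin A B C) :
    rawBulk A B C Q = uniaxialBulk A B C (sPlus A B C) := by
  rw [rawBulk, (traces_of_mem_Nmin hQ).1, (traces_of_mem_Nmin hQ).2, uniaxialBulk]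
  ring

theorem Nmin_nonempty : (Nmin A B C).Nonempty :=
  ⟨_, EuclideanSpace.single 0 1, by simp, rfl⟩

theorem fB_eq (hA : 0 < A) (hB : 0 < B) (hC : 0 < C) (Q : Mat) :
    fB A B C Q = rawBulk A B C Q - uniaxialBulk A B C (sPlus A B C) := by
  have : IsLeast (rawBulk A B C '' (S0 : Set Mat)) (uniaxialBulk A B C (sPlus A B C)) := by
    constructor
    · obtain ⟨P, hP⟩ := Nmin_nonempty (A := A) (B := B) (C := C)
      exact ⟨P, Nmin_subset_S0 hP, rawBulk_of_mem_Nmin hP⟩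
    · rintro _ ⟨P, hP, rfl⟩
      exact uniaxialBulk_sPlus_le hA hB hC hP
  rw [fB, this.csInf_eq]

theorem fB_nonneg (hA : 0 < A) (hB : 0 < B) (hC : 0 < C) {Q : Mat} (hQ : Q ∈ S0) :
    0 ≤ fB A B C Q := by
  rw [fB_eq hA hB hC]
  exact sub_nonneg.2 (uniaxialBulk_sPlus_le hA hB hC hQ)

theorem fB_of_mem_Nmin (hA : 0 < A) (hB : 0 < B) (hC : 0 < C) {Q : Mat} (hQ : Q ∈ Nmin A B C) :
    fB A B C Q = 0 := by
  rw [fB_eq hA hB hC, rawBulk_of_mem_Nmin hQ, sub_self]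

theorem mem_Nmin_of_fB_eq_zero (hA : 0 < A) (hB : 0 < B) (hC : 0 < C) {Q : Mat} (hQ : Q ∈ S0)
    (h : fB A B C Q = 0) : Q ∈ Nmin A B C := by
  rw [fB_eq hA hB hC] at h
  exact mem_Nmin_of_rawBulk_le hA hB hC hQ (by linarith)

theorem continuous_fB : Continuous (fB A B C) := by
  unfold fB rawBulk
  have : ∀ n : ℕ, Continuous fun Q : Mat => (Q ^ n).trace := fun n =>
    (continuous_pow n).matrix_trace
  exact ((((this 2).const_mul _).sub ((this 3).const_mul _)).add
    (((this 2).pow 2).const_mul _)).sub continuous_const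

theorem exists_matNorm_le_of_Nmin : ∃ b, ∀ Q ∈ Nmin A B C, matNorm Q ≤ b := by
  refine ⟨√(2 / 3 * sPlus A B C ^ 2), fun Q hQ => ?_⟩
  rw [← (traces_of_mem_Nmin hQ).1, trace_sq_of_mem_S0 (Nmin_subset_S0 hQ)]
  exact Real.le_sqrt_of_sq_le le_rfl

/-- The bulk potential controls the fourth power of the norm. -/
theorem exists_matNorm_pow_four_le (hA : 0 < A) (hB : 0 < B) (hC : 0 < C) :
    ∃ a b, 0 ≤ a ∧ 0 ≤ b ∧ ∀ Q ∈ S0, matNorm Q ^ 4 ≤ a * fB A B C Q + b := by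
  set η := C / (4 * B) with hη
  have hη0 : 0 < η := by positivity
  set k := A / 2 + B / (3 * η) with hk
  have hk0 : 0 < k := by positivity
  set m := uniaxialBulk A B C (sPlus A B C)
  refine ⟨12 / C, 12 / C * (|m| + 3 * k ^ 2 / C), by positivity, by positivity, fun Q hQ => ?_⟩
  have hx0 : 0 ≤ (Q ^ 2).trace := by rw [trace_sq_of_mem_S0 hQ]; positivity
  have hcube := trace_cube_sq_le hQ
  have hfour : matNorm Q ^ 4 = (Q ^ 2).trace ^ 2 := by rw [trace_sq_of_mem_S0 hQ]; ring
  rw [fB_eq hA hB hC, hfour, rawBulk]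
  set x := (Q ^ 2).trace
  set y := (Q ^ 3).trace
  have hy : y ≤ η * x ^ 2 + x / η := by
    refine abs_le_of_sq_le_sq' ?_ (by positivity) |>.2
    have : (η * x ^ 2 + x / η) ^ 2 = η ^ 2 * x ^ 4 + 2 * x ^ 3 + x ^ 2 / η ^ 2 := by
      field_simp; ring
    rw [this]
    have h1 : 0 ≤ η ^ 2 * x ^ 4 := by positivity
    have h2 : 0 ≤ x ^ 2 / η ^ 2 := by positivity
    have h3 : 0 ≤ x ^ 3 := by positivity
    nlinarith
  have h1 : B / 3 * y ≤ C / 12 * x ^ 2 + B / (3 * η) * x := by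
    have := mul_le_mul_of_nonneg_left hy (show 0 ≤ B / 3 by positivity)
    refine this.trans (le_of_eq ?_)
    rw [hη]; field_simp; ring
  have h2 : k * x ≤ C / 12 * x ^ 2 + 3 * k ^ 2 / C := by
    have : C / 12 * x ^ 2 + 3 * k ^ 2 / C - k * x = (C * x - 6 * k) ^ 2 / (12 * C) := by
      field_simp; ring
    have h : 0 ≤ (C * x - 6 * k) ^ 2 / (12 * C) := by positivity
    linarith
  have h3 : C / 12 * x ^ 2 ≤ (-(A / 2) * x - B / 3 * y + C / 4 * x ^ 2 - m) +
      (|m| + 3 * k ^ 2 / C) := by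
    have := le_abs_self m
    have h4 : k * x = A / 2 * x + B / (3 * η) * x := by rw [hk]; ring
    linarith
  have h4 := mul_le_mul_of_nonneg_left h3 (show 0 ≤ 12 / C by positivity)
  have h5 : 12 / C * (C / 12 * x ^ 2) = x ^ 2 := by field_simp
  linarith

end

end LdG

namespace LdG

/-! ### The modular of an Orlicz space -/

variable {α : Type*} [MeasurableSpace α] {H : Type} [NormedAddCommGroup H]

/-- `u` belongs to the Orlicz class of `φ`, for vector-valued `u`. -/
structure MemMod (φ : ℝ → ℝ) (μ : Measure α) (u : α → H) : Prop where
  aestronglyMeasurable : AEStronglyMeasurable u μ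
  integrable : Integrable (fun x => φ ‖u x‖) μ

/-- The modular `∫ φ(|u|)`. -/
noncomputable def modular (φ : ℝ → ℝ) (μ : Measure α) (u : α → H) : ℝ := ∫ x, φ ‖u x‖ ∂μ

variable {φ : ℝ → ℝ} {μ : Measure α} {u v : α → H}

theorem modular_nonneg (h : IsPowerConvexDensity φ) : 0 ≤ modular φ μ u :=
  integral_nonneg fun _ => h.norm_nonneg _

theorem modular_sub_comm : modular φ μ (u - v) = modular φ μ (v - u) := by
  simp only [modular, Pi.sub_apply, norm_sub_rev]

namespace MemMod

theorem of_le (h : IsPowerConvexDensity φ) (hu : AEStronglyMeasurable u μ) {g : α → ℝ}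
    (hg : Integrable g μ) (hle : ∀ᵐ x ∂μ, φ ‖u x‖ ≤ g x) : MemMod φ μ u :=
  ⟨hu, hg.mono' (h.continuous_norm.comp_aestronglyMeasurable hu) (hle.mono fun x hx => by
    rwa [Real.norm_of_nonneg (h.norm_nonneg _)])⟩

theorem add (h : IsPowerConvexDensity φ) (hu : MemMod φ μ u) (hv : MemMod φ μ v) :
    MemMod φ μ (u + v) := by
  obtain ⟨K, -, hK⟩ := h.exists_norm_add_le
  exact of_le h (hu.1.add hv.1) ((hu.2.add hv.2).const_mul K)
    (ae_of_all _ fun x => hK H (u x) (v x))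

theorem neg (hu : MemMod φ μ u) : MemMod φ μ (-u) :=
  ⟨hu.1.neg, by simpa using hu.2⟩

theorem sub (h : IsPowerConvexDensity φ) (hu : MemMod φ μ u) (hv : MemMod φ μ v) :
    MemMod φ μ (u - v) := by
  rw [sub_eq_add_neg]
  exact hu.add h hv.neg

theorem smul [NormedSpace ℝ H] (h : IsPowerConvexDensity φ) (a : ℝ) (hu : MemMod φ μ u) :
    MemMod φ μ (a • u) := by
  obtain ⟨K, -, hK⟩ := h.exists_mul_le |a|
  refine of_le h (hu.1.const_smul a) (hu.2.const_mul K) (ae_of_all _ fun x => ?_)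
  exact hK _ _ (norm_nonneg _) (by rw [Pi.smul_apply, norm_smul, Real.norm_eq_abs])
    (norm_nonneg _)

theorem congr (hu : MemMod φ μ u) (huv : u =ᵐ[μ] v) : MemMod φ μ v :=
  ⟨hu.1.congr huv, hu.2.congr (huv.mono fun x hx => by simp only [hx])⟩

theorem memMod_integrable [IsFiniteMeasure μ] (h : IsPowerConvexDensity φ) (hu : MemMod φ μ u) :
    Integrable u μ := by
  obtain ⟨C, -, hC⟩ := h.exists_le_add one_pos
  exact ((integrable_const (1 : ℝ)).add (hu.2.const_mul C)).mono' hu.1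
    (ae_of_all _ fun x => hC _ (norm_nonneg _))

end MemMod

theorem modular_congr (huv : u =ᵐ[μ] v) : modular φ μ u = modular φ μ v :=
  integral_congr_ae (huv.mono fun x hx => by simp only [hx])

theorem modular_convex [NormedSpace ℝ H] (h : IsPowerConvexDensity φ) (hu : MemMod φ μ u)
    (hv : MemMod φ μ v) {a b : ℝ} (ha : 0 ≤ a) (hb : 0 ≤ b) (hab : a + b = 1) :
    modular φ μ (a • u + b • v) ≤ a * modular φ μ u + b * modular φ μ v := by
  have hm : MemMod φ μ (a • u + b • v) := (hu.smul h a).add h (hv.smul h b)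
  rw [modular, modular, modular, ← integral_const_mul, ← integral_const_mul,
    ← integral_add (hu.2.const_mul a) (hv.2.const_mul b)]
  exact integral_mono hm.2 ((hu.2.const_mul a).add (hv.2.const_mul b)) fun x =>
    h.norm_convexOn.2 (mem_univ (u x)) (mem_univ (v x)) ha hb hab

theorem exists_modular_add_le (h : IsPowerConvexDensity φ) :
    ∃ K, 0 ≤ K ∧ ∀ (H : Type) [NormedAddCommGroup H] (u v : α → H), MemMod φ μ u → MemMod φ μ v →
      modular φ μ (u + v) ≤ K * (modular φ μ u + modular φ μ v) := by
  obtain ⟨K, hK0, hK⟩ := h.exists_norm_add_le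
  refine ⟨K, hK0, fun H _ u v hu hv => ?_⟩
  rw [modular, modular, modular, ← integral_add hu.2 hv.2, ← integral_const_mul]
  exact integral_mono (hu.add h hv).2 ((hu.2.add hv.2).const_mul K) fun x => hK H _ _

theorem exists_integral_norm_le [IsFiniteMeasure μ] (h : IsPowerConvexDensity φ) {ε : ℝ}
    (hε : 0 < ε) : ∃ C, 0 ≤ C ∧ ∀ (H : Type) [NormedAddCommGroup H] (u : α → H), MemMod φ μ u →
      ∫ x, ‖u x‖ ∂μ ≤ ε + C * modular φ μ u := by
  obtain ⟨C, hC0, hC⟩ := h.exists_le_add (show 0 < ε / (μ.real univ + 1) by positivity)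
  refine ⟨C, hC0, fun H _ u hu => ?_⟩
  have h1 : ∫ x, ‖u x‖ ∂μ ≤ ∫ x, (ε / (μ.real univ + 1) + C * φ ‖u x‖) ∂μ :=
    integral_mono (hu.memMod_integrable h).norm
      ((integrable_const _).add (hu.2.const_mul C)) fun x => hC _ (norm_nonneg _)
  rw [integral_add (integrable_const _) (hu.2.const_mul C), integral_const_mul,
    integral_const, smul_eq_mul] at h1
  have h2 : μ.real univ * (ε / (μ.real univ + 1)) ≤ ε := by
    rw [mul_div_assoc', div_le_iff₀ (by positivity)]
    nlinarith [measureReal_nonneg (μ := μ) (s := univ)]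
  unfold modular
  linarith

/-- Modular convergence implies convergence in `L¹`. -/
theorem tendsto_integral_norm_of_modular [IsFiniteMeasure μ] (h : IsPowerConvexDensity φ)
    {w : ℕ → α → H} (hw : ∀ n, MemMod φ μ (w n))
    (hlim : Tendsto (fun n => modular φ μ (w n)) atTop (𝓝 0)) :
    Tendsto (fun n => ∫ x, ‖w n x‖ ∂μ) atTop (𝓝 0) := by
  rw [Metric.tendsto_atTop]
  intro ε hε
  obtain ⟨C, hC0, hC⟩ := exists_integral_norm_le (μ := μ) h (half_pos hε)
  obtain ⟨N, hN⟩ := Metric.tendsto_atTop.1 hlim (ε / (2 * (C + 1))) (by positivity)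
  refine ⟨N, fun n hn => ?_⟩
  have h1 := hN n hn
  rw [Real.dist_0_eq_abs, abs_of_nonneg (modular_nonneg h)] at h1
  rw [Real.dist_0_eq_abs, abs_of_nonneg (integral_nonneg fun _ => norm_nonneg _)]
  have h2 := hC H (w n) (hw n)
  rw [lt_div_iff₀ (by positivity)] at h1
  nlinarith [modular_nonneg h (μ := μ) (u := w n)]

/-- Fatou's lemma for the modular. -/
theorem modular_le_of_ae_tendsto (h : IsPowerConvexDensity φ) {w : ℕ → α → H}
    (hw : ∀ n, MemMod φ μ (w n)) (hlim : ∀ᵐ x ∂μ, Tendsto (fun n => w n x) atTop (𝓝 (u x)))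
    {c : ℝ} (hc : ∃ᶠ n in atTop, modular φ μ (w n) ≤ c) :
    MemMod φ μ u ∧ modular φ μ u ≤ c := by
  have hum : AEStronglyMeasurable u μ :=
    aestronglyMeasurable_of_tendsto_ae atTop (fun n => (hw n).1) hlim
  have hφu : AEStronglyMeasurable (fun x => φ ‖u x‖) μ :=
    h.continuous_norm.comp_aestronglyMeasurable hum
  have h1 : ∫⁻ x, ENNReal.ofReal (φ ‖u x‖) ∂μ ≤ ENNReal.ofReal c := by
    calc ∫⁻ x, ENNReal.ofReal (φ ‖u x‖) ∂μ
        = ∫⁻ x, liminf (fun n => ENNReal.ofReal (φ ‖w n x‖)) atTop ∂μ := by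
          refine lintegral_congr_ae (hlim.mono fun x hx => ?_)
          exact (((ENNReal.continuous_ofReal.comp h.continuous_norm).tendsto
            (u x)).comp hx).liminf_eq.symm
      _ ≤ liminf (fun n => ∫⁻ x, ENNReal.ofReal (φ ‖w n x‖) ∂μ) atTop :=
          lintegral_liminf_le' fun n => (hw n).2.aemeasurable.ennreal_ofReal
      _ ≤ ENNReal.ofReal c := by
          refine liminf_le_of_frequently_le' (hc.mono fun n hn => ?_)
          rw [← ofReal_integral_eq_lintegral_ofReal (hw n).2 (ae_of_all _ fun _ => h.norm_nonneg _)]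
          exact ENNReal.ofReal_le_ofReal hn
  have hint : Integrable (fun x => φ ‖u x‖) μ := by
    refine ⟨hφu, ?_⟩
    rw [hasFiniteIntegral_iff_ofReal (ae_of_all _ fun _ => h.norm_nonneg _)]
    exact h1.trans_lt ENNReal.ofReal_lt_top
  refine ⟨⟨hum, hint⟩, ?_⟩
  obtain ⟨n, hn⟩ := hc.exists
  have hc0 : 0 ≤ c := (modular_nonneg h).trans hn
  rw [← ofReal_integral_eq_lintegral_ofReal hint (ae_of_all _ fun _ => h.norm_nonneg _)] at h1
  exact (ENNReal.ofReal_le_ofReal_iff hc0).1 h1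

theorem exists_subseq_ae_tendsto [IsFiniteMeasure μ] {w : ℕ → α → H}
    (hw : ∀ n, Integrable (w n) μ) (hu : Integrable u μ)
    (hlim : Tendsto (fun n => ∫ x, ‖w n x - u x‖ ∂μ) atTop (𝓝 0)) :
    ∃ ns : ℕ → ℕ, StrictMono ns ∧
      ∀ᵐ x ∂μ, Tendsto (fun n => w (ns n) x) atTop (𝓝 (u x)) := by
  have h1 : Tendsto (fun n => eLpNorm (w n - u) 1 μ) atTop (𝓝 0) := by
    have h2 : ∀ n, eLpNorm (w n - u) 1 μ = ENNReal.ofReal (∫ x, ‖w n x - u x‖ ∂μ) := fun n => by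
      rw [eLpNorm_one_eq_lintegral_enorm]
      exact (ofReal_integral_norm_eq_lintegral_enorm ((hw n).sub hu)).symm
    simp_rw [h2]
    simpa using ENNReal.tendsto_ofReal hlim
  exact (tendstoInMeasure_of_tendsto_eLpNorm one_ne_zero (fun n => (hw n).1) hu.1
    h1).exists_seq_tendsto_ae

/-- Completeness of `L¹`, in terms of integrals. -/
theorem exists_integrable_limit [CompleteSpace H] {w : ℕ → α → H} (hw : ∀ n, Integrable (w n) μ)
    (hc : ∀ ε > 0, ∃ N, ∀ m ≥ N, ∀ n ≥ N, ∫ x, ‖w m x - w n x‖ ∂μ < ε) :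
    ∃ u : α → H, Integrable u μ ∧
      Tendsto (fun n => ∫ x, ‖w n x - u x‖ ∂μ) atTop (𝓝 0) := by
  have hd : ∀ f g : α → H, ∀ (hf : Integrable f μ) (hg : Integrable g μ),
      dist (hf.toL1 f) (hg.toL1 g) = ∫ x, ‖f x - g x‖ ∂μ := fun f g hf hg => by
    rw [dist_eq_norm, ← Integrable.toL1_sub, L1.norm_of_fun_eq_integral_norm]
    rfl
  have hcs : CauchySeq fun n => (hw n).toL1 (w n) := by
    rw [Metric.cauchySeq_iff]
    intro ε hε
    obtain ⟨N, hN⟩ := hc ε hε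
    exact ⟨N, fun m hm n hn => by rw [hd]; exact hN m hm n hn⟩
  obtain ⟨f, hf⟩ := cauchySeq_tendsto_of_complete hcs
  refine ⟨f, L1.integrable_coeFn f, ?_⟩
  have h1 := tendsto_iff_dist_tendsto_zero.1 hf
  have h2 : ∀ n, dist ((hw n).toL1 (w n)) f = ∫ x, ‖w n x - f x‖ ∂μ := fun n => by
    rw [← hd _ _ (hw n) (L1.integrable_coeFn f), Integrable.toL1_coeFn]
  simpa only [h2] using h1

/-- Completeness of the Orlicz class for modular convergence. -/
theorem exists_modular_limit [IsFiniteMeasure μ] [CompleteSpace H] (h : IsPowerConvexDensity φ)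
    {w : ℕ → α → H} (hw : ∀ n, MemMod φ μ (w n))
    (hc : ∀ ε > 0, ∃ N, ∀ m ≥ N, ∀ n ≥ N, modular φ μ (w m - w n) < ε) :
    ∃ u : α → H, MemMod φ μ u ∧ Tendsto (fun n => modular φ μ (w n - u)) atTop (𝓝 0) := by
  obtain ⟨u, hu, hlim⟩ := exists_integrable_limit (fun n => (hw n).memMod_integrable h)
    fun ε hε => by
      obtain ⟨C, hC0, hC⟩ := exists_integral_norm_le (μ := μ) h (half_pos hε)
      obtain ⟨N, hN⟩ := hc (ε / (2 * (C + 1))) (by positivity)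
      refine ⟨N, fun m hm n hn => ?_⟩
      have h1 := hN m hm n hn
      have h2 := hC H (w m - w n) ((hw m).sub h (hw n))
      simp only [Pi.sub_apply] at h2
      rw [lt_div_iff₀ (by positivity)] at h1
      nlinarith [modular_nonneg h (μ := μ) (u := w m - w n)]
  obtain ⟨ns, hns, hae⟩ := exists_subseq_ae_tendsto (fun n => (hw n).memMod_integrable h) hu hlim
  have key : ∀ ε > 0, ∃ N, ∀ n ≥ N, MemMod φ μ (w n - u) ∧ modular φ μ (w n - u) ≤ ε := by
    intro ε hε
    obtain ⟨N, hN⟩ := hc ε hε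
    refine ⟨N, fun n hn => ?_⟩
    refine modular_le_of_ae_tendsto h (w := fun k => w n - w (ns k))
      (fun k => (hw n).sub h (hw _)) (hae.mono fun x hx => hx.const_sub (w n x)) ?_
    refine Eventually.frequently ?_
    filter_upwards [hns.tendsto_atTop.eventually_ge_atTop N] with k hk
    exact (hN n hn _ hk).le
  refine ⟨u, ?_, ?_⟩
  · obtain ⟨N, hN⟩ := key 1 one_pos
    have := (hw N).sub h (hN N le_rfl).1
    rwa [sub_sub_cancel] at this
  · rw [Metric.tendsto_atTop]
    intro ε hε
    obtain ⟨N, hN⟩ := key (ε / 2) (half_pos hε)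
    refine ⟨N, fun n hn => ?_⟩
    rw [Real.dist_0_eq_abs, abs_of_nonneg (modular_nonneg h)]
    linarith [(hN n hn).2]

/-- Modular convergence implies convergence of the modulars. -/
theorem tendsto_modular (h : IsPowerConvexDensity φ) {w : ℕ → α → H}
    (hw : ∀ n, MemMod φ μ (w n)) (hu : MemMod φ μ u) {c : ℝ} (hc : ∀ n, modular φ μ (w n) ≤ c)
    (hlim : Tendsto (fun n => modular φ μ (w n - u)) atTop (𝓝 0)) :
    Tendsto (fun n => modular φ μ (w n)) atTop (𝓝 (modular φ μ u)) := by
  rw [Metric.tendsto_atTop]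
  intro ε hε
  have hc0 : 0 ≤ c := (modular_nonneg h).trans (hc 0)
  have hu0 := modular_nonneg h (μ := μ) (u := u)
  set D := c + modular φ μ u + 1 with hD
  have hD0 : 0 < D := by linarith
  obtain ⟨C, hC0, hC⟩ := h.exists_abs_sub_le (H := H) (show 0 < ε / (2 * D) by positivity)
  obtain ⟨N, hN⟩ := Metric.tendsto_atTop.1 hlim (ε / (2 * (C + 1))) (by positivity)
  refine ⟨N, fun n hn => ?_⟩
  have h1 := hN n hn
  rw [Real.dist_0_eq_abs, abs_of_nonneg (modular_nonneg h), lt_div_iff₀ (by positivity)] at h1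
  have hint : Integrable (fun x => ε / (2 * D) * (φ ‖w n x‖ + φ ‖u x‖)) μ :=
    ((hw n).2.add hu.2).const_mul _
  have hint2 : Integrable (fun x => C * φ ‖w n x - u x‖) μ := ((hw n).sub h hu).2.const_mul _
  calc dist (modular φ μ (w n)) (modular φ μ u)
      = |∫ x, (φ ‖w n x‖ - φ ‖u x‖) ∂μ| := by
        rw [Real.dist_eq, modular, modular, ← integral_sub (hw n).2 hu.2]
    _ ≤ ∫ x, |φ ‖w n x‖ - φ ‖u x‖| ∂μ := abs_integral_le_integral_abs
    _ ≤ ∫ x, (ε / (2 * D) * (φ ‖w n x‖ + φ ‖u x‖) + C * φ ‖w n x - u x‖) ∂μ :=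
        integral_mono ((hw n).2.sub hu.2).abs (hint.add hint2) fun x => hC _ _
    _ = ε / (2 * D) * (modular φ μ (w n) + modular φ μ u) + C * modular φ μ (w n - u) := by
        rw [integral_add hint hint2, integral_const_mul, integral_const_mul,
          integral_add (hw n).2 hu.2]
        rfl
    _ ≤ ε / 2 + C * modular φ μ (w n - u) := by
        have : ε / (2 * D) * (modular φ μ (w n) + modular φ μ u) ≤ ε / (2 * D) * D :=
          mul_le_mul_of_nonneg_left (by linarith [hc n]) (by positivity)
        have e : ε / (2 * D) * D = ε / 2 := by field_simp
        linarith
    _ < ε := by nlinarith [modular_nonneg h (μ := μ) (u := w n - u)]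

variable {F : Type} [NormedAddCommGroup F] [InnerProductSpace ℝ F] [FiniteDimensional ℝ F]

/-- Uniform convexity of the modular. -/
theorem exists_modular_sub_le (h : IsPowerConvexDensity φ) {ε : ℝ} (hε : 0 < ε) :
    ∃ C, 0 ≤ C ∧ ∀ u v : α → F, MemMod φ μ u → MemMod φ μ v → modular φ μ (u - v) ≤
      C * ((modular φ μ u + modular φ μ v) / 2 - modular φ μ ((1 / 2 : ℝ) • (u + v))) +
        ε * (modular φ μ u + modular φ μ v) := by
  obtain ⟨C, hC0, hC⟩ := h.exists_norm_sub_le_defect (H := F) hε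
  refine ⟨C, hC0, fun u v hu hv => ?_⟩
  have hm : Integrable (fun x => φ ‖(1 / 2 : ℝ) • (u x + v x)‖) μ :=
    ((hu.add h hv).smul h (1 / 2)).2
  have h1 : Integrable (fun x => (φ ‖u x‖ + φ ‖v x‖) / 2) μ := (hu.2.add hv.2).div_const 2
  have h2 : Integrable (fun x => IsPowerConvexDensity.defect φ (u x) (v x)) μ := h1.sub hm
  have h3 : Integrable (fun x => ε * (φ ‖u x‖ + φ ‖v x‖)) μ := (hu.2.add hv.2).const_mul _
  calc modular φ μ (u - v)
      ≤ ∫ x, (C * IsPowerConvexDensity.defect φ (u x) (v x) + ε * (φ ‖u x‖ + φ ‖v x‖)) ∂μ :=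
        integral_mono (hu.sub h hv).2 ((h2.const_mul C).add h3) fun x => hC _ _
    _ = _ := by
        rw [integral_add (h2.const_mul C) h3, integral_const_mul, integral_const_mul,
          integral_add hu.2 hv.2]
        unfold IsPowerConvexDensity.defect
        rw [integral_sub h1 hm, integral_div, integral_add hu.2 hv.2]
        rfl

end LdG

namespace LdG

/-! ### Weak gradients of vector-valued maps -/

section WeakPartial

variable {d : ℕ} {Ω : Set (E d)} {k : Fin d} {u v u' v' : E d → ℝ}

theorem integrableOn_mul_of_tsupport_subset (hu : LocallyIntegrableOn u Ω) {g : E d → ℝ}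
    (hg : Continuous g) (hgc : HasCompactSupport g) (hgs : tsupport g ⊆ Ω) :
    IntegrableOn (fun x => u x * g x) Ω := by
  have h1 : IntegrableOn (fun x => u x * g x) (tsupport g) :=
    (hu.integrableOn_compact_subset hgs hgc).mul_continuousOn hg.continuousOn hgc
  refine Integrable.integrableOn ?_
  refine (integrableOn_iff_integrable_of_support_subset fun x hx => ?_).1 h1
  exact subset_tsupport g (right_ne_zero_of_mul hx)

theorem integrableOn_mul_fderiv (hu : LocallyIntegrableOn u Ω) {η : E d → ℝ} (hη : ContDiff ℝ ∞ η)
    (hc : HasCompactSupport η) (hs : tsupport η ⊆ Ω) (z : E d) :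
    IntegrableOn (fun x => u x * fderiv ℝ η x z) Ω :=
  integrableOn_mul_of_tsupport_subset hu
    ((hη.continuous_fderiv (by simp)).clm_apply continuous_const) (hc.fderiv_apply ℝ z)
    ((tsupport_fderiv_apply_subset ℝ z).trans hs)

namespace IsWeakPartial

theorem add (h : IsWeakPartial Ω k u v) (h' : IsWeakPartial Ω k u' v') :
    IsWeakPartial Ω k (fun x => u x + u' x) (fun x => v x + v' x) where
  locInt := h.locInt.add h'.locInt
  locInt_partial := h.locInt_partial.add h'.locInt_partial
  integral_eq η hη hc hs := by
    have e1 := h.integral_eq η hη hc hs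
    have e2 := h'.integral_eq η hη hc hs
    simp only [add_mul]
    rw [integral_add (integrableOn_mul_fderiv h.locInt hη hc hs _)
      (integrableOn_mul_fderiv h'.locInt hη hc hs _), e1, e2,
      integral_add (integrableOn_mul_of_tsupport_subset h.locInt_partial hη.continuous hc hs)
      (integrableOn_mul_of_tsupport_subset h'.locInt_partial hη.continuous hc hs)]
    ring

theorem const_mul (h : IsWeakPartial Ω k u v) (a : ℝ) :
    IsWeakPartial Ω k (fun x => a * u x) (fun x => a * v x) where
  locInt := h.locInt.smul a
  locInt_partial := h.locInt_partial.smul a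
  integral_eq η hη hc hs := by
    simp only [mul_assoc]
    rw [integral_const_mul, integral_const_mul, h.integral_eq η hη hc hs, mul_neg]

/-- Weak partial derivatives are unique. -/
theorem ae_eq (hΩ : IsOpen Ω) (h : IsWeakPartial Ω k u v) (h' : IsWeakPartial Ω k u v') :
    v =ᵐ[volume.restrict Ω] v' := by
  have h1 : LocallyIntegrableOn (fun x => v x - v' x) Ω := h.locInt_partial.sub h'.locInt_partial
  have h2 := hΩ.ae_eq_zero_of_integral_contDiff_smul_eq_zero h1 fun g hg hgc hgs => by
    have e1 := h.integral_eq g hg hgc hgs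
    have e2 := h'.integral_eq g hg hgc hgs
    have e3 : ∫ x in Ω, v x * g x = ∫ x in Ω, v' x * g x := by
      rw [e1] at e2; linarith
    rw [← setIntegral_eq_integral_of_forall_compl_eq_zero (s := Ω) fun x hx => ?_]
    · have : ∀ x, g x • (v x - v' x) = v x * g x - v' x * g x := fun x => by
        rw [smul_eq_mul]; ring
      simp only [this]
      rw [integral_sub (integrableOn_mul_of_tsupport_subset h.locInt_partial hg.continuous hgc hgs)
        (integrableOn_mul_of_tsupport_subset h'.locInt_partial hg.continuous hgc hgs), e3, sub_self]
    · rw [image_eq_zero_of_notMem_tsupport fun hm => hx (hgs hm), zero_smul]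
  rw [EventuallyEq, ae_restrict_iff' hΩ.measurableSet]
  exact h2.mono fun x hx hxΩ => sub_eq_zero.1 (hx hxΩ)

theorem weakPartial (h : IsWeakPartial Ω k u v) : IsWeakPartial Ω k u (weakPartial Ω k u) := by
  have hex : ∃ v, IsWeakPartial Ω k u v := ⟨v, h⟩
  rw [LdG.weakPartial, dif_pos hex]
  exact hex.choose_spec

end IsWeakPartial

/-- Against a bounded weight, `L¹` convergence implies convergence of the integrals. -/
theorem tendsto_integral_mul_of_tendsto_integral_abs {α : Type*} [MeasurableSpace α]
    {μ : Measure α} {w : ℕ → α → ℝ} {u g : α → ℝ} (hw : ∀ n, Integrable (w n) μ)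
    (hu : Integrable u μ) (hg : AEStronglyMeasurable g μ) {M : ℝ} (hM : ∀ x, |g x| ≤ M)
    (hlim : Tendsto (fun n => ∫ x, |w n x - u x| ∂μ) atTop (𝓝 0)) :
    Tendsto (fun n => ∫ x, w n x * g x ∂μ) atTop (𝓝 (∫ x, u x * g x ∂μ)) := by
  have hm : ∀ f : α → ℝ, Integrable f μ → Integrable (fun x => f x * g x) μ := fun f hf =>
    hf.mul_bdd hg (ae_of_all _ hM)
  rw [tendsto_iff_dist_tendsto_zero]
  refine squeeze_zero (fun _ => dist_nonneg) (fun n => ?_) (by simpa using hlim.const_mul M)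
  rw [Real.dist_eq, ← integral_sub (hm _ (hw n)) (hm _ hu), ← integral_const_mul]
  refine abs_integral_le_integral_abs.trans ?_
  refine integral_mono ((hm _ (hw n)).sub (hm _ hu)).abs (((hw n).sub hu).abs.const_mul M)
    fun x => ?_
  simp only
  rw [← sub_mul, abs_mul, mul_comm]
  exact mul_le_mul_of_nonneg_right (hM x) (abs_nonneg _)

end WeakPartial

variable {d : ℕ} {ι : Type}

/-- `G` is the weak gradient of the vector-valued map `u` on `Ω`; the entry `(k, i)` of `G` is
`∂ₖ uᵢ`. -/
def IsGrad (Ω : Set (E d)) (u : E d → EuclideanSpace ℝ ι)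
    (G : E d → EuclideanSpace ℝ (Fin d × ι)) : Prop :=
  ∀ k i, IsWeakPartial Ω k (fun x => u x i) (fun x => G x (k, i))

namespace IsGrad

variable {Ω : Set (E d)} {u u' : E d → EuclideanSpace ℝ ι}
  {G G' : E d → EuclideanSpace ℝ (Fin d × ι)}

theorem add (h : IsGrad Ω u G) (h' : IsGrad Ω u' G') : IsGrad Ω (u + u') (G + G') :=
  fun k i => (h k i).add (h' k i)

theorem smul (h : IsGrad Ω u G) (a : ℝ) : IsGrad Ω (a • u) (a • G) :=
  fun k i => (h k i).const_mul a

theorem sub (h : IsGrad Ω u G) (h' : IsGrad Ω u' G') : IsGrad Ω (u - u') (G - G') := by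
  have := h.add (h'.smul (-1))
  simpa [sub_eq_add_neg] using this

theorem ae_eq [Countable ι] (hΩ : IsOpen Ω) (h : IsGrad Ω u G) (h' : IsGrad Ω u G') :
    G =ᵐ[volume.restrict Ω] G' := by
  have : ∀ᵐ x ∂volume.restrict Ω, ∀ p : Fin d × ι, G x p = G' x p :=
    ae_all_iff.2 fun p => (h p.1 p.2).ae_eq hΩ (h' p.1 p.2)
  exact this.mono fun x hx => PiLp.ext hx

theorem abs_apply_le {ι : Type*} [Fintype ι] (x : EuclideanSpace ℝ ι) (i : ι) : |x i| ≤ ‖x‖ :=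
  PiLp.norm_apply_le x i

theorem tendsto_integral_abs_apply {κ : Type*} [Fintype κ] {w : ℕ → E d → EuclideanSpace ℝ κ}
    {u : E d → EuclideanSpace ℝ κ} (hw : ∀ n, IntegrableOn (w n) Ω) (hu : IntegrableOn u Ω)
    (hlim : Tendsto (fun n => ∫ x in Ω, ‖w n x - u x‖) atTop (𝓝 0)) (i : κ) :
    Tendsto (fun n => ∫ x in Ω, |w n x i - u x i|) atTop (𝓝 0) := by
  refine squeeze_zero (fun n => integral_nonneg fun _ => abs_nonneg _) (fun n => ?_) hlim
  have h1 : IntegrableOn (fun x => w n x i - u x i) Ω :=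
    ((EuclideanSpace.proj (𝕜 := ℝ) i).integrable_comp (hw n)).sub
      ((EuclideanSpace.proj (𝕜 := ℝ) i).integrable_comp hu)
  exact integral_mono h1.abs ((hw n).sub hu).norm fun x => abs_apply_le (w n x - u x) i

variable [Fintype ι]

/-- Weak gradients pass to limits in `L¹`. -/
theorem of_tendsto {w : ℕ → E d → EuclideanSpace ℝ ι}
    {g : ℕ → E d → EuclideanSpace ℝ (Fin d × ι)} (h : ∀ n, IsGrad Ω (w n) (g n))
    (hw : ∀ n, IntegrableOn (w n) Ω) (hu : IntegrableOn u Ω)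
    (hg : ∀ n, IntegrableOn (g n) Ω) (hG : IntegrableOn G Ω)
    (hwu : Tendsto (fun n => ∫ x in Ω, ‖w n x - u x‖) atTop (𝓝 0))
    (hgG : Tendsto (fun n => ∫ x in Ω, ‖g n x - G x‖) atTop (𝓝 0)) : IsGrad Ω u G := by
  intro k i
  have hp : ∀ {κ : Type} [Fintype κ] (j : κ) {f : E d → EuclideanSpace ℝ κ}, IntegrableOn f Ω →
      IntegrableOn (fun x => f x j) Ω := fun j f hf =>
    (EuclideanSpace.proj (𝕜 := ℝ) j).integrable_comp hf
  refine ⟨(hp i hu).locallyIntegrableOn, (hp (k, i) hG).locallyIntegrableOn,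
    fun η hη hc hs => ?_⟩
  have hd : Continuous fun x => fderiv ℝ η x (EuclideanSpace.single k 1) :=
    (hη.continuous_fderiv (by simp)).clm_apply continuous_const
  obtain ⟨M₁, hM₁⟩ := (hc.fderiv_apply ℝ (EuclideanSpace.single k 1)).exists_bound_of_continuous hd
  obtain ⟨M₂, hM₂⟩ := hc.exists_bound_of_continuous hη.continuous
  have t1 := tendsto_integral_mul_of_tendsto_integral_abs (fun n => hp i (hw n)) (hp i hu)
    hd.aestronglyMeasurable hM₁ (tendsto_integral_abs_apply hw hu hwu i)
  have t2 := tendsto_integral_mul_of_tendsto_integral_abs (fun n => hp (k, i) (hg n))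
    (hp (k, i) hG) hη.continuous.aestronglyMeasurable hM₂
    (tendsto_integral_abs_apply hg hG hgG (k, i))
  refine tendsto_nhds_unique t1 ?_
  simp only [(h _ k i).integral_eq η hη hc hs]
  exact t2.neg

end IsGrad

/-! ### Test maps -/

variable [Fintype ι]

/-- The classical gradient of a vector-valued map. -/
noncomputable def grad (η : E d → EuclideanSpace ℝ ι) (x : E d) : EuclideanSpace ℝ (Fin d × ι) :=
  WithLp.toLp 2 fun p => fderiv ℝ η x (EuclideanSpace.single p.1 1) p.2

/-- Vector-valued smooth maps with compact support in `Ω`. -/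
structure IsTest (Ω : Set (E d)) (η : E d → EuclideanSpace ℝ ι) : Prop where
  contDiff : ContDiff ℝ ∞ η
  hasCompactSupport : HasCompactSupport η
  tsupport_subset : tsupport η ⊆ Ω

namespace IsTest

variable {Ω : Set (E d)} {η ζ : E d → EuclideanSpace ℝ ι}

theorem differentiable (h : IsTest Ω η) : Differentiable ℝ η := h.contDiff.differentiable (by simp)

theorem continuous_grad (h : IsTest Ω η) : Continuous (grad η) := by
  refine (PiLp.continuous_toLp 2 _).comp (continuous_pi fun p => ?_)
  exact (EuclideanSpace.proj (𝕜 := ℝ) p.2).continuous.comp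
    ((h.contDiff.continuous_fderiv (by simp)).clm_apply continuous_const)

theorem hasCompactSupport_grad (h : IsTest Ω η) : HasCompactSupport (grad η) := by
  refine HasCompactSupport.of_support_subset_isCompact (h.hasCompactSupport.fderiv ℝ) ?_
  refine fun x hx => subset_tsupport _ fun h0 => hx ?_
  ext p
  simp [grad, h0]

theorem add (h : IsTest Ω η) (h' : IsTest Ω ζ) : IsTest Ω (η + ζ) :=
  ⟨h.1.add h'.1, h.2.add h'.2, (tsupport_add _ _).trans (union_subset h.3 h'.3)⟩

theorem smul (h : IsTest Ω η) (a : ℝ) : IsTest Ω (a • η) := by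
  have hs : tsupport (a • η) ⊆ tsupport η := closure_mono fun x hx h0 => hx (by
    simp [h0])
  exact ⟨h.1.const_smul a, h.2.of_isClosed_subset (isClosed_tsupport _) hs, hs.trans h.3⟩

theorem grad_add (h : IsTest Ω η) (h' : IsTest Ω ζ) : grad (η + ζ) = grad η + grad ζ := by
  ext x p
  simp [grad, fderiv_add (h.differentiable x) (h'.differentiable x)]

theorem grad_smul (h : IsTest Ω η) (a : ℝ) : grad (a • η) = a • grad η := by
  ext x p
  simp [grad, fderiv_const_smul (h.differentiable x)]

theorem isGrad (h : IsTest Ω η) : IsGrad Ω η (grad η) := by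
  intro k i
  have hci : ContDiff ℝ ∞ fun x => η x i :=
    (EuclideanSpace.proj (𝕜 := ℝ) i).contDiff.comp h.contDiff
  have hcs : HasCompactSupport fun x => η x i := 
    HasCompactSupport.comp_left (g := fun y : EuclideanSpace ℝ ι => y i) h.2 rfl
  have hd : ∀ x z, fderiv ℝ (fun x => η x i) x z = fderiv ℝ η x z i := by
    intro x z
    have := ((EuclideanSpace.proj (𝕜 := ℝ) i).hasFDerivAt.comp x
      (h.differentiable x).hasFDerivAt).fderiv
    have e := congr_arg (fun L : E d →L[ℝ] ℝ => L z) this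
    exact e
  have hG : Continuous fun x => grad η x (k, i) :=
    (EuclideanSpace.proj (𝕜 := ℝ) (k, i)).continuous.comp h.continuous_grad
  refine ⟨hci.continuous.locallyIntegrable.locallyIntegrableOn _,
    hG.locallyIntegrable.locallyIntegrableOn _, fun ζ hζ hc hs => ?_⟩
  have hdc : ∀ {f : E d → ℝ}, ContDiff ℝ ∞ f → Continuous fun x =>
      fderiv ℝ f x (EuclideanSpace.single k 1) := fun hf =>
    (hf.continuous_fderiv (by simp)).clm_apply continuous_const
  rw [setIntegral_eq_integral_of_forall_compl_eq_zero fun x hx => ?_,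
    setIntegral_eq_integral_of_forall_compl_eq_zero fun x hx => ?_]
  · rw [integral_mul_fderiv_eq_neg_fderiv_mul_of_integrable]
    · simp only [hd]; rfl
    · exact ((hdc hci).mul hζ.continuous).integrable_of_hasCompactSupport hc.mul_left
    · exact (hci.continuous.mul (hdc hζ)).integrable_of_hasCompactSupport hcs.mul_right
    · exact (hci.continuous.mul hζ.continuous).integrable_of_hasCompactSupport hcs.mul_right
    · exact fun x _ => hci.differentiable (by simp) x
    · exact fun x _ => hζ.differentiable (by simp) x
  · rw [image_eq_zero_of_notMem_tsupport fun hm => hx (hs hm), mul_zero]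
  · rw [image_eq_zero_of_notMem_tsupport (f := fun x => fderiv ℝ ζ x (EuclideanSpace.single k 1))
      fun hm => hx (hs (tsupport_fderiv_apply_subset ℝ _ hm)), mul_zero]

theorem norm_fderiv_apply_le (η : E d → EuclideanSpace ℝ ι) (x z : E d) :
    ‖fderiv ℝ η x z‖ ≤ ‖z‖ * ‖grad η x‖ := by
  have hz : z = ∑ k, z k • EuclideanSpace.single k (1 : ℝ) := by
    ext j
    simp [Finset.sum_apply, Pi.single_apply]
  have hc : ∀ i, fderiv ℝ η x z i = ∑ k, z k * grad η x (k, i) := by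
    intro i
    conv_lhs => rw [hz, map_sum]
    simp [grad]
  refine abs_le_of_sq_le_sq' ?_ (by positivity) |>.2
  rw [mul_pow, EuclideanSpace.real_norm_sq_eq, EuclideanSpace.real_norm_sq_eq,
    EuclideanSpace.real_norm_sq_eq, Fintype.sum_prod_type_right, Finset.mul_sum]
  refine Finset.sum_le_sum fun i _ => ?_
  rw [hc]
  exact Finset.sum_mul_sq_le_sq_mul_sq _ _ _

end IsTest

end LdG

namespace LdG

/-! ### Compactness of test maps with bounded gradients -/

variable {d : ℕ} {ι : Type} [Fintype ι] {Ω : Set (E d)}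

/-- A translation by `z` moves a test map by at most `|z|` times the integral of its gradient, in
`L¹`. -/
theorem IsTest.lintegral_translate_le {η : E d → EuclideanSpace ℝ ι} (h : IsTest Ω η) (z : E d) :
    ∫⁻ x, ‖η (x + z) - η x‖ₑ ≤ ‖z‖ₑ * ∫⁻ x, ‖grad η x‖ₑ := by
  have hc : Continuous (fderiv ℝ η) := h.contDiff.continuous_fderiv (by simp)
  have hg := h.continuous_grad
  have hpt : ∀ x, ‖η (x + z) - η x‖ₑ ≤
      ∫⁻ t in Ioc (0 : ℝ) 1, ‖z‖ₑ * ‖grad η (x + t • z)‖ₑ := by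
    intro x
    have hderiv : ∀ t ∈ uIcc (0 : ℝ) 1, HasDerivAt (fun t : ℝ => η (x + t • z))
        (fderiv ℝ η (x + t • z) z) t := by
      intro t _
      have h1 : HasDerivAt (fun t : ℝ => x + t • z) z t := by
        simpa using ((hasDerivAt_id t).smul_const z).const_add x
      exact (h.differentiable _).hasFDerivAt.comp_hasDerivAt t h1
    have hcont : Continuous fun t : ℝ => fderiv ℝ η (x + t • z) z :=
      (hc.comp (by fun_prop)).clm_apply continuous_const
    have := intervalIntegral.integral_eq_sub_of_hasDerivAt hderiv (hcont.intervalIntegrable 0 1)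
    simp only [one_smul, zero_smul, add_zero] at this
    rw [← this, intervalIntegral.integral_of_le zero_le_one]
    refine (enorm_integral_le_lintegral_enorm _).trans (lintegral_mono fun t => ?_)
    rw [← enorm_norm, ← enorm_norm z, ← enorm_norm (grad η _), ← enorm_mul]
    rw [Real.enorm_of_nonneg (norm_nonneg _), Real.enorm_of_nonneg (by positivity)]
    exact ENNReal.ofReal_le_ofReal (IsTest.norm_fderiv_apply_le η _ z)
  calc ∫⁻ x, ‖η (x + z) - η x‖ₑ
      ≤ ∫⁻ x, ∫⁻ t in Ioc (0 : ℝ) 1, ‖z‖ₑ * ‖grad η (x + t • z)‖ₑ := lintegral_mono hpt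
    _ = ∫⁻ t in Ioc (0 : ℝ) 1, ∫⁻ x, ‖z‖ₑ * ‖grad η (x + t • z)‖ₑ := by
        refine lintegral_lintegral_swap (Continuous.measurable ?_).aemeasurable
        unfold Function.uncurry
        exact ENNReal.continuous_const_mul (by simp) |>.comp
          (hg.comp (by fun_prop)).enorm
    _ = ∫⁻ t in Ioc (0 : ℝ) 1, ‖z‖ₑ * ∫⁻ x, ‖grad η x‖ₑ := by
        refine lintegral_congr fun t => ?_
        rw [lintegral_const_mul' _ _ (by simp),
          lintegral_add_right_eq_self (fun x => ‖grad η x‖ₑ)]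
    _ = _ := by simp

/-- The average over the ball of radius `r`. -/
noncomputable def ballAverage (r : ℝ) (η : E d → EuclideanSpace ℝ ι) (x : E d) :
    EuclideanSpace ℝ ι :=
  (volume.real (Metric.ball (0 : E d) r))⁻¹ • ∫ y in Metric.ball x r, η y

theorem setIntegral_ball_eq (r : ℝ) (η : E d → EuclideanSpace ℝ ι) (x : E d) :
    ∫ y in Metric.ball x r, η y = ∫ y in Metric.ball (0 : E d) r, η (x + y) := by
  have := (measurePreserving_add_left (volume : Measure (E d)) x).setIntegral_preimage_emb
    (Homeomorph.addLeft x).measurableEmbedding η (Metric.ball x r)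
  rw [← this]
  congr 2
  ext y
  simp [Metric.mem_ball, dist_eq_norm]

/-- Averaging over balls of radius `r` moves a test map by at most `r` times the integral of its
gradient, in `L¹`. -/
theorem IsTest.lintegral_sub_ballAverage_le {η : E d → EuclideanSpace ℝ ι} (h : IsTest Ω η)
    {r : ℝ} (hr : 0 < r) :
    ∫⁻ x, ‖η x - ballAverage r η x‖ₑ ≤ ENNReal.ofReal r * ∫⁻ x, ‖grad η x‖ₑ := by
  set B := Metric.ball (0 : E d) r with hB
  have hb0 : volume B ≠ 0 := (Metric.measure_ball_pos volume _ hr).ne'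
  have hbt : volume B ≠ ⊤ := measure_ball_lt_top.ne
  have hbr : 0 < volume.real B := ENNReal.toReal_pos hb0 hbt
  have hη : Continuous η := h.contDiff.continuous
  have hint : ∀ x, IntegrableOn (fun y => η (x + y)) B := fun x =>
    ((hη.comp (by fun_prop : Continuous fun y => x + y)).continuousOn.integrableOn_compact
      (isCompact_closedBall (0 : E d) r)).mono_set Metric.ball_subset_closedBall
  have hpt : ∀ x, ‖η x - ballAverage r η x‖ₑ ≤
      (volume B)⁻¹ * ∫⁻ y in B, ‖η (x + y) - η x‖ₑ := by
    intro x
    have e : η x - ballAverage r η x =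
        (volume.real B)⁻¹ • ∫ y in B, (η x - η (x + y)) := by
      have hc : IntegrableOn (fun _ : E d => η x) B := integrableOn_const hbt
      rw [integral_sub hc (hint x), setIntegral_const, smul_sub, smul_smul,
        inv_mul_cancel₀ hbr.ne', one_smul, ballAverage, setIntegral_ball_eq]
    rw [e, enorm_smul]
    refine mul_le_mul' (le_of_eq ?_) ?_
    · rw [Real.enorm_of_nonneg (inv_nonneg.2 hbr.le), ENNReal.ofReal_inv_of_pos hbr,
        Measure.real, ENNReal.ofReal_toReal hbt]
    · refine (enorm_integral_le_lintegral_enorm _).trans (le_of_eq ?_)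
      exact lintegral_congr fun y => enorm_sub_rev _ _
  calc ∫⁻ x, ‖η x - ballAverage r η x‖ₑ
      ≤ ∫⁻ x, (volume B)⁻¹ * ∫⁻ y in B, ‖η (x + y) - η x‖ₑ := lintegral_mono hpt
    _ = (volume B)⁻¹ * ∫⁻ x, ∫⁻ y in B, ‖η (x + y) - η x‖ₑ :=
        lintegral_const_mul' _ _ (ENNReal.inv_ne_top.2 hb0)
    _ = (volume B)⁻¹ * ∫⁻ y in B, ∫⁻ x, ‖η (x + y) - η x‖ₑ := by
        rw [lintegral_lintegral_swap]
        refine (Continuous.measurable ?_).aemeasurable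
        unfold Function.uncurry
        exact ((hη.comp (by fun_prop)).sub (hη.comp continuous_fst)).enorm
    _ ≤ (volume B)⁻¹ * ∫⁻ y in B, ENNReal.ofReal r * ∫⁻ x, ‖grad η x‖ₑ := by
        refine mul_le_mul_right (setLIntegral_mono' measurableSet_ball fun y hy => ?_) _
        refine (h.lintegral_translate_le y).trans (mul_le_mul_left ?_ _)
        rw [← enorm_norm, Real.enorm_of_nonneg (norm_nonneg _)]
        exact ENNReal.ofReal_le_ofReal (mem_ball_zero_iff.1 hy).le
    _ = ENNReal.ofReal r * ∫⁻ x, ‖grad η x‖ₑ := by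
        rw [setLIntegral_const, mul_comm, mul_assoc, ENNReal.mul_inv_cancel hb0 hbt, mul_one]

theorem measurable_ballAverage {η : E d → EuclideanSpace ℝ ι} (hη : Continuous η) (r : ℝ) :
    StronglyMeasurable (ballAverage r η) := by
  have : ballAverage r η = fun x => (volume.real (Metric.ball (0 : E d) r))⁻¹ •
      ∫ y in Metric.ball (0 : E d) r, η (x + y) := by
    ext1 x
    rw [ballAverage, setIntegral_ball_eq]
  rw [this]
  have h1 : StronglyMeasurable fun x => ∫ y in Metric.ball (0 : E d) r, η (x + y) :=
    StronglyMeasurable.integral_prod_right (f := fun x y => η (x + y))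
      (hη.comp (continuous_fst.add continuous_snd)).stronglyMeasurable
  exact h1.const_smul (volume.real (Metric.ball (0 : E d) r))⁻¹

/-- Rellich's compactness theorem for test maps: if the gradients are bounded in `L¹` and the
integrals over all balls converge, then the maps converge in `L¹`. -/
theorem cauchy_of_tendsto_setIntegral_ball (hΩ : volume Ω ≠ ⊤) {w : ℕ → E d → EuclideanSpace ℝ ι}
    (hw : ∀ n, IsTest Ω (w n)) {K K' : ℝ} (hK : ∀ n, ∫ x, ‖grad (w n) x‖ ≤ K)
    (hK' : ∀ n, ∫ x, ‖w n x‖ ≤ K')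
    (hconv : ∀ x r, ∃ l, Tendsto (fun n => ∫ y in Metric.ball x r, w n y) atTop (𝓝 l)) :
    ∀ ε > 0, ∃ N, ∀ m ≥ N, ∀ n ≥ N, ∫ x in Ω, ‖w m x - w n x‖ < ε := by
  intro ε hε
  have hK0 : 0 ≤ K := (integral_nonneg fun _ => norm_nonneg _).trans (hK 0)
  set r := ε / (8 * (K + 1)) with hr
  have hr0 : 0 < r := by positivity
  choose l hl using fun x => hconv x r
  set b := volume.real (Metric.ball (0 : E d) r) with hb
  have hb0 : 0 ≤ b⁻¹ := inv_nonneg.2 measureReal_nonneg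
  have : IsFiniteMeasure (volume.restrict Ω) := ⟨by simpa using hΩ.lt_top⟩
  have hwint : ∀ n, Integrable (w n) := fun n =>
    (hw n).contDiff.continuous.integrable_of_hasCompactSupport (hw n).hasCompactSupport
  have hgint : ∀ n, Integrable (grad (w n)) := fun n =>
    (hw n).continuous_grad.integrable_of_hasCompactSupport (hw n).hasCompactSupport_grad
  have hAm : ∀ n, StronglyMeasurable (ballAverage r (w n)) := fun n =>
    measurable_ballAverage (hw n).contDiff.continuous r
  have hAbd : ∀ n x, ‖ballAverage r (w n) x‖ ≤ b⁻¹ * K' := by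
    intro n x
    rw [ballAverage, norm_smul, Real.norm_of_nonneg hb0]
    refine mul_le_mul_of_nonneg_left ?_ hb0
    refine (norm_integral_le_integral_norm _).trans (le_trans ?_ (hK' n))
    exact setIntegral_le_integral (hwint n).norm (ae_of_all _ fun _ => norm_nonneg _)
  have hAint : ∀ n, IntegrableOn (ballAverage r (w n)) Ω := fun n =>
    Integrable.of_bound (hAm n).aestronglyMeasurable _ (ae_of_all _ (hAbd n))
  have hAlim : ∀ x, Tendsto (fun n => ballAverage r (w n) x) atTop (𝓝 (b⁻¹ • l x)) := fun x =>
    (hl x).const_smul b⁻¹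
  have ham : StronglyMeasurable fun x => b⁻¹ • l x :=
    stronglyMeasurable_of_tendsto atTop hAm (tendsto_pi_nhds.2 hAlim)
  have habd : ∀ x, ‖b⁻¹ • l x‖ ≤ b⁻¹ * K' := fun x =>
    le_of_tendsto (hAlim x).norm (Eventually.of_forall fun n => hAbd n x)
  have haint : IntegrableOn (fun x => b⁻¹ • l x) Ω :=
    Integrable.of_bound ham.aestronglyMeasurable _ (ae_of_all _ habd)
  have hA : Tendsto (fun n => ∫ x in Ω, ‖ballAverage r (w n) x - b⁻¹ • l x‖) atTop (𝓝 0) := by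
    have := tendsto_integral_of_dominated_convergence (μ := volume.restrict Ω)
      (F := fun n x => ‖ballAverage r (w n) x - b⁻¹ • l x‖) (f := fun _ => 0)
      (fun _ => b⁻¹ * K' + b⁻¹ * K')
      (fun n => ((hAm n).sub ham).norm.aestronglyMeasurable) (integrable_const _)
      (fun n => ae_of_all _ fun x => by
        rw [norm_norm]
        exact (norm_sub_le _ _).trans (add_le_add (hAbd n x) (habd x)))
      (ae_of_all _ fun x => by
        have := ((hAlim x).sub_const (b⁻¹ • l x)).norm
        rwa [sub_self, norm_zero] at this)
    simpa using this
  obtain ⟨N, hN⟩ := Metric.tendsto_atTop.1 hA (ε / 8) (by positivity)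
  have h1 : ∀ n ≥ N, ∫ x in Ω, ‖ballAverage r (w n) x - b⁻¹ • l x‖ < ε / 8 := fun n hn => by
    have := hN n hn
    rwa [Real.dist_0_eq_abs, abs_of_nonneg (integral_nonneg fun _ => norm_nonneg _)] at this
  have h2 : ∀ n, ∫ x in Ω, ‖w n x - ballAverage r (w n) x‖ ≤ ε / 8 := by
    intro n
    have hm : AEStronglyMeasurable (fun x => w n x - ballAverage r (w n) x)
        (volume.restrict Ω) := ((hwint n).integrableOn.sub (hAint n)).aestronglyMeasurable
    rw [integral_norm_eq_lintegral_enorm hm]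
    refine ENNReal.toReal_le_of_le_ofReal (by positivity) ?_
    refine (setLIntegral_le_lintegral _ _).trans
      (((hw n).lintegral_sub_ballAverage_le hr0).trans ?_)
    rw [← ofReal_integral_norm_eq_lintegral_enorm (hgint n), ← ENNReal.ofReal_mul hr0.le]
    refine ENNReal.ofReal_le_ofReal ((mul_le_mul_of_nonneg_left (hK n) hr0.le).trans ?_)
    rw [hr, div_mul_eq_mul_div, div_le_div_iff₀ (by positivity) (by positivity)]
    nlinarith
  refine ⟨N, fun m hm n hn => ?_⟩
  have hi : ∀ n, IntegrableOn (fun x => ‖w n x - ballAverage r (w n) x‖) Ω := fun n =>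
    ((hwint n).integrableOn.sub (hAint n)).norm
  have hj : ∀ n, IntegrableOn (fun x => ‖ballAverage r (w n) x - b⁻¹ • l x‖) Ω := fun n =>
    ((hAint n).sub haint).norm
  have h3 : ∫ x in Ω, ‖w m x - w n x‖ ≤ ∫ x in Ω,
      ((‖w m x - ballAverage r (w m) x‖ + ‖ballAverage r (w m) x - b⁻¹ • l x‖) +
        (‖w n x - ballAverage r (w n) x‖ + ‖ballAverage r (w n) x - b⁻¹ • l x‖)) := by
    refine integral_mono ((hwint m).integrableOn.sub (hwint n).integrableOn).norm
      (((hi m).add (hj m)).add ((hi n).add (hj n))) fun x => ?_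
    have e1 := norm_sub_le_norm_sub_add_norm_sub (w m x) (ballAverage r (w m) x) (b⁻¹ • l x)
    have e2 := norm_sub_le_norm_sub_add_norm_sub (w n x) (ballAverage r (w n) x) (b⁻¹ • l x)
    have e3 := norm_sub_le_norm_sub_add_norm_sub (w m x) (b⁻¹ • l x) (w n x)
    rw [norm_sub_rev (b⁻¹ • l x)] at e3
    exact e3.trans (add_le_add e1 e2)
  have hij : ∀ n, IntegrableOn (fun x => ‖w n x - ballAverage r (w n) x‖ +
      ‖ballAverage r (w n) x - b⁻¹ • l x‖) Ω := fun n => (hi n).add (hj n)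
  rw [integral_add (hij m) (hij n), integral_add (hi m) (hj m), integral_add (hi n) (hj n)] at h3
  linarith [h1 m hm, h1 n hn, h2 m, h2 n]

/-- A bounded sequence in `L²` has a subsequence whose integrals over all measurable sets
converge. -/
theorem exists_subseq_tendsto_setIntegral {α : Type*} [MeasurableSpace α]
    [MeasurableSpace.CountablyGenerated α] {μ : Measure α} [IsFiniteMeasure μ]
    {f : ℕ → α → EuclideanSpace ℝ ι} (hf : ∀ n, MemLp (f n) 2 μ) {C : ℝ}
    (hC : ∀ n, ∫ x, ‖f n x‖ ^ 2 ∂μ ≤ C) :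
    ∃ ns : ℕ → ℕ, StrictMono ns ∧ ∀ s, MeasurableSet s →
      ∃ l, Tendsto (fun n => ∫ x in s, f (ns n) x ∂μ) atTop (𝓝 l) := by
  classical
  set g : ℕ → Lp (EuclideanSpace ℝ ι) 2 μ := fun n => (hf n).toLp (f n) with hg
  have hbd : ∀ n, ‖g n‖ ≤ √C := by
    intro n
    refine Real.le_sqrt_of_sq_le ?_
    rw [← real_inner_self_eq_norm_sq, L2.inner_def]
    refine le_trans (le_of_eq ?_) (hC n)
    refine integral_congr_ae ((hf n).coeFn_toLp.mono fun x hx => ?_)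
    simp only [hg, hx, real_inner_self_eq_norm_sq]
  have : Fact ((2 : ENNReal) ≠ ⊤) := ⟨by simp⟩
  obtain ⟨ℓ, -, ns, hns, hlim⟩ := (WeakDual.isSeqCompact_closedBall ℝ
    (Lp (EuclideanSpace ℝ ι) 2 μ) 0 √C) (x := fun n =>
      StrongDual.toWeakDual (InnerProductSpace.toDual ℝ _ (g n))) (fun n => by
        rw [mem_preimage, mem_closedBall_zero_iff]
        exact ((InnerProductSpace.toDual ℝ _).norm_map (g n)).trans_le (hbd n))
  refine ⟨ns, hns, fun s hs => ?_⟩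
  have hev := fun h => (WeakDual.eval_continuous h).continuousAt.tendsto.comp hlim
  refine ⟨WithLp.toLp 2 fun i => ℓ (indicatorConstLp 2 hs (measure_ne_top μ s)
    (EuclideanSpace.single i 1)), ?_⟩
  have e : ∀ n i, (∫ x in s, f n x ∂μ) i =
      InnerProductSpace.toDual ℝ _ (g n) (indicatorConstLp 2 hs (measure_ne_top μ s)
        (EuclideanSpace.single i 1)) := by
    intro n i
    rw [InnerProductSpace.toDual_apply_apply, real_inner_comm,
      L2.inner_indicatorConstLp_eq_inner_setIntegral, EuclideanSpace.inner_single_left]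
    simp only [map_one, one_mul]
    have : ∫ x in s, f n x ∂μ = ∫ x in s, g n x ∂μ :=
      setIntegral_congr_ae hs ((hf n).coeFn_toLp.mono fun x hx _ => hx.symm)
    rw [this]
  have hpi : Tendsto (fun n => (∫ x in s, f (ns n) x ∂μ).ofLp) atTop (𝓝 fun i =>
      ℓ (indicatorConstLp 2 hs (measure_ne_top μ s) (EuclideanSpace.single i 1))) := by
    rw [tendsto_pi_nhds]
    intro i
    simp only [e]
    exact hev _
  exact ((PiLp.continuous_toLp 2 _).tendsto _).comp hpi

end LdG

namespace LdG

variable {d : ℕ} {ι : Type} [Fintype ι] {Ω : Set (E d)} {φ : ℝ → ℝ}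

/-! ### Modular limits of test maps -/

variable {μ : Measure (E d)} [IsFiniteMeasure μ]

theorem IsTest.memMod (h : IsPowerConvexDensity φ) {η : E d → EuclideanSpace ℝ ι}
    (hη : IsTest Ω η) : MemMod φ μ η := by
  obtain ⟨C, hC⟩ := hη.hasCompactSupport.exists_bound_of_continuous hη.contDiff.continuous
  exact .of_le h hη.contDiff.continuous.aestronglyMeasurable (integrable_const (φ C))
    (ae_of_all _ fun x => h.monotoneOn (mem_Ici.2 (norm_nonneg _))
      (mem_Ici.2 ((norm_nonneg _).trans (hC x))) (hC x))

theorem IsTest.memMod_grad (h : IsPowerConvexDensity φ) {η : E d → EuclideanSpace ℝ ι}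
    (hη : IsTest Ω η) : MemMod φ μ (grad η) := by
  obtain ⟨C, hC⟩ := hη.hasCompactSupport_grad.exists_bound_of_continuous hη.continuous_grad
  exact .of_le h hη.continuous_grad.aestronglyMeasurable (integrable_const (φ C))
    (ae_of_all _ fun x => h.monotoneOn (mem_Ici.2 (norm_nonneg _))
      (mem_Ici.2 ((norm_nonneg _).trans (hC x))) (hC x))

/-- The pair `(u, G)` is a limit of pairs `(η, ∇η)`, with `η` a test map, for modular convergence
on `Ω`. -/
def IsTestLimit (φ : ℝ → ℝ) (Ω : Set (E d)) (u : E d → EuclideanSpace ℝ ι)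
    (G : E d → EuclideanSpace ℝ (Fin d × ι)) : Prop :=
  ∀ ε > 0, ∃ η, IsTest Ω η ∧ modular φ (volume.restrict Ω) (u - η) < ε ∧
    modular φ (volume.restrict Ω) (G - grad η) < ε

/-- A map of class `W^{1,φ}(Ω)`, given together with its weak gradient. -/
structure MemSobolev (φ : ℝ → ℝ) (Ω : Set (E d)) (u : E d → EuclideanSpace ℝ ι)
    (G : E d → EuclideanSpace ℝ (Fin d × ι)) : Prop where
  isGrad : IsGrad Ω u G
  memMod : MemMod φ (volume.restrict Ω) u
  memMod_grad : MemMod φ (volume.restrict Ω) G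

variable {u v : E d → EuclideanSpace ℝ ι} {G D : E d → EuclideanSpace ℝ (Fin d × ι)}

namespace MemSobolev

theorem add (h : IsPowerConvexDensity φ) (hu : MemSobolev φ Ω u G) (hv : MemSobolev φ Ω v D) :
    MemSobolev φ Ω (u + v) (G + D) :=
  ⟨hu.1.add hv.1, hu.2.add h hv.2, hu.3.add h hv.3⟩

theorem sub (h : IsPowerConvexDensity φ) (hu : MemSobolev φ Ω u G) (hv : MemSobolev φ Ω v D) :
    MemSobolev φ Ω (u - v) (G - D) :=
  ⟨hu.1.sub hv.1, hu.2.sub h hv.2, hu.3.sub h hv.3⟩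

theorem smul (h : IsPowerConvexDensity φ) (hu : MemSobolev φ Ω u G) (a : ℝ) :
    MemSobolev φ Ω (a • u) (a • G) :=
  ⟨hu.1.smul a, hu.2.smul h a, hu.3.smul h a⟩

end MemSobolev

variable [IsFiniteMeasure ((volume : Measure (E d)).restrict Ω)]

theorem IsTest.memSobolev (h : IsPowerConvexDensity φ) {η : E d → EuclideanSpace ℝ ι}
    (hη : IsTest Ω η) : MemSobolev φ Ω η (grad η) :=
  ⟨hη.isGrad, hη.memMod h, hη.memMod_grad h⟩

namespace IsTestLimit

theorem convex (h : IsPowerConvexDensity φ) (hu : MemSobolev φ Ω u G) (hv : MemSobolev φ Ω v D)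
    (hu' : IsTestLimit φ Ω u G) (hv' : IsTestLimit φ Ω v D) {a b : ℝ} (ha : 0 ≤ a) (hb : 0 ≤ b)
    (hab : a + b = 1) : IsTestLimit φ Ω (a • u + b • v) (a • G + b • D) := by
  intro ε hε
  obtain ⟨η, hη, h1, h2⟩ := hu' ε hε
  obtain ⟨ζ, hζ, h3, h4⟩ := hv' ε hε
  have hS := hu.sub h (hη.memSobolev h)
  have hT := hv.sub h (hζ.memSobolev h)
  have hcomb : ∀ {s t : ℝ}, s < ε → t < ε → a * s + b * t < ε := fun {s t} hs ht => by
    rcases ha.eq_or_lt with rfl | ha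
    · have : b = 1 := by linarith
      simpa [this] using ht
    · calc a * s + b * t < a * ε + b * ε :=
          add_lt_add_of_lt_of_le (mul_lt_mul_of_pos_left hs ha)
            (mul_le_mul_of_nonneg_left ht.le hb)
        _ = ε := by rw [← add_mul, hab, one_mul]
  refine ⟨a • η + b • ζ, (hη.smul a).add (hζ.smul b), ?_, ?_⟩
  · rw [show a • u + b • v - (a • η + b • ζ) = a • (u - η) + b • (v - ζ) by
      rw [smul_sub, smul_sub]; abel]
    exact (modular_convex h hS.2 hT.2 ha hb hab).trans_lt (hcomb h1 h3)
  · rw [(hη.smul a).grad_add (hζ.smul b), hη.grad_smul, hζ.grad_smul,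
      show a • G + b • D - (a • grad η + b • grad ζ) = a • (G - grad η) + b • (D - grad ζ) by
        rw [smul_sub, smul_sub]; abel]
    exact (modular_convex h hS.3 hT.3 ha hb hab).trans_lt (hcomb h2 h4)

theorem of_tendsto (h : IsPowerConvexDensity φ) {w : ℕ → E d → EuclideanSpace ℝ ι}
    {g : ℕ → E d → EuclideanSpace ℝ (Fin d × ι)} (hw : ∀ n, MemSobolev φ Ω (w n) (g n))
    (hl : ∀ n, IsTestLimit φ Ω (w n) (g n)) (hu : MemSobolev φ Ω u G)
    (h1 : Tendsto (fun n => modular φ (volume.restrict Ω) (w n - u)) atTop (𝓝 0))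
    (h2 : Tendsto (fun n => modular φ (volume.restrict Ω) (g n - G)) atTop (𝓝 0)) :
    IsTestLimit φ Ω u G := by
  intro ε hε
  obtain ⟨K, hK0, hK⟩ := exists_modular_add_le (μ := volume.restrict Ω) h
  have hδ : 0 < ε / (2 * (K + 1)) := by positivity
  obtain ⟨n, hn1, hn2⟩ := ((h1.eventually_lt_const hδ).and (h2.eventually_lt_const hδ)).exists
  obtain ⟨η, hη, h3, h4⟩ := hl n _ hδ
  have hS := hu.sub h (hw n)
  have hT := (hw n).sub h (hη.memSobolev h)
  have hcomb : ∀ {s t : ℝ}, 0 ≤ s → 0 ≤ t → s < ε / (2 * (K + 1)) → t < ε / (2 * (K + 1)) →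
      K * (s + t) < ε := fun {s t} hs0 ht0 hs ht => by
    rw [lt_div_iff₀ (by positivity)] at hs ht
    nlinarith
  refine ⟨η, hη, ?_, ?_⟩
  · have := hK _ _ _ hS.2 hT.2
    rw [sub_add_sub_cancel] at this
    refine this.trans_lt (hcomb (modular_nonneg h) (modular_nonneg h) ?_ h3)
    rwa [modular_sub_comm]
  · have := hK _ _ _ hS.3 hT.3
    rw [sub_add_sub_cancel] at this
    refine this.trans_lt (hcomb (modular_nonneg h) (modular_nonneg h) ?_ h4)
    rwa [modular_sub_comm]

end IsTestLimit

/-- Rellich's theorem for maps with zero boundary values which are bounded in `L²`. The bound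
provides a weakly convergent subsequence, so that the averages over balls converge, and the gradient
bound makes these averages uniformly close in `L¹` to the (test) maps themselves. -/
theorem exists_subseq_tendsto_L1 (h : IsPowerConvexDensity φ) (hΩ : IsOpen Ω)
    {w : ℕ → E d → EuclideanSpace ℝ ι} {g : ℕ → E d → EuclideanSpace ℝ (Fin d × ι)}
    (hw : ∀ n, MemSobolev φ Ω (w n) (g n)) (hl : ∀ n, IsTestLimit φ Ω (w n) (g n)) {K C : ℝ}
    (hK : ∀ n, modular φ (volume.restrict Ω) (g n) ≤ K)
    (hint : ∀ n, IntegrableOn (fun x => ‖w n x‖ ^ 2) Ω) (hC : ∀ n, ∫ x in Ω, ‖w n x‖ ^ 2 ≤ C) :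
    ∃ (ns : ℕ → ℕ) (u : E d → EuclideanSpace ℝ ι), StrictMono ns ∧ IntegrableOn u Ω ∧
      Tendsto (fun n => ∫ x in Ω, ‖w (ns n) x - u x‖) atTop (𝓝 0) := by
  -- test maps, unlike the `w n`, vanish outside `Ω` and hence are Sobolev maps on the whole space
  choose η hη h1 h2 using fun n : ℕ => hl n (1 / ((n : ℝ) + 1)) (by positivity)
  have hm1 : ∀ n, MemMod φ (volume.restrict Ω) (w n - η n) := fun n =>
    (hw n).2.sub h ((hη n).memMod h)
  have hm2 : ∀ n, MemMod φ (volume.restrict Ω) (g n - grad (η n)) := fun n =>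
    (hw n).3.sub h ((hη n).memMod_grad h)
  have hηi : ∀ n, Integrable (η n) := fun n =>
    (hη n).contDiff.continuous.integrable_of_hasCompactSupport (hη n).hasCompactSupport
  have hwi : ∀ n, IntegrableOn (w n) Ω := fun n => (hw n).2.memMod_integrable h
  have hgi : ∀ n, IntegrableOn (g n) Ω := fun n => (hw n).3.memMod_integrable h
  have hgηi : ∀ n, Integrable (grad (η n)) := fun n =>
    (hη n).continuous_grad.integrable_of_hasCompactSupport (hη n).hasCompactSupport_grad
  have hwη : Tendsto (fun n => ∫ x in Ω, ‖(w n - η n) x‖) atTop (𝓝 0) :=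
    tendsto_integral_norm_of_modular h hm1 (squeeze_zero (fun _ => modular_nonneg h)
      (fun n => (h1 n).le) tendsto_one_div_add_atTop_nhds_zero_nat)
  obtain ⟨A, hA0, hA⟩ := exists_integral_norm_le (μ := volume.restrict Ω) h one_pos
  have hone : ∀ n : ℕ, 1 / ((n : ℝ) + 1) ≤ 1 := fun n => by
    rw [div_le_one (by positivity)]; linarith [n.cast_nonneg (α := ℝ)]
  have hg1 : ∀ n, ∫ x, ‖grad (η n) x‖ ≤ (1 + A * 1) + (1 + A * K) := by
    intro n
    rw [← setIntegral_eq_integral_of_forall_compl_eq_zero (s := Ω) fun x hx => ?_]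
    · have e1 := (hA _ _ (hm2 n)).trans (add_le_add_right
        (mul_le_mul_of_nonneg_left ((h2 n).le.trans (hone n)) hA0) 1)
      have e2 := (hA _ _ (hw n).3).trans (add_le_add_right
        (mul_le_mul_of_nonneg_left (hK n) hA0) 1)
      refine le_trans ?_ (add_le_add e1 e2)
      rw [← integral_add ((hm2 n).memMod_integrable h).norm (hgi n).norm]
      refine integral_mono (hgηi n).integrableOn.norm
        (((hm2 n).memMod_integrable h).norm.add (hgi n).norm) fun x => ?_
      have := norm_sub_norm_le (grad (η n) x) (g n x)
      rw [norm_sub_rev] at this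
      simp only [Pi.sub_apply]
      linarith
    · have hx' : x ∉ tsupport (fderiv ℝ (η n)) := fun hm =>
        hx ((hη n).tsupport_subset (tsupport_fderiv_subset ℝ hm))
      have h0 : fderiv ℝ (η n) x = 0 := image_eq_zero_of_notMem_tsupport hx'
      rw [norm_eq_zero]
      ext p
      simp [grad, h0]
  have hη0 : ∀ n x, x ∉ Ω → η n x = 0 := fun n x hx =>
    image_eq_zero_of_notMem_tsupport fun hm => hx ((hη n).tsupport_subset hm)
  have hwC : ∀ n, ∫ x in Ω, ‖w n x‖ ≤ (volume.restrict Ω).real univ + C := by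
    intro n
    have e : ∫ x in Ω, ‖w n x‖ ≤ ∫ x in Ω, (1 + ‖w n x‖ ^ 2) :=
      integral_mono (hwi n).norm ((integrable_const 1).add (hint n)) fun x => by
        nlinarith [sq_nonneg (‖w n x‖ - 1), norm_nonneg (w n x)]
    rw [integral_add (integrable_const 1) (hint n), integral_const, smul_eq_mul, mul_one] at e
    linarith [hC n]
  have hη1 : ∀ n, ∫ x, ‖η n x‖ ≤ (1 + A * 1) + ((volume.restrict Ω).real univ + C) := by
    intro n
    rw [← setIntegral_eq_integral_of_forall_compl_eq_zero (s := Ω) fun x hx => by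
      rw [hη0 n x hx, norm_zero]]
    have e1 := (hA _ _ (hm1 n)).trans (add_le_add_right
      (mul_le_mul_of_nonneg_left ((h1 n).le.trans (hone n)) hA0) 1)
    refine le_trans ?_ (add_le_add e1 (hwC n))
    rw [← integral_add ((hm1 n).memMod_integrable h).norm (hwi n).norm]
    refine integral_mono (hηi n).integrableOn.norm
      (((hm1 n).memMod_integrable h).norm.add (hwi n).norm) fun x => ?_
    have := norm_sub_norm_le (η n x) (w n x)
    rw [norm_sub_rev] at this
    simp only [Pi.sub_apply]
    linarith
  obtain ⟨ns, hns, hweak⟩ := exists_subseq_tendsto_setIntegral (μ := volume.restrict Ω)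
    (fun n => (memLp_two_iff_integrable_sq_norm (hwi n).aestronglyMeasurable).2 (hint n)) hC
  have hwη' := hwη.comp hns.tendsto_atTop
  have hcauchy := cauchy_of_tendsto_setIntegral_ball (Ω := Ω) (w := fun n => η (ns n))
    (by simpa using measure_ne_top (volume.restrict Ω) univ) (fun n => hη _) (fun n => hg1 _)
    (fun n => hη1 _) fun x r => by
      obtain ⟨l, hl⟩ := hweak (Metric.ball x r) measurableSet_ball
      refine ⟨l, ?_⟩
      have e : ∀ n, ∫ y in Metric.ball x r, η n y =
          ∫ y in Metric.ball x r, η n y ∂(volume.restrict Ω) := by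
        intro n
        rw [Measure.restrict_restrict measurableSet_ball, inter_comm,
          ← Measure.restrict_restrict hΩ.measurableSet,
          setIntegral_eq_integral_of_forall_compl_eq_zero (hη0 n)]
      simp only [e]
      have hz : Tendsto (fun n => ∫ y in Metric.ball x r, (w (ns n) - η (ns n)) y
          ∂(volume.restrict Ω)) atTop (𝓝 0) := by
        refine squeeze_zero_norm (fun n => ?_) hwη'
        refine (norm_integral_le_integral_norm _).trans ?_
        exact setIntegral_le_integral ((hwi _).sub (hηi _).integrableOn).norm
          (ae_of_all _ fun _ => norm_nonneg _)
      have := hl.sub hz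
      rw [sub_zero] at this
      refine this.congr fun n => ?_
      have hs : ∫ y in Metric.ball x r, (w (ns n) - η (ns n)) y ∂(volume.restrict Ω) =
          ∫ y in Metric.ball x r, w (ns n) y ∂(volume.restrict Ω) -
          ∫ y in Metric.ball x r, η (ns n) y ∂(volume.restrict Ω) :=
        integral_sub (hwi _).integrableOn (hηi _).integrableOn.integrableOn
      rw [hs, sub_sub_cancel]
  obtain ⟨u, hu, hlim⟩ := exists_integrable_limit (μ := volume.restrict Ω)
    (w := fun n => η (ns n)) (fun n => (hηi _).integrableOn) hcauchy
  refine ⟨ns, u, hns, hu, ?_⟩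
  have hsum := hwη'.add hlim
  rw [add_zero] at hsum
  refine squeeze_zero (fun n => integral_nonneg fun _ => norm_nonneg _) (fun n => ?_) hsum
  have hi1 : IntegrableOn (fun x => ‖(w (ns n) - η (ns n)) x‖) Ω :=
    ((hwi _).sub (hηi _).integrableOn).norm
  have hi2 : IntegrableOn (fun x => ‖η (ns n) x - u x‖) Ω := ((hηi _).integrableOn.sub hu).norm
  rw [Function.comp_apply, ← integral_add hi1 hi2]
  exact integral_mono ((hwi _).sub hu).norm (hi1.add hi2) fun x =>
    norm_sub_le_norm_sub_add_norm_sub _ _ _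

end LdG

namespace LdG

variable {d : ℕ} {ι : Type} [Fintype ι] {Ω : Set (E d)} {φ : ℝ → ℝ}
  [IsFiniteMeasure ((volume : Measure (E d)).restrict Ω)]

/-! ### Convex combinations of almost minimal energy -/

/-- Lower semicontinuity of the energy along a sequence which converges in the modular sense,
together with the existence of the limit gradient and the persistence of boundary values.

In the convex hull of each tail of the sequence, pick a pair whose energy is almost the infimum
over that hull. Midpoints of such pairs are again in the hull of a tail, so their energy is not much
smaller; by uniform convexity the chosen gradients form a Cauchy sequence. -/
theorem exists_grad_of_tendsto_modular (h : IsPowerConvexDensity φ)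
    {w : ℕ → E d → EuclideanSpace ℝ ι} {g : ℕ → E d → EuclideanSpace ℝ (Fin d × ι)}
    {u b : E d → EuclideanSpace ℝ ι} {D : E d → EuclideanSpace ℝ (Fin d × ι)}
    (hw : ∀ n, MemSobolev φ Ω (w n) (g n)) {K : ℝ}
    (hK : ∀ n, modular φ (volume.restrict Ω) (g n) ≤ K)
    (hu : MemMod φ (volume.restrict Ω) u)
    (hlim : Tendsto (fun n => modular φ (volume.restrict Ω) (w n - u)) atTop (𝓝 0))
    (hb : MemSobolev φ Ω b D) (hl : ∀ n, IsTestLimit φ Ω (w n - b) (g n - D)) :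
    ∃ G, MemSobolev φ Ω u G ∧ IsTestLimit φ Ω (u - b) (G - D) ∧
      ∀ c, (∃ᶠ n in atTop, modular φ (volume.restrict Ω) (g n) ≤ c) →
        modular φ (volume.restrict Ω) G ≤ c := by
  set μ := (volume : Measure (E d)).restrict Ω with hμ
  have hK0 : 0 ≤ K := (modular_nonneg h).trans (hK 0)
  let P : Set ((E d → EuclideanSpace ℝ ι) × (E d → EuclideanSpace ℝ (Fin d × ι))) :=
    {p | MemSobolev φ Ω p.1 p.2 ∧ modular φ μ p.2 ≤ K ∧ IsTestLimit φ Ω (p.1 - b) (p.2 - D)}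
  have hsplit : ∀ {F : Type} [AddCommGroup F] [Module ℝ F] {s t : ℝ} (x y z : F), s + t = 1 →
      s • x + t • y - z = s • (x - z) + t • (y - z) := fun {F} _ _ {s t} x y z hst => by
    rw [smul_sub, smul_sub, sub_add_sub_comm, ← add_smul, hst, one_smul]
  have hP : Convex ℝ P := by
    intro p hp q hq s t hs ht hst
    refine ⟨(hp.1.smul h s).add h (hq.1.smul h t), ?_, ?_⟩
    · refine (modular_convex h hp.1.3 hq.1.3 hs ht hst).trans ?_
      calc s * modular φ μ p.2 + t * modular φ μ q.2 ≤ s * K + t * K :=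
            add_le_add (mul_le_mul_of_nonneg_left hp.2.1 hs) (mul_le_mul_of_nonneg_left hq.2.1 ht)
        _ = K := by rw [← add_mul, hst, one_mul]
    · have := IsTestLimit.convex h (hp.1.sub h hb) (hq.1.sub h hb) hp.2.2 hq.2.2 hs ht hst
      rw [← hsplit p.1 q.1 b hst, ← hsplit p.2 q.2 D hst] at this
      exact this
  have hPc : ∀ ε, Convex ℝ (P ∩ {p | modular φ μ (p.1 - u) ≤ ε}) := by
    intro ε p hp q hq s t hs ht hst
    refine ⟨hP hp.1 hq.1 hs ht hst, ?_⟩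
    change modular φ μ (s • p.1 + t • q.1 - u) ≤ ε
    rw [hsplit p.1 q.1 u hst]
    refine (modular_convex h (hp.1.1.2.sub h hu) (hq.1.1.2.sub h hu) hs ht hst).trans ?_
    calc s * modular φ μ (p.1 - u) + t * modular φ μ (q.1 - u) ≤ s * ε + t * ε :=
          add_le_add (mul_le_mul_of_nonneg_left hp.2 hs) (mul_le_mul_of_nonneg_left hq.2 ht)
      _ = ε := by rw [← add_mul, hst, one_mul]
  let S : ℕ → Set ((E d → EuclideanSpace ℝ ι) × (E d → EuclideanSpace ℝ (Fin d × ι))) :=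
    fun n => convexHull ℝ ((fun k => (w k, g k)) '' Ici n)
  have hSmin : ∀ n T, Convex ℝ T → (∀ k ≥ n, (w k, g k) ∈ T) → S n ⊆ T := fun n T hT hk =>
    convexHull_min (by
      rintro _ ⟨k, hnk, rfl⟩
      exact hk k hnk) hT
  have hSconv : ∀ n, Convex ℝ (S n) := fun n => convex_convexHull ℝ _
  have hSP : ∀ n, S n ⊆ P := fun n => hSmin n P hP fun k _ => ⟨hw k, hK k, hl k⟩
  have hSanti : ∀ m n, m ≤ n → S n ⊆ S m := fun m n hmn =>
    convexHull_mono (image_mono (Ici_subset_Ici.2 hmn))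
  have hmem : ∀ n k, n ≤ k → (w k, g k) ∈ S n := fun n k hnk =>
    subset_convexHull ℝ _ ⟨k, hnk, rfl⟩
  clear_value S
  let J : (E d → EuclideanSpace ℝ ι) × (E d → EuclideanSpace ℝ (Fin d × ι)) → ℝ :=
    fun p => modular φ μ p.2
  let I : ℕ → ℝ := fun n => sInf (J '' S n)
  have hbdd : ∀ n, BddBelow (J '' S n) := fun n => ⟨0, by
    rintro _ ⟨p, -, rfl⟩
    exact modular_nonneg h⟩
  have hIle : ∀ n p, p ∈ S n → I n ≤ modular φ μ p.2 := fun n p hp => csInf_le (hbdd n) ⟨p, hp, rfl⟩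
  have hImono : Monotone I := fun m n hmn =>
    csInf_le_csInf (hbdd m) ⟨_, _, hmem n n le_rfl, rfl⟩ (image_mono (hSanti m n hmn))
  have hIbdd : BddAbove (range I) := ⟨K, by
    rintro _ ⟨n, rfl⟩
    exact (hIle n (w n, g n) (hmem n n le_rfl)).trans (hK n)⟩
  have hpick : ∀ n : ℕ, ∃ p ∈ S n, modular φ μ p.2 < I n + 1 / ((n : ℝ) + 1) := fun n => by
    obtain ⟨_, ⟨p, hp, rfl⟩, hlt⟩ := exists_lt_of_csInf_lt
      (⟨_, _, hmem n n le_rfl, rfl⟩ : (J '' S n).Nonempty)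
      (lt_add_of_pos_right (I n) (show 0 < 1 / ((n : ℝ) + 1) by positivity))
    exact ⟨p, hp, hlt⟩
  clear_value I
  choose p hpS hpJ using hpick
  have hpP : ∀ n, p n ∈ P := fun n => hSP n (hpS n)
  have hIlim : Tendsto I atTop (𝓝 (⨆ n, I n)) := tendsto_atTop_ciSup hImono hIbdd
  have hIsup : ∀ n, I n ≤ ⨆ n, I n := fun n => le_ciSup hIbdd n
  have hcauchy : ∀ ε > 0, ∃ N, ∀ m ≥ N, ∀ n ≥ N, modular φ μ ((p m).2 - (p n).2) < ε := by
    intro ε hε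
    obtain ⟨C, hC0, hC⟩ := exists_modular_sub_le (α := E d) (μ := μ)
      (F := EuclideanSpace ℝ (Fin d × ι)) h (show 0 < ε / (4 * (K + 1)) by positivity)
    have hgap : Tendsto (fun n : ℕ => (⨆ n, I n) + 1 / ((n : ℝ) + 1) - I n) atTop (𝓝 0) := by
      have := (tendsto_const_nhds (x := ⨆ n, I n)).add
        (tendsto_one_div_add_atTop_nhds_zero_nat (𝕜 := ℝ)) |>.sub hIlim
      simpa using this
    obtain ⟨N, hN⟩ := (hgap.eventually_lt_const
      (show 0 < ε / (2 * (C + 1)) by positivity)).exists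
    refine ⟨N, fun m hm n hn => ?_⟩
    have hmid : (1 / 2 : ℝ) • (p m + p n) ∈ S N := by
      rw [smul_add]
      exact hSconv N (hSanti _ _ hm (hpS m)) (hSanti _ _ hn (hpS n))
        (by norm_num) (by norm_num) (by norm_num)
    have h1 : I N ≤ modular φ μ ((1 / 2 : ℝ) • ((p m).2 + (p n).2)) := by
      have := hIle N _ hmid
      rwa [Prod.smul_snd, Prod.snd_add] at this
    have h2 : ∀ k ≥ N, modular φ μ (p k).2 ≤ (⨆ n, I n) + 1 / ((N : ℝ) + 1) := fun k hk => by
      have e1 : 1 / ((k : ℝ) + 1) ≤ 1 / ((N : ℝ) + 1) :=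
        one_div_le_one_div_of_le (by positivity) (by
          have : (N : ℝ) ≤ k := by exact_mod_cast hk
          linarith)
      have e2 : modular φ μ (p k).2 < I k + 1 / ((k : ℝ) + 1) := hpJ k
      linarith [hIsup k]
    have h3 := hC _ _ (hpP m).1.3 (hpP n).1.3
    have h4 : ε / (4 * (K + 1)) * (modular φ μ (p m).2 + modular φ μ (p n).2) ≤ ε / 2 := by
      rw [div_mul_eq_mul_div, div_le_div_iff₀ (by positivity) two_pos]
      nlinarith [(hpP m).2.1, (hpP n).2.1]
    have h5 : C * ((modular φ μ (p m).2 + modular φ μ (p n).2) / 2 -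
        modular φ μ ((1 / 2 : ℝ) • ((p m).2 + (p n).2))) ≤ C * (ε / (2 * (C + 1))) :=
      mul_le_mul_of_nonneg_left (by linarith [h2 m hm, h2 n hn]) hC0
    have h6 : C * (ε / (2 * (C + 1))) < ε / 2 := by
      rw [mul_div_assoc', div_lt_div_iff₀ (by positivity) two_pos]
      nlinarith
    linarith
  obtain ⟨G, hG, hGlim⟩ := exists_modular_limit h (w := fun n => (p n).2)
    (fun n => (hpP n).1.3) hcauchy
  have hulim : Tendsto (fun n => modular φ μ ((p n).1 - u)) atTop (𝓝 0) := by
    rw [Metric.tendsto_atTop]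
    intro ε hε
    obtain ⟨N, hN⟩ := eventually_atTop.1 (hlim.eventually_lt_const (half_pos hε))
    refine ⟨N, fun n hn => ?_⟩
    rw [Real.dist_0_eq_abs, abs_of_nonneg (modular_nonneg h)]
    have : S n ⊆ P ∩ {p | modular φ μ (p.1 - u) ≤ ε / 2} := hSmin n _ (hPc _) fun k hk =>
      ⟨⟨hw k, hK k, hl k⟩, (hN k (hn.trans hk)).le⟩
    have h1 : modular φ μ ((p n).1 - u) ≤ ε / 2 := (this (hpS n)).2
    linarith
  have hgrad : IsGrad Ω u G := by
    refine IsGrad.of_tendsto (fun n => (hpP n).1.1) (fun n => (hpP n).1.2.memMod_integrable h)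
      (hu.memMod_integrable h) (fun n => (hpP n).1.3.memMod_integrable h)
      (hG.memMod_integrable h) ?_ ?_
    · exact tendsto_integral_norm_of_modular h (fun n => (hpP n).1.2.sub h hu) hulim
    · exact tendsto_integral_norm_of_modular h (fun n => (hpP n).1.3.sub h hG) hGlim
  have hS : MemSobolev φ Ω u G := ⟨hgrad, hu, hG⟩
  refine ⟨G, hS, ?_, fun c hc => ?_⟩
  · refine IsTestLimit.of_tendsto h (fun n => (hpP n).1.sub h hb) (fun n => (hpP n).2.2)
      (hS.sub h hb) ?_ ?_
    · simpa only [sub_sub_sub_cancel_right] using hulim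
    · simpa only [sub_sub_sub_cancel_right] using hGlim
  · have h1 : ∀ n, modular φ μ (p n).2 ≤ c + 1 / ((n : ℝ) + 1) := by
      intro n
      obtain ⟨k, hk, hkc⟩ := frequently_atTop.1 hc n
      have e1 : I n ≤ modular φ μ (g k) := hIle n (w k, g k) (hmem n k hk)
      have e2 : modular φ μ (p n).2 < I n + 1 / ((n : ℝ) + 1) := hpJ n
      linarith
    have h2 := tendsto_modular h (fun n => (hpP n).1.3) hG (fun n => (hpP n).2.1) hGlim
    refine le_of_tendsto_of_tendsto' h2 ?_ h1
    have := (tendsto_const_nhds (x := c)).add (tendsto_one_div_add_atTop_nhds_zero_nat (𝕜 := ℝ))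
    simpa using this

/-- If the energies along the sequence do not exceed the energy of the limit, then the gradients
converge in the modular sense: the energy of the midpoints is lower semicontinuous as well, hence
the convexity defect tends to `0`. -/
theorem tendsto_modular_grad_sub (h : IsPowerConvexDensity φ) (hΩ : IsOpen Ω)
    {w : ℕ → E d → EuclideanSpace ℝ ι} {g : ℕ → E d → EuclideanSpace ℝ (Fin d × ι)}
    {u b : E d → EuclideanSpace ℝ ι} {G D : E d → EuclideanSpace ℝ (Fin d × ι)}
    (hw : ∀ n, MemSobolev φ Ω (w n) (g n)) (hu : MemSobolev φ Ω u G)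
    (hle : ∀ n, modular φ (volume.restrict Ω) (g n) ≤ modular φ (volume.restrict Ω) G)
    (hlim : Tendsto (fun n => modular φ (volume.restrict Ω) (w n - u)) atTop (𝓝 0))
    (hb : MemSobolev φ Ω b D) (hl : ∀ n, IsTestLimit φ Ω (w n - b) (g n - D))
    (hl0 : IsTestLimit φ Ω (u - b) (G - D)) :
    Tendsto (fun n => modular φ (volume.restrict Ω) (g n - G)) atTop (𝓝 0) := by
  set μ := (volume : Measure (E d)).restrict Ω with hμ
  set m := modular φ μ G with hm
  have hm0 : 0 ≤ m := modular_nonneg h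
  have half : ∀ {F : Type} [AddCommGroup F] [Module ℝ F] (x y z : F),
      (1 / 2 : ℝ) • (x + y) - z = (1 / 2 : ℝ) • (x - z) + (1 / 2 : ℝ) • (y - z) :=
    fun {F} _ _ x y z => by module
  have hmidS : ∀ n, MemSobolev φ Ω ((1 / 2 : ℝ) • (w n + u)) ((1 / 2 : ℝ) • (g n + G)) :=
    fun n => ((hw n).add h hu).smul h _
  have hmidlim : Tendsto (fun n => modular φ μ ((1 / 2 : ℝ) • (w n + u) - u)) atTop (𝓝 0) := by
    refine squeeze_zero (fun n => modular_nonneg h) (fun n => ?_) hlim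
    rw [half, sub_self]
    have hz : MemMod φ μ (0 : E d → EuclideanSpace ℝ ι) := by
      simpa using hu.2.sub h hu.2
    refine (modular_convex h ((hw n).2.sub h hu.2) hz (by norm_num) (by norm_num)
      (by norm_num)).trans ?_
    have : modular φ μ (0 : E d → EuclideanSpace ℝ ι) = 0 := by
      simp [modular, h.map_zero]
    rw [this]
    linarith [modular_nonneg h (μ := μ) (u := w n - u)]
  have hmidle : ∀ n, modular φ μ ((1 / 2 : ℝ) • (g n + G)) ≤ m := fun n => by
    rw [smul_add]
    refine (modular_convex h (hw n).3 hu.3 (by norm_num) (by norm_num) (by norm_num)).trans ?_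
    linarith [hle n]
  obtain ⟨G', hG', -, hlsc⟩ := exists_grad_of_tendsto_modular h hmidS hmidle hu.2 hmidlim hb
    fun n => by
      rw [half, half]
      exact IsTestLimit.convex h ((hw n).sub h hb) (hu.sub h hb) (hl n) hl0 (by norm_num)
        (by norm_num) (by norm_num)
  have hGG' : modular φ μ G' = m := modular_congr (hG'.1.ae_eq hΩ hu.1)
  rw [Metric.tendsto_atTop]
  intro ε hε
  obtain ⟨C, hC0, hC⟩ := exists_modular_sub_le (α := E d) (μ := μ)
    (F := EuclideanSpace ℝ (Fin d × ι)) h (show 0 < ε / (4 * (m + 1)) by positivity)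
  have hev : ∀ᶠ n in atTop, m - ε / (2 * (C + 1)) < modular φ μ ((1 / 2 : ℝ) • (g n + G)) := by
    by_contra hcon
    rw [not_eventually] at hcon
    have := hlsc (m - ε / (2 * (C + 1))) (hcon.mono fun n hn => not_lt.1 hn)
    rw [hGG'] at this
    have : 0 < ε / (2 * (C + 1)) := by positivity
    linarith
  obtain ⟨N, hN⟩ := eventually_atTop.1 hev
  refine ⟨N, fun n hn => ?_⟩
  rw [Real.dist_0_eq_abs, abs_of_nonneg (modular_nonneg h)]
  have h3 := hC _ _ (hw n).3 hu.3
  have h4 : ε / (4 * (m + 1)) * (modular φ μ (g n) + modular φ μ G) ≤ ε / 2 := by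
    rw [div_mul_eq_mul_div, div_le_div_iff₀ (by positivity) two_pos]
    nlinarith [hle n]
  have h5 : C * ((modular φ μ (g n) + modular φ μ G) / 2 -
      modular φ μ ((1 / 2 : ℝ) • (g n + G))) ≤ C * (ε / (2 * (C + 1))) :=
    mul_le_mul_of_nonneg_left (by linarith [hN n hn, hle n]) hC0
  have h6 : C * (ε / (2 * (C + 1))) < ε / 2 := by
    rw [mul_div_assoc', div_lt_div_iff₀ (by positivity) two_pos]
    nlinarith
  linarith

end LdG

namespace LdG

/-! ### Luxemburg norms and modulars -/

section Luxemburg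

variable {d : ℕ} {Ω : Set (E d)} {φ : ℝ → ℝ} {F : Type} [NormedAddCommGroup F]

theorem luxNorm_nonneg (u : E d → ℝ) : 0 ≤ luxNorm φ Ω u :=
  Real.sInf_nonneg fun _ hr => hr.1.le

theorem MemMod.lintegral_eq (h : IsPowerConvexDensity φ) {u : E d → F}
    (hu : MemMod φ (volume.restrict Ω) u) :
    ∫⁻ x in Ω, ENNReal.ofReal (φ ‖u x‖) = ENNReal.ofReal (modular φ (volume.restrict Ω) u) :=
  (ofReal_integral_eq_lintegral_ofReal hu.2 (ae_of_all _ fun _ => h.norm_nonneg _)).symm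

/-- For a convex `φ` vanishing at `0`, the modular of `u` is at most the Luxemburg norm whenever the
latter is less than `1`. -/
theorem modular_lt_of_luxNorm_lt (h : IsPowerConvexDensity φ) {u : E d → F}
    (hu : MemMod φ (volume.restrict Ω) u) {ε : ℝ} (hε : ε ≤ 1)
    (hlt : luxNorm φ Ω (fun x => ‖u x‖) < ε) : modular φ (volume.restrict Ω) u < ε := by
  have hm0 := modular_nonneg h (μ := volume.restrict Ω) (u := u)
  -- the defining set of the Luxemburg norm is nonempty, so that its infimum is not a junk value
  have hne : {r : ℝ | 0 < r ∧ ∫⁻ x in Ω, ENNReal.ofReal (φ (|‖u x‖| / r)) ≤ 1}.Nonempty := by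
    set r := modular φ (volume.restrict Ω) u + 1 with hr
    have hr0 : 0 < r := by linarith
    refine ⟨r, hr0, ?_⟩
    calc ∫⁻ x in Ω, ENNReal.ofReal (φ (|‖u x‖| / r))
        ≤ ∫⁻ x in Ω, ENNReal.ofReal r⁻¹ * ENNReal.ofReal (φ ‖u x‖) := by
          refine lintegral_mono fun x => ?_
          simp only
          rw [← ENNReal.ofReal_mul (inv_nonneg.2 hr0.le), abs_norm, div_eq_inv_mul]
          exact ENNReal.ofReal_le_ofReal (h.mul_le (inv_nonneg.2 hr0.le)
            (inv_le_one_of_one_le₀ (by linarith)) (norm_nonneg _))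
      _ = ENNReal.ofReal (r⁻¹ * modular φ (volume.restrict Ω) u) := by
          rw [lintegral_const_mul' _ _ ENNReal.ofReal_ne_top, hu.lintegral_eq h,
            ← ENNReal.ofReal_mul (inv_nonneg.2 hr0.le)]
      _ ≤ 1 := by
          rw [ENNReal.ofReal_le_one, inv_mul_le_iff₀ hr0]
          linarith
  obtain ⟨r, ⟨hr0, hr⟩, hrε⟩ := exists_lt_of_csInf_lt hne hlt
  refine lt_of_le_of_lt ?_ hrε
  rw [← ENNReal.ofReal_le_ofReal_iff hr0.le, ← hu.lintegral_eq h]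
  calc ∫⁻ x in Ω, ENNReal.ofReal (φ ‖u x‖)
      ≤ ∫⁻ x in Ω, ENNReal.ofReal r * ENNReal.ofReal (φ (|‖u x‖| / r)) := by
        refine lintegral_mono fun x => ?_
        simp only
        rw [← ENNReal.ofReal_mul hr0.le, abs_norm]
        refine ENNReal.ofReal_le_ofReal ?_
        have := h.mul_le hr0.le (hrε.le.trans hε) (t := ‖u x‖ / r) (by positivity)
        rwa [mul_div_cancel₀ _ hr0.ne'] at this
    _ ≤ ENNReal.ofReal r := by
        rw [lintegral_const_mul' _ _ ENNReal.ofReal_ne_top]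
        exact (mul_le_mul_right hr _).trans (mul_one _).le

/-- By the doubling property of `φ`, a small modular forces a small Luxemburg norm, uniformly in the
domain and in the map. -/
theorem exists_luxNorm_le (h : IsPowerConvexDensity φ) {ε : ℝ} (hε : 0 < ε) :
    ∃ δ, 0 < δ ∧ ∀ (Ω : Set (E d)) (F : Type) [NormedAddCommGroup F] (u : E d → F),
      MemMod φ (volume.restrict Ω) u → modular φ (volume.restrict Ω) u < δ →
        luxNorm φ Ω (fun x => ‖u x‖) ≤ ε := by
  obtain ⟨K, hK0, hK⟩ := h.exists_mul_le ε⁻¹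
  refine ⟨1 / (K + 1), by positivity, fun Ω F _ u hu hlt => ?_⟩
  refine csInf_le ⟨0, fun r hr => hr.1.le⟩ ⟨hε, ?_⟩
  calc ∫⁻ x in Ω, ENNReal.ofReal (φ (|‖u x‖| / ε))
      ≤ ∫⁻ x in Ω, ENNReal.ofReal K * ENNReal.ofReal (φ ‖u x‖) := by
        refine lintegral_mono fun x => ?_
        simp only
        rw [← ENNReal.ofReal_mul hK0, abs_norm]
        exact ENNReal.ofReal_le_ofReal (hK _ _ (by positivity) (div_eq_inv_mul _ _).le
          (norm_nonneg _))
    _ = ENNReal.ofReal (K * modular φ (volume.restrict Ω) u) := by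
        rw [lintegral_const_mul' _ _ ENNReal.ofReal_ne_top, hu.lintegral_eq h,
          ← ENNReal.ofReal_mul hK0]
    _ ≤ 1 := by
        rw [ENNReal.ofReal_le_one]
        rw [lt_div_iff₀ (by positivity)] at hlt
        nlinarith [modular_nonneg h (μ := volume.restrict Ω) (u := u)]

theorem tendsto_luxNorm (h : IsPowerConvexDensity φ) {w : ℕ → E d → F}
    (hw : ∀ n, MemMod φ (volume.restrict Ω) (w n))
    (hlim : Tendsto (fun n => modular φ (volume.restrict Ω) (w n)) atTop (𝓝 0)) :
    Tendsto (fun n => luxNorm φ Ω (fun x => ‖w n x‖)) atTop (𝓝 0) := by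
  rw [Metric.tendsto_atTop]
  intro ε hε
  obtain ⟨δ, hδ, hle⟩ := exists_luxNorm_le (d := d) h (half_pos hε)
  obtain ⟨N, hN⟩ := eventually_atTop.1 (hlim.eventually_lt_const hδ)
  refine ⟨N, fun n hn => ?_⟩
  rw [Real.dist_0_eq_abs, abs_of_nonneg (luxNorm_nonneg _)]
  linarith [hle Ω F (w n) (hw n) (hN n hn)]

end Luxemburg

/-! ### Matrix-valued maps as vector-valued maps -/

variable {d : ℕ} {Ω : Set (E d)} {φ : ℝ → ℝ}

/-- The matrix-valued map `Q`, as a map with values in the Euclidean space `ℝ⁹`. -/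
noncomputable def vec (Q : E d → Mat) (x : E d) : EuclideanSpace ℝ (Fin 3 × Fin 3) :=
  WithLp.toLp 2 fun p => Q x p.1 p.2

/-- The weak gradient on `Ω` of the matrix-valued map `Q`, with values in a Euclidean space. -/
noncomputable def gvec (Ω : Set (E d)) (Q : E d → Mat) (x : E d) :
    EuclideanSpace ℝ (Fin d × Fin 3 × Fin 3) :=
  WithLp.toLp 2 fun p => weakGrad Ω Q x p.1 p.2.1 p.2.2

/-- The matrix-valued map with the entries of `u`. -/
def unvec (u : E d → EuclideanSpace ℝ (Fin 3 × Fin 3)) (x : E d) : Mat :=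
  Matrix.of fun i j => u x (i, j)

theorem norm_vec (Q : E d → Mat) (x : E d) : ‖vec Q x‖ = matNorm (Q x) := by
  rw [EuclideanSpace.norm_eq, matNorm, Fintype.sum_prod_type]
  simp [vec]

theorem norm_gvec (Q : E d → Mat) (x : E d) : ‖gvec Ω Q x‖ = gradNorm (weakGrad Ω Q x) := by
  rw [EuclideanSpace.norm_eq, gradNorm, Fintype.sum_prod_type]
  simp [gvec, Fintype.sum_prod_type]

theorem elasticEnergy_eq (V : Set (E d)) (Q : E d → Mat) :
    elasticEnergy φ Ω V Q = modular φ (volume.restrict V) (gvec Ω Q) := by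
  simp only [elasticEnergy, modular, norm_gvec]

theorem aestronglyMeasurable_of_components {ι : Type*} [Fintype ι] {α : Type*} [MeasurableSpace α]
    {μ : Measure α} {f : α → EuclideanSpace ℝ ι}
    (h : ∀ i, AEStronglyMeasurable (fun x => f x i) μ) : AEStronglyMeasurable f μ := by
  have h1 : AEMeasurable (fun x => (f x).ofLp) μ := aemeasurable_pi_lambda _ fun i =>
    (h i).aemeasurable
  exact ((PiLp.continuous_toLp 2 _).measurable.comp_aemeasurable h1).aestronglyMeasurable

/-- The dimension has to be positive: for `d = 0` the measurability of `Q` itself, which comes from its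
weak derivatives, is not part of `MemW1`. -/
theorem MemW1.memSobolev [NeZero d] {Q : E d → Mat} (hQ : MemW1 φ Ω Q) :
    MemSobolev φ Ω (vec Q) (gvec Ω Q) := by
  have hg : IsGrad Ω (vec Q) (gvec Ω Q) := fun k p => by
    obtain ⟨v, hv⟩ := hQ.weakDiff k p.1 p.2
    exact hv.weakPartial
  refine ⟨hg, ⟨?_, ?_⟩, ⟨?_, ?_⟩⟩
  · exact aestronglyMeasurable_of_components fun p => by
      obtain ⟨v, hv⟩ := hQ.weakDiff 0 p.1 p.2
      exact hv.locInt.aestronglyMeasurable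
  · refine hQ.memOrlicz.2.congr (ae_of_all _ fun x => ?_)
    simp only [← norm_vec, abs_norm]
  · exact aestronglyMeasurable_of_components fun p =>
      (hg p.1 p.2).locInt_partial.aestronglyMeasurable
  · refine hQ.memOrlicz_grad.2.congr (ae_of_all _ fun x => ?_)
    simp only [← norm_gvec, abs_norm]

theorem gvec_ae_eq (hΩ : IsOpen Ω) {Q : E d → Mat}
    {G : E d → EuclideanSpace ℝ (Fin d × Fin 3 × Fin 3)}
    (hG : IsGrad Ω (vec Q) G) : gvec Ω Q =ᵐ[volume.restrict Ω] G := by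
  have hg : IsGrad Ω (vec Q) (gvec Ω Q) := fun k p => (hG k p).weakPartial
  exact hg.ae_eq hΩ hG

theorem MemSobolev.memW1 (hΩ : IsOpen Ω) {Q : E d → Mat}
    {G : E d → EuclideanSpace ℝ (Fin d × Fin 3 × Fin 3)} (hQ : MemSobolev φ Ω (vec Q) G) :
    MemW1 φ Ω Q := by
  have hg := hQ.3.congr (gvec_ae_eq hΩ hQ.1).symm
  refine ⟨fun k i j => ⟨_, hQ.1 k (i, j)⟩, ⟨?_, ?_⟩, ⟨?_, ?_⟩⟩
  · simpa only [norm_vec] using hQ.2.1.norm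
  · refine hQ.2.2.congr (ae_of_all _ fun x => ?_)
    simp only [← norm_vec, abs_norm]
  · simpa only [norm_gvec] using hg.1.norm
  · refine hg.2.congr (ae_of_all _ fun x => ?_)
    simp only [← norm_gvec, abs_norm]

theorem w1Norm_eq (Q : E d → Mat) : w1Norm φ Ω Q =
    luxNorm φ Ω (fun x => ‖vec Q x‖) + luxNorm φ Ω (fun x => ‖gvec Ω Q x‖) := by
  simp only [w1Norm, norm_vec, norm_gvec]

theorem isTest_vec {η : E d → Mat} (hη : η ∈ TestMaps Ω) : IsTest Ω (vec η) := by
  have hs : Function.support (vec η) ⊆ Function.support η := fun x hx h0 => hx (by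
    ext p
    simp [vec, h0])
  refine ⟨contDiff_euclidean.2 fun p => hη.1 p.1 p.2, hη.2.1.of_isClosed_subset
    (isClosed_tsupport _) (closure_mono hs), (closure_mono hs).trans hη.2.2⟩

theorem unvec_mem_testMaps {η : E d → EuclideanSpace ℝ (Fin 3 × Fin 3)} (hη : IsTest Ω η) :
    unvec η ∈ TestMaps Ω := by
  have hs : Function.support (unvec η) ⊆ Function.support η := fun x hx h0 => hx (by
    ext i j
    simp [unvec, h0])
  refine ⟨fun i j => contDiff_euclidean.1 hη.contDiff (i, j),
    hη.hasCompactSupport.of_isClosed_subset (isClosed_tsupport _) (closure_mono hs),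
    (closure_mono hs).trans hη.tsupport_subset⟩

/-- Modular convergence of the maps and of their gradients implies weak convergence, since it is
convergence in norm. -/
theorem tendstoWeakly_of_modular [NeZero d] (h : IsPowerConvexDensity φ) (hΩ : IsOpen Ω)
    {K : Submodule ℝ Mat} {Q : ℕ → E d → Mat} {Q₀ : E d → Mat} (hQ : ∀ k, Q k ∈ W1 φ Ω K)
    (hQ₀ : Q₀ ∈ W1 φ Ω K)
    (h1 : Tendsto (fun k => modular φ (volume.restrict Ω) (vec (Q k) - vec Q₀)) atTop (𝓝 0))
    (h2 : Tendsto (fun k => modular φ (volume.restrict Ω) (gvec Ω (Q k) - gvec Ω Q₀)) atTop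
      (𝓝 0)) : TendstoWeakly φ Ω K Q Q₀ := by
  refine ⟨hQ, hQ₀, fun ℓ hℓ => ?_⟩
  have hS : ∀ k, MemSobolev φ Ω (vec (Q k - Q₀)) (gvec Ω (Q k) - gvec Ω Q₀) := fun k =>
    ((hQ k).1.memSobolev).sub h (hQ₀.1.memSobolev)
  have hg : ∀ k, gvec Ω (Q k - Q₀) =ᵐ[volume.restrict Ω] gvec Ω (Q k) - gvec Ω Q₀ := fun k =>
    gvec_ae_eq hΩ (hS k).1
  have hW : ∀ k, Q k - Q₀ ∈ W1 φ Ω K := fun k => ⟨(hS k).memW1 hΩ, by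
    filter_upwards [(hQ k).2, hQ₀.2] with x hx hx0
    exact K.sub_mem hx hx0⟩
  have hn : Tendsto (fun k => w1Norm φ Ω (Q k - Q₀)) atTop (𝓝 0) := by
    simp only [w1Norm_eq]
    have e1 := tendsto_luxNorm h (fun k => (hS k).2) h1
    have e2 := tendsto_luxNorm (w := fun k => gvec Ω (Q k - Q₀)) h
      (fun k => (hS k).3.congr (hg k).symm) (by simpa only [modular_congr (hg _)] using h2)
    simpa using e1.add e2
  obtain ⟨c, hc⟩ := hℓ.bound
  rw [tendsto_iff_dist_tendsto_zero]
  refine squeeze_zero (fun _ => dist_nonneg) (fun k => ?_) (by simpa using hn.const_mul c)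
  have := hℓ.map_add (Q k - Q₀) (hW k) Q₀ hQ₀
  rw [sub_add_cancel] at this
  rw [Real.dist_eq, this, add_sub_cancel_right]
  exact hc _ (hW k)

variable [IsFiniteMeasure ((volume : Measure (E d)).restrict Ω)]

/-- Equality on the boundary, in terms of modulars: by the doubling property, the closure of the
test maps is the same for the Luxemburg norm and for modular convergence. -/
theorem eqOnBoundary_iff (h : IsPowerConvexDensity φ) (hΩ : IsOpen Ω) {Q P : E d → Mat}
    {G D : E d → EuclideanSpace ℝ (Fin d × Fin 3 × Fin 3)} (hQ : MemSobolev φ Ω (vec Q) G)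
    (hP : MemSobolev φ Ω (vec P) D) :
    EqOnBoundary φ Ω Q P ↔ IsTestLimit φ Ω (vec Q - vec P) (G - D) := by
  have hS : ∀ {η}, IsTest Ω η → MemSobolev φ Ω (vec Q - vec P - η) (G - D - grad η) :=
    fun hη => (hQ.sub h hP).sub h (hη.memSobolev h)
  constructor
  · rintro ⟨-, hlim⟩ ε hε
    obtain ⟨η, hη, hlt⟩ := hlim (min ε 1) (lt_min hε one_pos)
    have hT := isTest_vec hη
    have hv : vec (Q - P - η) = vec Q - vec P - vec η := rfl
    have hg : gvec Ω (Q - P - η) =ᵐ[volume.restrict Ω] G - D - grad (vec η) :=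
      gvec_ae_eq hΩ (hS hT).1
    rw [w1Norm_eq] at hlt
    have n1 := luxNorm_nonneg (φ := φ) (Ω := Ω) fun x => ‖vec (Q - P - η) x‖
    have n2 := luxNorm_nonneg (φ := φ) (Ω := Ω) fun x => ‖gvec Ω (Q - P - η) x‖
    refine ⟨vec η, hT, ?_, ?_⟩
    · exact (modular_lt_of_luxNorm_lt h (u := vec (Q - P - η)) (hS hT).2 (min_le_right ε 1)
        (by linarith)).trans_le (min_le_left ε 1)
    · rw [← modular_congr hg]
      exact (modular_lt_of_luxNorm_lt h ((hS hT).3.congr hg.symm) (min_le_right ε 1)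
        (by linarith)).trans_le (min_le_left ε 1)
  · intro hlim
    refine ⟨MemSobolev.memW1 (Q := Q - P) hΩ (hQ.sub h hP), fun ε hε => ?_⟩
    obtain ⟨δ, hδ, hle⟩ := exists_luxNorm_le (d := d) h (show 0 < ε / 3 by positivity)
    obtain ⟨η, hη, h1, h2⟩ := hlim δ hδ
    have hg : gvec Ω (Q - P - unvec η) =ᵐ[volume.restrict Ω] G - D - grad η :=
      gvec_ae_eq hΩ (hS hη).1
    refine ⟨unvec η, unvec_mem_testMaps hη, ?_⟩
    rw [w1Norm_eq]
    have e1 := hle Ω _ (vec (Q - P - unvec η)) (hS hη).2 h1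
    have e2 := hle Ω _ (gvec Ω (Q - P - unvec η)) ((hS hη).3.congr hg.symm)
      (by rwa [modular_congr hg])
    linarith

end LdG

namespace LdG

/-! ### Fourth moments -/

/-- `φ` is at most linear near `0` and at most quadratic at infinity, and `t ^ 2` is absorbed by
`ε * t ^ 4` and a multiple of `t` for `t ≥ 1`. -/
theorem IsElasticDensity.exists_le_add_pow_four {φ : ℝ → ℝ} (hφ : IsElasticDensity φ) {ε : ℝ}
    (hε : 0 < ε) : ∃ C, 0 ≤ C ∧ ∀ t, 0 ≤ t → φ t ≤ C * t + ε * t ^ 4 := by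
  have h := hφ.isPowerConvexDensity
  obtain ⟨C, hC0, hC⟩ := hφ.le_sq
  set δ := ε / (C + 1) with hδ
  have hδ0 : 0 < δ := by positivity
  have hφ1 := h.nonneg zero_le_one
  refine ⟨φ 1 + C / δ, by positivity, fun t ht => ?_⟩
  rcases le_total t 1 with h1 | h1
  · have e := h.mul_le ht h1 zero_le_one
    rw [mul_one] at e
    have : 0 ≤ C / δ * t + ε * t ^ 4 := by positivity
    linarith
  · have e1 : t ^ 2 ≤ δ * t ^ 4 + t / δ := by
      have h2 : 0 ≤ (δ * t ^ 2 - 1) ^ 2 / δ := by positivity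
      have h3 : (δ * t ^ 2 - 1) ^ 2 / δ = δ * t ^ 4 - 2 * t ^ 2 + 1 / δ := by
        field_simp; ring
      have h4 : 1 / δ ≤ t / δ := div_le_div_of_nonneg_right h1 hδ0.le
      nlinarith [sq_nonneg t]
    have e2 : C * δ ≤ ε := by
      rw [hδ, mul_div_assoc', div_le_iff₀ (by positivity)]
      nlinarith
    calc φ t ≤ C * t ^ 2 := hC t h1
      _ ≤ C * (δ * t ^ 4 + t / δ) := mul_le_mul_of_nonneg_left e1 hC0
      _ = C * δ * t ^ 4 + C / δ * t := by ring
      _ ≤ ε * t ^ 4 + C / δ * t :=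
          add_le_add_left (mul_le_mul_of_nonneg_right e2 (by positivity)) _
      _ ≤ (φ 1 + C / δ) * t + ε * t ^ 4 := by nlinarith [mul_nonneg hφ1 ht]

/-- Since `φ` grows at most quadratically, convergence in `L¹` and boundedness in `L⁴` imply
modular convergence. -/
theorem tendsto_modular_of_pow_four {φ : ℝ → ℝ} (hφ : IsElasticDensity φ) {α : Type*}
    [MeasurableSpace α] {μ : Measure α} {F : Type} [NormedAddCommGroup F]
    {v : ℕ → α → F} (h1 : ∀ n, Integrable (v n) μ) (h4 : ∀ n, Integrable (fun x => ‖v n x‖ ^ 4) μ)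
    {M : ℝ} (hM : ∀ n, ∫ x, ‖v n x‖ ^ 4 ∂μ ≤ M)
    (hlim : Tendsto (fun n => ∫ x, ‖v n x‖ ∂μ) atTop (𝓝 0)) :
    Tendsto (fun n => modular φ μ (v n)) atTop (𝓝 0) := by
  have h := hφ.isPowerConvexDensity
  have hM0 : 0 ≤ M := (integral_nonneg fun _ => by positivity).trans (hM 0)
  rw [Metric.tendsto_atTop]
  intro ε hε
  obtain ⟨C, hC0, hC⟩ := hφ.exists_le_add_pow_four (show 0 < ε / (2 * (M + 1)) by positivity)
  obtain ⟨N, hN⟩ := eventually_atTop.1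
    (hlim.eventually_lt_const (show 0 < ε / (2 * (C + 1)) by positivity))
  refine ⟨N, fun n hn => ?_⟩
  rw [Real.dist_0_eq_abs, abs_of_nonneg (modular_nonneg h)]
  have hi : Integrable (fun x => C * ‖v n x‖ + ε / (2 * (M + 1)) * ‖v n x‖ ^ 4) μ :=
    ((h1 n).norm.const_mul _).add ((h4 n).const_mul _)
  have hm : MemMod φ μ (v n) :=
    .of_le h (h1 n).1 hi (ae_of_all _ fun x => hC _ (norm_nonneg _))
  have e1 : modular φ μ (v n) ≤ ∫ x, (C * ‖v n x‖ + ε / (2 * (M + 1)) * ‖v n x‖ ^ 4) ∂μ :=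
    integral_mono hm.2 hi fun x => hC _ (norm_nonneg _)
  rw [integral_add ((h1 n).norm.const_mul _) ((h4 n).const_mul _), integral_const_mul,
    integral_const_mul] at e1
  have e2 : ε / (2 * (M + 1)) * ∫ x, ‖v n x‖ ^ 4 ∂μ ≤ ε / 2 := by
    rw [div_mul_eq_mul_div, div_le_div_iff₀ (by positivity) two_pos]
    nlinarith [hM n]
  have e3 := hN n hn
  have e4 : C * ∫ x, ‖v n x‖ ∂μ < ε / 2 := by
    rw [lt_div_iff₀ (by positivity)] at e3
    have : 0 ≤ ∫ x, ‖v n x‖ ∂μ := integral_nonneg fun _ => norm_nonneg _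
    nlinarith
  linarith

/-! ### Energy comparison -/

section

variable {d : ℕ} {Ω : Set (E d)} {φ : ℝ → ℝ} {A B C : ℝ}

theorem continuous_of_vec :
    Continuous fun x : EuclideanSpace ℝ (Fin 3 × Fin 3) =>
      (Matrix.of fun i j => x (i, j) : Mat) :=
  continuous_matrix fun i j => (EuclideanSpace.proj (𝕜 := ℝ) (i, j)).continuous

theorem ae_fB_nonneg (hA : 0 < A) (hB : 0 < B) (hC : 0 < C) {Q : E d → Mat}
    (hQ : Q ∈ W1 φ Ω S0) : ∀ᵐ x ∂volume.restrict Ω, 0 ≤ fB A B C (Q x) :=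
  hQ.2.mono fun _ hx => fB_nonneg hA hB hC hx

theorem eqOnBoundary_refl [IsFiniteMeasure ((volume : Measure (E d)).restrict Ω)]
    (h : IsPowerConvexDensity φ) (hΩ : IsOpen Ω) {Q : E d → Mat}
    (hQ : MemSobolev φ Ω (vec Q) (gvec Ω Q)) : EqOnBoundary φ Ω Q Q := by
  rw [eqOnBoundary_iff h hΩ hQ hQ, sub_self, sub_self]
  intro ε hε
  have hT : IsTest Ω (0 : E d → EuclideanSpace ℝ (Fin 3 × Fin 3)) :=
    ⟨contDiff_const, HasCompactSupport.zero, by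
      rw [tsupport_eq_empty_iff.2 rfl]; exact empty_subset _⟩
  have hg : grad (0 : E d → EuclideanSpace ℝ (Fin 3 × Fin 3)) = 0 := by
    ext x p
    simp [grad]
  have hz : ∀ {F : Type} [NormedAddCommGroup F],
      modular φ (volume.restrict Ω) (0 : E d → F) = 0 := by
    intro F _
    simp [modular, h.map_zero]
  refine ⟨0, hT, ?_, ?_⟩
  · rw [sub_self, hz]; exact hε
  · rw [hg, sub_self, hz]; exact hε

/-- Comparison of a minimizer with uniaxial maps, whose bulk energy vanishes. -/
theorem IsGlobalMinimizer.modular_add_le [NeZero d] (hA : 0 < A) (hB : 0 < B) (hC : 0 < C)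
    {Qb Q P : E d → Mat} {L : ℝ} (hQ : IsGlobalMinimizer φ Ω A B C Qb L Q)
    (hP : P ∈ W1 φ Ω (Nmin A B C)) (hPb : EqOnBoundary φ Ω P Qb) :
    modular φ (volume.restrict Ω) (gvec Ω Q) + 1 / L * ∫ x in Ω, fB A B C (Q x) ≤
      modular φ (volume.restrict Ω) (gvec Ω P) := by
  have h0 : ∀ᵐ x ∂volume.restrict Ω, fB A B C (P x) = 0 :=
    hP.2.mono fun x hx => fB_of_mem_Nmin hA hB hC hx
  have hPA : P ∈ Admissible φ Ω A B C Qb :=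
    ⟨⟨hP.1, hP.2.mono fun x hx => Nmin_subset_S0 hx⟩,
      (integrable_zero _ _ _).congr (h0.mono fun x hx => hx.symm), hPb⟩
  have hle := hQ.2 P hPA
  have e1 : energy φ Ω A B C L Q =
      modular φ (volume.restrict Ω) (gvec Ω Q) + 1 / L * ∫ x in Ω, fB A B C (Q x) := by
    have hi : Integrable (fun x => φ (gradNorm (weakGrad Ω Q x))) (volume.restrict Ω) := by
      simpa only [norm_gvec] using hQ.1.1.1.memSobolev.3.2
    rw [energy, integral_add hi (hQ.1.2.1.const_mul _), integral_const_mul, modular]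
    simp only [norm_gvec]
  have e2 : energy φ Ω A B C L P = modular φ (volume.restrict Ω) (gvec Ω P) := by
    refine integral_congr_ae (h0.mono fun x hx => ?_)
    simp only [norm_gvec, hx, mul_zero, add_zero]
  rwa [e1, e2] at hle

/-- The bulk energy bounds the fourth moment. -/
theorem integrable_pow_four_and_le [NeZero d]
    [IsFiniteMeasure ((volume : Measure (E d)).restrict Ω)] {a b : ℝ}
    (hab : ∀ Q ∈ S0, matNorm Q ^ 4 ≤ a * fB A B C Q + b) {Q : E d → Mat}
    (hQ : Q ∈ W1 φ Ω S0) (hi : IntegrableOn (fun x => fB A B C (Q x)) Ω) :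
    IntegrableOn (fun x => ‖vec Q x‖ ^ 4) Ω ∧ ∫ x in Ω, ‖vec Q x‖ ^ 4 ≤
      a * (∫ x in Ω, fB A B C (Q x)) + (volume.restrict Ω).real univ * b := by
  have hi' : IntegrableOn (fun x => a * fB A B C (Q x) + b) Ω :=
    (hi.const_mul a).add (integrable_const b)
  have hle : ∀ᵐ x ∂volume.restrict Ω, ‖vec Q x‖ ^ 4 ≤ a * fB A B C (Q x) + b :=
    hQ.2.mono fun x hx => by rw [norm_vec]; exact hab _ hx
  have h4 : IntegrableOn (fun x => ‖vec Q x‖ ^ 4) Ω :=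
    hi'.mono' (hQ.1.memSobolev.2.1.norm.pow 4) (hle.mono fun x hx => by
      rwa [Real.norm_of_nonneg (by positivity)])
  refine ⟨h4, (integral_mono_ae h4 hi' hle).trans (le_of_eq ?_)⟩
  rw [integral_add (hi.const_mul a) (integrable_const b), integral_const_mul, integral_const,
    smul_eq_mul]

theorem norm_sub_pow_four_le {F : Type*} [NormedAddCommGroup F] (x y : F) :
    ‖x - y‖ ^ 4 ≤ 8 * ‖x‖ ^ 4 + 8 * ‖y‖ ^ 4 := by
  have h1 : ‖x - y‖ ^ 4 ≤ (‖x‖ + ‖y‖) ^ 4 := pow_le_pow_left₀ (norm_nonneg _) (norm_sub_le _ _) 4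
  have h2 := add_pow_le (norm_nonneg x) (norm_nonneg y) 4
  norm_num at h2
  linarith

theorem integrable_sub_pow_four_and_le {α : Type*} [MeasurableSpace α] {μ : Measure α}
    [IsFiniteMeasure μ] {F : Type*} [NormedAddCommGroup F] {u v : α → F}
    (hu : AEStronglyMeasurable u μ) (hv : AEStronglyMeasurable v μ) {b M : ℝ}
    (hb : ∀ᵐ x ∂μ, ‖v x‖ ≤ b) (hi : Integrable (fun x => ‖u x‖ ^ 4) μ)
    (hM : ∫ x, ‖u x‖ ^ 4 ∂μ ≤ M) :
    Integrable (fun x => ‖u x - v x‖ ^ 4) μ ∧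
      ∫ x, ‖u x - v x‖ ^ 4 ∂μ ≤ 8 * M + μ.real univ * (8 * b ^ 4) := by
  have hi' : Integrable (fun x => 8 * ‖u x‖ ^ 4 + 8 * b ^ 4) μ :=
    (hi.const_mul 8).add (integrable_const _)
  have hle : ∀ᵐ x ∂μ, ‖u x - v x‖ ^ 4 ≤ 8 * ‖u x‖ ^ 4 + 8 * b ^ 4 := hb.mono fun x hx => by
    have := pow_le_pow_left₀ (norm_nonneg (v x)) hx 4
    linarith [norm_sub_pow_four_le (u x) (v x)]
  have h4 : Integrable (fun x => ‖u x - v x‖ ^ 4) μ :=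
    hi'.mono' ((hu.sub hv).norm.pow 4) (hle.mono fun x hx => by
      rwa [Real.norm_of_nonneg (by positivity)])
  refine ⟨h4, (integral_mono_ae h4 hi' hle).trans ?_⟩
  rw [integral_add (hi.const_mul 8) (integrable_const _), integral_const_mul, integral_const,
    smul_eq_mul]
  linarith

end

/-- Square integrability, from the fourth moment. -/
theorem integrable_sq_and_le {α : Type*} [MeasurableSpace α] {μ : Measure α} [IsFiniteMeasure μ]
    {F : Type*} [NormedAddCommGroup F] {u : α → F} (hu : AEStronglyMeasurable u μ) {M : ℝ}
    (hi : Integrable (fun x => ‖u x‖ ^ 4) μ) (hM : ∫ x, ‖u x‖ ^ 4 ∂μ ≤ M) :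
    Integrable (fun x => ‖u x‖ ^ 2) μ ∧ ∫ x, ‖u x‖ ^ 2 ∂μ ≤ μ.real univ + M := by
  have hi' : Integrable (fun x => 1 + ‖u x‖ ^ 4) μ := (integrable_const 1).add hi
  have hle : ∀ x, ‖u x‖ ^ 2 ≤ 1 + ‖u x‖ ^ 4 := fun x => by
    nlinarith [sq_nonneg (‖u x‖ ^ 2 - 1), sq_nonneg (‖u x‖ ^ 2)]
  have h2 : Integrable (fun x => ‖u x‖ ^ 2) μ :=
    hi'.mono' (hu.norm.pow 2) (ae_of_all _ fun x => by
      rw [Real.norm_of_nonneg (by positivity)]; exact hle x)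
  refine ⟨h2, (integral_mono h2 hi' hle).trans ?_⟩
  rw [integral_add (integrable_const 1) hi, integral_const, smul_eq_mul, mul_one]
  linarith

/-- A limit almost everywhere of maps whose bulk energies tend to `0` is uniaxial. -/
theorem ae_mem_Nmin_of_tendsto {d : ℕ} {Ω : Set (E d)} {φ : ℝ → ℝ} {A B C : ℝ} (hA : 0 < A)
    (hB : 0 < B) (hC : 0 < C) {R : ℕ → E d → Mat} {Q₀ : E d → Mat} (hR : ∀ n, R n ∈ W1 φ Ω S0)
    (hi : ∀ n, IntegrableOn (fun x => fB A B C (R n x)) Ω)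
    (hlim : Tendsto (fun n => ∫ x in Ω, fB A B C (R n x)) atTop (𝓝 0))
    (hae : ∀ᵐ x ∂volume.restrict Ω, Tendsto (fun n => R n x) atTop (𝓝 (Q₀ x))) :
    ∀ᵐ x ∂volume.restrict Ω, Q₀ x ∈ Nmin A B C := by
  have hcont : Continuous fun P : Mat => ENNReal.ofReal (fB A B C P) :=
    ENNReal.continuous_ofReal.comp continuous_fB
  have hm : ∀ n, AEMeasurable (fun x => ENNReal.ofReal (fB A B C (R n x)))
      (volume.restrict Ω) := fun n => (hi n).aemeasurable.ennreal_ofReal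
  have hae' : ∀ᵐ x ∂volume.restrict Ω, Tendsto (fun n => ENNReal.ofReal (fB A B C (R n x))) atTop
      (𝓝 (ENNReal.ofReal (fB A B C (Q₀ x)))) := hae.mono fun x hx => (hcont.tendsto _).comp hx
  have h0 : ∫⁻ x in Ω, ENNReal.ofReal (fB A B C (Q₀ x)) = 0 := by
    refine le_antisymm ?_ zero_le
    calc ∫⁻ x in Ω, ENNReal.ofReal (fB A B C (Q₀ x))
        = ∫⁻ x in Ω, liminf (fun n => ENNReal.ofReal (fB A B C (R n x))) atTop :=
          lintegral_congr_ae (hae'.mono fun x hx => hx.liminf_eq.symm)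
      _ ≤ liminf (fun n => ∫⁻ x in Ω, ENNReal.ofReal (fB A B C (R n x))) atTop :=
          lintegral_liminf_le' hm
      _ = 0 := by
          have e : ∀ n, ∫⁻ x in Ω, ENNReal.ofReal (fB A B C (R n x)) =
              ENNReal.ofReal (∫ x in Ω, fB A B C (R n x)) := fun n =>
            (ofReal_integral_eq_lintegral_ofReal (hi n) (ae_fB_nonneg hA hB hC (hR n))).symm
          simp only [e]
          have := (ENNReal.continuous_ofReal.tendsto 0).comp hlim
          rw [ENNReal.ofReal_zero] at this
          exact this.liminf_eq
  rw [lintegral_eq_zero_iff' (aemeasurable_of_tendsto_metrizable_ae atTop hm hae')] at h0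
  filter_upwards [h0, hae, ae_all_iff.2 fun n => (hR n).2] with x hx hxl hxS
  have hS : Q₀ x ∈ S0 := (Submodule.closed_of_finiteDimensional S0).mem_of_tendsto hxl
    (Eventually.of_forall hxS)
  exact mem_Nmin_of_fB_eq_zero hA hB hC hS
    (le_antisymm (ENNReal.ofReal_eq_zero.1 hx) (fB_nonneg hA hB hC hS))

end LdG

open LdG in
theorem lemma4 (d : ℕ) (hd : d = 2 ∨ d = 3) (Ω : Set (LdG.E d))
    (hΩ : LdG.IsSmoothDomain Ω) (hΩb : Bornology.IsBounded Ω)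
    (φ : ℝ → ℝ) (hφ : LdG.IsElasticDensity φ)
    (A B C : ℝ) (hA : 0 < A) (hB : 0 < B) (hC : 0 < C)
    (Qb : LdG.E d → LdG.Mat) (hQb : Qb ∈ LdG.W1 φ Ω (LdG.Nmin A B C))
    (Q : ℝ → LdG.E d → LdG.Mat)
    (hQ : ∀ L : ℝ, 0 < L → LdG.IsGlobalMinimizer φ Ω A B C Qb L (Q L)) :
    ∃ (Lk : ℕ → ℝ) (Q₀ : LdG.E d → LdG.Mat),
      (∀ k, 0 < Lk k) ∧ Tendsto Lk atTop (𝓝 0) ∧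
      LdG.TendstoWeakly φ Ω LdG.S0 (fun k => Q (Lk k)) Q₀ ∧
      LdG.IsPhiMinimizingUniaxial φ Ω A B C Qb Q₀ ∧
      ∀ V : Set (LdG.E d), LdG.IsSmoothDomain V → LdG.CompactlyIn V Ω →
        Tendsto (fun k => LdG.elasticEnergy φ Ω V (Q (Lk k))) atTop
          (𝓝 (LdG.elasticEnergy φ Ω V Q₀)) ∧
        Tendsto (fun k => 1 / Lk k * ∫ x in V, LdG.fB A B C (Q (Lk k) x)) atTop (𝓝 0) := by
  have : NeZero d := ⟨by omega⟩
  have : IsFiniteMeasure ((volume : Measure (E d)).restrict Ω) :=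
    ⟨by simpa using hΩb.measure_lt_top⟩
  have ho := hΩ.isOpen
  have h := hφ.isPowerConvexDensity
  set μ := (volume : Measure (E d)).restrict Ω with hμ
  have hSb : MemSobolev φ Ω (vec Qb) (gvec Ω Qb) := hQb.1.memSobolev
  set K := modular φ μ (gvec Ω Qb) with hK
  have hK0 : 0 ≤ K := modular_nonneg h
  obtain ⟨b, hb⟩ := exists_matNorm_le_of_Nmin (A := A) (B := B) (C := C)
  obtain ⟨α, β, hα, hβ, hαβ⟩ := exists_matNorm_pow_four_le hA hB hC
  -- uniform bounds for the minimizers with `L ≤ 1`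
  let L : ℕ → ℝ := fun k => 1 / ((k : ℝ) + 1)
  have hL0 : ∀ k, 0 < L k := fun k => by positivity
  have hL1 : ∀ k, L k ≤ 1 := fun k => by
    rw [div_le_one (by positivity)]; linarith [k.cast_nonneg (α := ℝ)]
  have hLlim : Tendsto L atTop (𝓝 0) := tendsto_one_div_add_atTop_nhds_zero_nat
  have hR : ∀ k, Q (L k) ∈ Admissible φ Ω A B C Qb := fun k => (hQ _ (hL0 k)).1
  have hSR : ∀ k, MemSobolev φ Ω (vec (Q (L k))) (gvec Ω (Q (L k))) := fun k =>
    (hR k).1.1.memSobolev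
  have hfB0 : ∀ k, 0 ≤ ∫ x in Ω, fB A B C (Q (L k) x) := fun k =>
    integral_nonneg_of_ae (ae_fB_nonneg hA hB hC (hR k).1)
  have hcomp : ∀ k P, P ∈ W1 φ Ω (Nmin A B C) → EqOnBoundary φ Ω P Qb →
      modular φ μ (gvec Ω (Q (L k))) + 1 / L k * ∫ x in Ω, fB A B C (Q (L k) x) ≤
        modular φ μ (gvec Ω P) := fun k P hP hPb =>
    (hQ _ (hL0 k)).modular_add_le hA hB hC hP hPb
  have hbulk0 : ∀ k, 0 ≤ 1 / L k * ∫ x in Ω, fB A B C (Q (L k) x) := fun k =>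
    mul_nonneg (one_div_nonneg.2 (hL0 k).le) (hfB0 k)
  have hgK : ∀ k, modular φ μ (gvec Ω (Q (L k))) ≤ K := fun k => by
    have := hcomp k Qb hQb (eqOnBoundary_refl h ho hSb)
    linarith [hbulk0 k]
  have hfBK : ∀ k, ∫ x in Ω, fB A B C (Q (L k) x) ≤ L k * K := fun k => by
    have h1 := hcomp k Qb hQb (eqOnBoundary_refl h ho hSb)
    have h2 : 1 / L k * ∫ x in Ω, fB A B C (Q (L k) x) ≤ K := by
      linarith [modular_nonneg h (μ := μ) (u := gvec Ω (Q (L k)))]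
    rwa [one_div, inv_mul_le_iff₀ (hL0 k)] at h2
  have hfBlim : Tendsto (fun k => ∫ x in Ω, fB A B C (Q (L k) x)) atTop (𝓝 0) :=
    squeeze_zero hfB0 hfBK (by simpa using hLlim.mul_const K)
  set M := α * K + μ.real univ * β with hM
  have hR4 : ∀ k, IntegrableOn (fun x => ‖vec (Q (L k)) x‖ ^ 4) Ω ∧
      ∫ x in Ω, ‖vec (Q (L k)) x‖ ^ 4 ≤ M := fun k => by
    obtain ⟨h1, h2⟩ := integrable_pow_four_and_le hαβ (hR k).1 (hR k).2.1
    refine ⟨h1, h2.trans ?_⟩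
    have : ∫ x in Ω, fB A B C (Q (L k) x) ≤ K := (hfBK k).trans (by
      nlinarith [hL1 k])
    exact add_le_add_left (mul_le_mul_of_nonneg_left this hα) _
  -- Rellich's theorem applies to `Q_L - Q_b`, which has zero boundary values
  have hl : ∀ k, IsTestLimit φ Ω (vec (Q (L k)) - vec Qb) (gvec Ω (Q (L k)) - gvec Ω Qb) :=
    fun k => (eqOnBoundary_iff h ho (hSR k) hSb).1 (hR k).2.2
  have hbQb : ∀ᵐ x ∂μ, ‖vec Qb x‖ ≤ b := hQb.2.mono fun x hx => by
    rw [norm_vec]; exact hb _ hx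
  obtain ⟨Kd, hKd0, hKd⟩ := exists_modular_add_le (μ := μ) h
  have hw4 := fun k => integrable_sub_pow_four_and_le (hSR k).2.1 hSb.2.1 hbQb (hR4 k).1 (hR4 k).2
  have hw2 := fun k => integrable_sq_and_le ((hSR k).2.1.sub hSb.2.1) (hw4 k).1 (hw4 k).2
  obtain ⟨ns, u, hns, hu, hulim⟩ := exists_subseq_tendsto_L1 h ho
    (fun k => (hSR k).sub h hSb) hl (K := Kd * (K + K))
    (fun k => by
      rw [sub_eq_add_neg]
      have hneg : modular φ μ (-gvec Ω Qb) = K := by simp [modular, hK]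
      refine (hKd _ _ _ (hSR k).3 hSb.3.neg).trans (mul_le_mul_of_nonneg_left ?_ hKd0)
      rw [hneg]
      exact add_le_add_left (hgK k) K)
    (fun k => (hw2 k).1) (fun k => (hw2 k).2)
  obtain ⟨ms, hms, hae⟩ := exists_subseq_ae_tendsto
    (fun n => ((hSR (ns n)).sub h hSb).2.memMod_integrable h) hu hulim
  let idx : ℕ → ℕ := fun n => ns (ms n)
  have hidx : Tendsto idx atTop atTop := hns.tendsto_atTop.comp hms.tendsto_atTop
  -- the limit of `Q_L - Q_b` is `u`
  let Q₀ : E d → Mat := unvec (u + vec Qb)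
  have hvQ₀ : vec Q₀ = u + vec Qb := rfl
  have hQ₀m : AEStronglyMeasurable (vec Q₀) μ := hu.1.add hSb.2.1
  have hQ₀N : ∀ᵐ x ∂μ, Q₀ x ∈ Nmin A B C := by
    refine ae_mem_Nmin_of_tendsto hA hB hC (fun n => (hR (idx n)).1) (fun n => (hR (idx n)).2.1)
      (hfBlim.comp hidx) (hae.mono fun x hx => ?_)
    have := (continuous_of_vec.tendsto _).comp (hx.add_const (vec Qb x))
    refine this.congr fun n => ?_
    rw [Function.comp_apply, Pi.sub_apply, sub_add_cancel]
    rfl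
  have hbQ₀ : ∀ᵐ x ∂μ, ‖vec Q₀ x‖ ≤ b := hQ₀N.mono fun x hx => by
    rw [norm_vec]; exact hb _ hx
  have hMQ₀ : MemMod φ μ (vec Q₀) := .of_le h hQ₀m (integrable_const (φ b))
    (hbQ₀.mono fun x hx => h.monotoneOn (mem_Ici.2 (norm_nonneg _))
      (mem_Ici.2 ((norm_nonneg _).trans hx)) hx)
  have hlim1 : Tendsto (fun n => modular φ μ (vec (Q (L (idx n))) - vec Q₀)) atTop (𝓝 0) := by
    have hd4 := fun n => integrable_sub_pow_four_and_le (hSR (idx n)).2.1 hQ₀m hbQ₀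
      (hR4 (idx n)).1 (hR4 (idx n)).2
    refine tendsto_modular_of_pow_four hφ
      (fun n => ((hSR (idx n)).2.sub h hMQ₀).memMod_integrable h) (fun n => (hd4 n).1)
      (fun n => (hd4 n).2) ((hulim.comp hms.tendsto_atTop).congr fun n => ?_)
    refine integral_congr_ae (ae_of_all _ fun x => ?_)
    simp only [hvQ₀, Pi.sub_apply, Pi.add_apply]
    rw [sub_sub, add_comm (vec Qb x)]
  -- lower semicontinuity provides the weak gradient `G` of `Q₀`, its boundary values, and the bound
  -- of its energy
  obtain ⟨G, hSG, hlG, hlsc⟩ := exists_grad_of_tendsto_modular h (fun n => hSR (idx n))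
    (fun n => hgK (idx n)) hMQ₀ hlim1 hSb (fun n => hl (idx n))
  have hGQ : gvec Ω Q₀ =ᵐ[μ] G := gvec_ae_eq ho hSG.1
  have hQ₀W : MemW1 φ Ω Q₀ := hSG.memW1 ho
  have hSQ₀ : MemSobolev φ Ω (vec Q₀) (gvec Ω Q₀) := hQ₀W.memSobolev
  have hQ₀b : EqOnBoundary φ Ω Q₀ Qb := (eqOnBoundary_iff h ho hSG hSb).2 hlG
  have hQ₀1 : Q₀ ∈ W1 φ Ω (Nmin A B C) := ⟨hQ₀W, hQ₀N⟩
  have hmin : IsPhiMinimizingUniaxial φ Ω A B C Qb Q₀ := by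
    refine ⟨hQ₀1, hQ₀b, fun P hP hPb => ?_⟩
    rw [elasticEnergy_eq, elasticEnergy_eq, modular_congr hGQ]
    refine hlsc _ (Frequently.of_forall fun n => ?_)
    linarith [hcomp (idx n) P hP hPb, hbulk0 (idx n)]
  -- `Q₀` is itself a uniaxial competitor, so no energy is lost in the limit
  have hle : ∀ n, modular φ μ (gvec Ω (Q (L (idx n)))) ≤ modular φ μ (gvec Ω Q₀) := fun n => by
    linarith [hcomp (idx n) Q₀ hQ₀1 hQ₀b, hbulk0 (idx n)]
  have hlim2 := tendsto_modular_grad_sub h ho (fun n => hSR (idx n)) hSQ₀ hle hlim1 hSb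
    (fun n => hl (idx n)) ((eqOnBoundary_iff h ho hSQ₀ hSb).1 hQ₀b)
  have hconv : ∀ V ⊆ Ω, Tendsto (fun n => elasticEnergy φ Ω V (Q (L (idx n)))) atTop
      (𝓝 (elasticEnergy φ Ω V Q₀)) := by
    intro V hV
    have hmono : (volume : Measure (E d)).restrict V ≤ μ := Measure.restrict_mono hV le_rfl
    have hmV : ∀ {F : Type} [NormedAddCommGroup F] {f : E d → F}, MemMod φ μ f →
        MemMod φ (volume.restrict V) f := fun hf =>
      ⟨hf.1.mono_measure hmono, hf.2.mono_measure hmono⟩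
    have hmle : ∀ {F : Type} [NormedAddCommGroup F] {f : E d → F}, MemMod φ μ f →
        modular φ (volume.restrict V) f ≤ modular φ μ f := fun hf =>
      integral_mono_measure hmono (ae_of_all _ fun _ => h.norm_nonneg _) hf.2
    simp only [elasticEnergy_eq]
    refine tendsto_modular h (fun n => hmV (hSR (idx n)).3) (hmV hSQ₀.3)
      (fun n => (hmle (hSR (idx n)).3).trans (hgK _)) ?_
    exact squeeze_zero (fun n => modular_nonneg h) (fun n => hmle ((hSR (idx n)).3.sub h hSQ₀.3))
      hlim2
  refine ⟨fun n => L (idx n), Q₀, fun n => hL0 _, hLlim.comp hidx, ?_, hmin,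
    fun V hV hVΩ => ⟨hconv V (subset_closure.trans hVΩ.2), ?_⟩⟩
  · exact tendstoWeakly_of_modular h ho (fun n => (hR (idx n)).1)
      ⟨hQ₀W, hQ₀N.mono fun x hx => Nmin_subset_S0 hx⟩ hlim1 hlim2
  · have hV' : V ⊆ Ω := subset_closure.trans hVΩ.2
    have e1 := (hconv Ω Subset.rfl).const_sub (elasticEnergy φ Ω Ω Q₀)
    rw [sub_self] at e1
    refine squeeze_zero (fun n => ?_) (fun n => ?_) e1
    · exact mul_nonneg (one_div_nonneg.2 (hL0 _).le) (integral_nonneg_of_ae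
        (ae_restrict_of_ae_restrict_of_subset hV' (ae_fB_nonneg hA hB hC (hR (idx n)).1)))
    · have e2 := hcomp (idx n) Q₀ hQ₀1 hQ₀b
      have e3 : ∫ x in V, fB A B C (Q (L (idx n)) x) ≤ ∫ x in Ω, fB A B C (Q (L (idx n)) x) :=
        setIntegral_mono_set (hR (idx n)).2.1 (ae_fB_nonneg hA hB hC (hR (idx n)).1)
          (LE.le.eventuallyLE hV')
      have e4 := mul_le_mul_of_nonneg_left e3 (one_div_nonneg.2 (hL0 (idx n)).le)
      rw [elasticEnergy_eq, elasticEnergy_eq]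
      linarith
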